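/- Let $M$ be an oriented smooth 3-manifold (Hausdorff, second countable, not necessarily compact), let $\pi:P\to M$ be a smooth principal $\mathrm{SU}(2)$-bundle with $P$ oriented, and let $\mathrm{Tr}$ be the trace of $2\times 2$ matrices. For a real 3-form $\Omega$ on $P$ and a volume form $v$ on $P$ in the orientation class, define $K_\Omega:T^*P\to T^*P$ by $i_\xi(K_\Omega\alpha)=(\alpha\wedge i_\xi\Omega\wedge\Omega)/v$ and $\lambda(\Omega)=\frac16\mathrm{Tr}(K_\Omega^2)$; $\Omega$ is stable of negative type if $\lambda(\Omega)<0$ everywhere, and then its Hitchin functional is $S[\Omega]=\int_P v_\Omega\in[0,\infty]$, where $v_\Omega=\sqrt{-\lambda(\Omega)}\,v$ (independent of the choice of $v$). Let $W$ be a smooth connection on $P$, viewed as an $\mathfrak{su}(2)$-valued 1-form on $P$, with curvature $F(W)=dW+W\wedge W$, which is negative definite, that is, the Chern-Simons form $CS(W)=\mathrm{Tr}\left(W\wedge dW+\frac23 W\wedge W\wedge W\right)$ is stable of negative type on $P$. Then there is a unique horizontal $\mathfrak{su}(2)$-valued 1-form $E_W$ on $P$ such that $F(W)=E_W\wedge E_W$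 and $-\frac23\mathrm{Tr}(E_W\wedge E_W\wedge E_W)$ is a positive multiple of the pullback of an orientation form of $M$; it is smooth and $\mathrm{SU}(2)$-equivariant. Let $\mathrm{Vol}_W$ be the Riemannian volume measure on $M$ of the metric whose pullback to $P$ is $-2\,\mathrm{Tr}(E_W\otimes E_W)$. The following hold. (1) $S[CS(W)]=c\cdot \mathrm{Vol}_W(M)$, as an identity in $[0,\infty]$, where $c=\left|\int_{\mathrm{SU}(2)}\frac13\mathrm{Tr}(m\wedge m\wedge m)\right|$, with $m=g^{-1}dg$ the Maurer-Cartan form, is the fibre volume; it is a universal constant with $0<c<\infty$. (2) $W$ is a critical point of the volume if and only if the torsion-free condition $\nabla_W E_W=dE_W+W\wedge E_W+E_W\wedge W=0$ holds. Here $W$ is a critical point if $\frac{d}{dt}\big|_{t=0}\mathrm{Vol}_{W+tA}(K)$ exists and equals $0$ for every compact $K\subseteq M$ and every smooth, horizontal, equivariant $\mathfrak{su}(2)$-valued 1-form $A$ on $P$ that vanishes outside $\pi^{-1}(K)$ (for compact $M$ one may take $K=M$). -/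

import Mathlib

open scoped Manifold ContDiff Quaternion ENNReal Topology
open MeasureTheory

noncomputable section

namespace HitchinGravity

/-! ### The group `SU(2)`, its Lie algebra and the trace

`SU(2)` is realised as the group of unit quaternions and `su(2)` as the imaginary quaternions. The
isomorphism with `2 × 2` matrices sends `i, j, k` to `-I σ₁, -I σ₂, -I σ₃` (Pauli matrices), so the
usual generators `τ_a = -(I/2) σ_a` are `i/2, j/2, k/2`. -/

/-- The group `SU(2)` as the group of unit quaternions. -/
abbrev SU2 : Type := Metric.sphere (0 : ℍ[ℝ]) 1

instance factFinrankQuaternion : Fact (Module.finrank ℝ ℍ[ℝ] = 3 + 1) :=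
  ⟨Quaternion.finrank_eq_four⟩

instance measurableSpaceSU2 : MeasurableSpace SU2 := borel SU2

instance borelSpaceSU2 : BorelSpace SU2 := ⟨rfl⟩

/-- The `2 × 2` complex matrix `a - I (b σ₁ + c σ₂ + d σ₃)` of the quaternion `a + bi + cj + dk`. -/
def toMatrix (q : ℍ[ℝ]) : Matrix (Fin 2) (Fin 2) ℂ :=
  !![⟨q.re, -q.imK⟩, ⟨-q.imJ, -q.imI⟩; ⟨q.imJ, -q.imI⟩, ⟨q.re, q.imK⟩]

theorem toMatrix_mul (p q : ℍ[ℝ]) : toMatrix (p * q) = toMatrix p * toMatrix q := by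
  ext i j
  fin_cases i <;> fin_cases j <;>
    simp [toMatrix, Matrix.mul_apply, Fin.sum_univ_two, Complex.ext_iff] <;>
    constructor <;> ring

theorem det_toMatrix (q : ℍ[ℝ]) : (toMatrix q).det = (Quaternion.normSq q : ℝ) := by
  rw [Quaternion.normSq_def', Matrix.det_fin_two]
  simp [toMatrix, Complex.ext_iff, pow_two]
  constructor <;> ring

theorem toMatrix_star (q : ℍ[ℝ]) : toMatrix (star q) = star (toMatrix q) := by
  ext i j
  fin_cases i <;> fin_cases j <;> simp [toMatrix, Matrix.star_apply, Complex.ext_iff]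

theorem toMatrix_one : toMatrix 1 = 1 := by
  ext i j
  fin_cases i <;> fin_cases j <;> simp [toMatrix, Complex.ext_iff]

/-- Under `toMatrix` the unit quaternions are exactly the special unitary `2 × 2` matrices. -/
theorem mem_specialUnitaryGroup_iff_exists (A : Matrix (Fin 2) (Fin 2) ℂ) :
    A ∈ Matrix.specialUnitaryGroup (Fin 2) ℂ ↔ ∃! g : SU2, toMatrix (g : ℍ[ℝ]) = A := by
  constructor
  · intro hA
    obtain ⟨hU, hd⟩ := Matrix.mem_specialUnitaryGroup_iff.1 hA
    have h1 : A * star A = 1 := Matrix.mem_unitaryGroup_iff.1 hU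
    have h2 : A.adjugate = star A := by
      calc A.adjugate = A.adjugate * (A * star A) := by rw [h1, mul_one]
        _ = star A := by rw [← mul_assoc, Matrix.adjugate_mul, hd, one_smul, one_mul]
    have e1 : A 1 1 = star (A 0 0) := by
      simpa [Matrix.adjugate_fin_two] using congrFun (congrFun h2 0) 0
    have e2 : -A 0 1 = star (A 1 0) := by
      simpa [Matrix.adjugate_fin_two] using congrFun (congrFun h2 0) 1
    obtain ⟨q, hq⟩ : ∃ q : ℍ[ℝ], toMatrix q = A := by
      refine ⟨⟨(A 0 0).re, -(A 1 0).im, (A 1 0).re, -(A 0 0).im⟩, ?_⟩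
      have e1r := congrArg Complex.re e1
      have e1i := congrArg Complex.im e1
      have e2r := congrArg Complex.re e2
      have e2i := congrArg Complex.im e2
      simp at e1r e1i e2r e2i
      ext i j
      fin_cases i <;> fin_cases j <;> simp [toMatrix, Complex.ext_iff] <;>
        constructor <;> linarith
    have hn : ‖q‖ = 1 := by
      have h3 := det_toMatrix q
      rw [hq, hd, Quaternion.normSq_eq_norm_mul_self] at h3
      have h4 : ‖q‖ * ‖q‖ = 1 := by exact_mod_cast h3.symm
      nlinarith [norm_nonneg q]
    refine ⟨⟨_, mem_sphere_zero_iff_norm.2 hn⟩, hq, fun g hg => Subtype.ext ?_⟩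
    rw [← hq] at hg
    have h00 := congrFun (congrFun hg 0) 0
    have h10 := congrFun (congrFun hg 1) 0
    simp [toMatrix, Complex.ext_iff] at h00 h10
    ext <;> simp [h00, h10]
  · rintro ⟨g, rfl, -⟩
    have hn : ‖(g : ℍ[ℝ])‖ = 1 := mem_sphere_zero_iff_norm.1 g.2
    have hs : Quaternion.normSq (g : ℍ[ℝ]) = 1 := by
      rw [Quaternion.normSq_eq_norm_mul_self, hn, mul_one]
    refine Matrix.mem_specialUnitaryGroup_iff.2 ⟨Matrix.mem_unitaryGroup_iff.2 ?_, ?_⟩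
    · rw [← toMatrix_star, ← toMatrix_mul, Quaternion.self_mul_star, hs, Quaternion.coe_one,
        toMatrix_one]
    · rw [det_toMatrix, hs]; simp

/-- The trace of `2 × 2` matrices, as a linear form on quaternions. -/
def tr : ℍ[ℝ] →ₗ[ℝ] ℝ where
  toFun q := 2 * q.re
  map_add' p q := by simp; ring
  map_smul' c q := by simp; ring

theorem trace_toMatrix (q : ℍ[ℝ]) : (toMatrix q).trace = (tr q : ℂ) := by
  simp [toMatrix, tr, Matrix.trace, Fin.sum_univ_two, Complex.ext_iff]; ring

/-! ### Linear algebra of exterior forms -/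

section Linear

variable {V : Type*} [AddCommGroup V] [Module ℝ V] {A : Type*} [Ring A] [Algebra ℝ A]

/-- The wedge product of forms with values in an algebra, with the normalisation
`(α ∧ β)(X, Y) = α(X) β(Y) - α(Y) β(X)` for 1-forms. -/
def wedge {k l : ℕ} (α : V [⋀^Fin k]→ₗ[ℝ] A) (β : V [⋀^Fin l]→ₗ[ℝ] A) :
    V [⋀^Fin (k + l)]→ₗ[ℝ] A :=
  ((LinearMap.mul' ℝ A).compAlternatingMap (α.domCoprod β)).domDomCongr finSumFinEquiv

theorem wedge_add_left {k l : ℕ} (α α' : V [⋀^Fin k]→ₗ[ℝ] A) (β : V [⋀^Fin l]→ₗ[ℝ] A) :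
    wedge (α + α') β = wedge α β + wedge α' β := by
  simp only [wedge, ← AlternatingMap.domCoprod'_apply, TensorProduct.add_tmul, map_add]
  ext; simp

theorem wedge_add_right {k l : ℕ} (α : V [⋀^Fin k]→ₗ[ℝ] A) (β β' : V [⋀^Fin l]→ₗ[ℝ] A) :
    wedge α (β + β') = wedge α β + wedge α β' := by
  simp only [wedge, ← AlternatingMap.domCoprod'_apply, TensorProduct.tmul_add, map_add]
  ext; simp

theorem wedge_smul_left {k l : ℕ} (c : ℝ) (α : V [⋀^Fin k]→ₗ[ℝ] A) (β : V [⋀^Fin l]→ₗ[ℝ] A) :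
    wedge (c • α) β = c • wedge α β := by
  simp only [wedge, ← AlternatingMap.domCoprod'_apply]
  rw [← TensorProduct.smul_tmul', map_smul]
  ext; simp

theorem wedge_smul_right {k l : ℕ} (c : ℝ) (α : V [⋀^Fin k]→ₗ[ℝ] A) (β : V [⋀^Fin l]→ₗ[ℝ] A) :
    wedge α (c • β) = c • wedge α β := by
  simp only [wedge, ← AlternatingMap.domCoprod'_apply, TensorProduct.tmul_smul, map_smul]
  ext; simp

/-- A linear form as an exterior 1-form. -/
def oneForm (α : Module.Dual ℝ V) : V [⋀^Fin 1]→ₗ[ℝ] ℝ :=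
  AlternatingMap.ofSubsingleton ℝ V ℝ (0 : Fin 1) α

theorem oneForm_add (α β : Module.Dual ℝ V) : oneForm (α + β) = oneForm α + oneForm β := by
  ext; simp [oneForm]

theorem oneForm_smul (c : ℝ) (α : Module.Dual ℝ V) : oneForm (c • α) = c • oneForm α := by
  ext; simp [oneForm]

end Linear

/-- The quotient `η / v` of a top-degree form by a nonzero top-degree form on an `n`-dimensional
space (evaluated on the standard basis; all top-degree forms are proportional). -/
def ratio {n : ℕ} (η v : EuclideanSpace ℝ (Fin n) [⋀^Fin n]→ₗ[ℝ] ℝ) : ℝ :=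
  η (EuclideanSpace.basisFun (Fin n) ℝ) / v (EuclideanSpace.basisFun (Fin n) ℝ)

theorem ratio_add {n : ℕ} (η η' v : EuclideanSpace ℝ (Fin n) [⋀^Fin n]→ₗ[ℝ] ℝ) :
    ratio (η + η') v = ratio η v + ratio η' v := by
  simp [ratio, add_div]

theorem ratio_smul {n : ℕ} (c : ℝ) (η v : EuclideanSpace ℝ (Fin n) [⋀^Fin n]→ₗ[ℝ] ℝ) :
    ratio (c • η) v = c • ratio η v := by
  simp [ratio, mul_div_assoc]

/-- The endomorphism `K_Ω` of the cotangent space, `i_ξ (K_Ω α) = (α ∧ i_ξ Ω ∧ Ω) / v`. -/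
def hitchinK (v : EuclideanSpace ℝ (Fin 6) [⋀^Fin 6]→ₗ[ℝ] ℝ)
    (Ω : EuclideanSpace ℝ (Fin 6) [⋀^Fin 3]→ₗ[ℝ] ℝ) :
    Module.Dual ℝ (EuclideanSpace ℝ (Fin 6)) →ₗ[ℝ] Module.Dual ℝ (EuclideanSpace ℝ (Fin 6)) :=
  LinearMap.mk₂ ℝ (fun α ξ => ratio (n := 6) (wedge (oneForm α) (wedge (Ω.curryLeft (n := 2) ξ) Ω)) v)
    (fun α β ξ => by
      rw [oneForm_add, wedge_add_left, ratio_add])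
    (fun c α ξ => by
      rw [oneForm_smul, wedge_smul_left, ratio_smul])
    (fun α ξ ζ => by
      rw [map_add, wedge_add_left, wedge_add_right, ratio_add])
    (fun c α ξ => by
      rw [map_smul, wedge_smul_left, wedge_smul_right, ratio_smul])

/-- The quartic invariant `λ(Ω) = (1/6) Tr (K_Ω²)`. -/
def hitchinLambda (v : EuclideanSpace ℝ (Fin 6) [⋀^Fin 6]→ₗ[ℝ] ℝ)
    (Ω : EuclideanSpace ℝ (Fin 6) [⋀^Fin 3]→ₗ[ℝ] ℝ) : ℝ :=
  (1 / 6) * LinearMap.trace ℝ _ (hitchinK v Ω * hitchinK v Ω)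

/-! ### Differential forms on manifolds -/

section Forms

variable {n : ℕ} {M : Type*} [TopologicalSpace M] [ChartedSpace (EuclideanSpace ℝ (Fin n)) M]
  {F : Type*} [NormedAddCommGroup F] [NormedSpace ℝ F]

variable (n M F) in
/-- Differential `k`-forms (not necessarily smooth) with values in `F` on an `n`-manifold. -/
abbrev DiffForm (k : ℕ) : Type _ := ∀ x : M, TangentSpace (𝓡 n) x [⋀^Fin k]→L[ℝ] F

/-- The pullback of a form to Euclidean space under the inverse of the preferred chart at `x₀`. -/
def chartRep {k : ℕ} (η : DiffForm n M F k) (x₀ : M) :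
    EuclideanSpace ℝ (Fin n) → EuclideanSpace ℝ (Fin n) [⋀^Fin k]→L[ℝ] F := fun y =>
  (η ((extChartAt (𝓡 n) x₀).symm y)).compContinuousLinearMap
    (mfderiv 𝓘(ℝ, EuclideanSpace ℝ (Fin n)) (𝓡 n) (extChartAt (𝓡 n) x₀).symm y)

/-- Smoothness of a differential form. -/
def IsSmoothForm {k : ℕ} (η : DiffForm n M F k) : Prop :=
  ∀ x₀ : M, ContDiffOn ℝ ∞ (chartRep η x₀) (extChartAt (𝓡 n) x₀).target

/-- The exterior derivative, computed at `x` in the preferred chart at `x`; by definition of the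
tangent space in Mathlib, this chart identifies `T_x M` with Euclidean space. -/
def extD {k : ℕ} (η : DiffForm n M F k) : DiffForm n M F (k + 1) := fun x =>
  (extDeriv (chartRep η x) (extChartAt (𝓡 n) x x) :
    EuclideanSpace ℝ (Fin n) [⋀^Fin (k + 1)]→L[ℝ] F)

/-- A smooth nowhere vanishing top-degree form; it represents an orientation of the manifold. -/
def IsVolumeForm (v : DiffForm n M ℝ n) : Prop :=
  IsSmoothForm v ∧ ∀ x, v x ≠ 0

/-- A function assigning to every `x` and every `n`-tuple of tangent vectors at `x` a number
(to be thought of as the volume of the parallelepiped that they span) defines in each chart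
a measure on the chart domain. -/
def chartMeasure [MeasurableSpace M] (ρ : ∀ x : M, (Fin n → TangentSpace (𝓡 n) x) → ℝ) (x₀ : M) :
    Measure M :=
  Measure.map (extChartAt (𝓡 n) x₀).symm
    ((volume.restrict (extChartAt (𝓡 n) x₀).target).withDensity fun y =>
      ENNReal.ofReal (ρ ((extChartAt (𝓡 n) x₀).symm y) fun i =>
        mfderiv 𝓘(ℝ, EuclideanSpace ℝ (Fin n)) (𝓡 n) (extChartAt (𝓡 n) x₀).symm y
          (EuclideanSpace.basisFun (Fin n) ℝ i)))

/-- The measure on a manifold defined by a (nonnegative) density `ρ`. For a density the measures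
`chartMeasure ρ x₀` agree on overlaps of charts, and their supremum in the lattice of measures is
the measure that restricts to each of them. -/
def densityMeasure [MeasurableSpace M] (ρ : ∀ x : M, (Fin n → TangentSpace (𝓡 n) x) → ℝ) :
    Measure M :=
  ⨆ x₀ : M, chartMeasure ρ x₀

/-- The Riemannian volume measure of a metric `g`, with density `√(det g(X_i, X_j))`. -/
def riemannianMeasure [MeasurableSpace M]
    (g : ∀ x : M, TangentSpace (𝓡 n) x → TangentSpace (𝓡 n) x → ℝ) : Measure M :=
  densityMeasure fun x X => Real.sqrt (Matrix.of fun i j => g x (X i) (X j)).det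

end Forms

/-! ### The Hitchin functional -/

section Hitchin

variable {P : Type*} [TopologicalSpace P] [ChartedSpace (EuclideanSpace ℝ (Fin 6)) P]

/-- Real 3-forms on a 6-manifold, as a pointwise family. -/
abbrev ThreeForm (P : Type*) [TopologicalSpace P] [ChartedSpace (EuclideanSpace ℝ (Fin 6)) P] :
    Type _ :=
  ∀ p : P, TangentSpace (𝓡 6) p [⋀^Fin 3]→ₗ[ℝ] ℝ

/-- The function `λ_v(Ω)` on `P`. -/
def lambdaAt (v : DiffForm 6 P ℝ 6) (Ω : ThreeForm P) (p : P) : ℝ :=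
  hitchinLambda (v p).toAlternatingMap (Ω p)

/-- The 3-form is stable of negative type at every point (this does not depend on `v`). -/
def IsNegativeType (v : DiffForm 6 P ℝ 6) (Ω : ThreeForm P) : Prop :=
  ∀ p, lambdaAt v Ω p < 0

/-- The volume form `v_Ω = √(-λ_v(Ω)) v`, in the orientation class of `v`. -/
def hitchinVolumeForm (v : DiffForm 6 P ℝ 6) (Ω : ThreeForm P) : DiffForm 6 P ℝ 6 := fun p =>
  Real.sqrt (-lambdaAt v Ω p) • v p

/-- The Hitchin functional `S[Ω] = ∫_P v_Ω`, for the orientation given by `v`. The form `v_Ω` is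
positive for this orientation, so its integral is the total mass of the density `|v_Ω|`. -/
def hitchinFunctional [MeasurableSpace P] (v : DiffForm 6 P ℝ 6) (Ω : ThreeForm P) : ℝ≥0∞ :=
  densityMeasure (fun p X => |hitchinVolumeForm v Ω p X|) Set.univ

end Hitchin

/-! ### Algebra of `su(2)`-valued 1-forms -/

section LieForms

variable {V : Type*} [AddCommGroup V] [Module ℝ V]

/-- The real 3-form `Tr (α ∧ α ∧ α)`. -/
def trCube (α : V [⋀^Fin 1]→ₗ[ℝ] ℍ[ℝ]) : V [⋀^Fin 3]→ₗ[ℝ] ℝ :=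
  tr.compAlternatingMap (wedge α (wedge α α))

variable {P : Type*} [TopologicalSpace P] [ChartedSpace (EuclideanSpace ℝ (Fin 6)) P]

/-- The curvature `F = dW + W ∧ W`. -/
def curvature (W : DiffForm 6 P ℍ[ℝ] 1) (p : P) : TangentSpace (𝓡 6) p [⋀^Fin 2]→ₗ[ℝ] ℍ[ℝ] :=
  (extD W p).toAlternatingMap + wedge (W p).toAlternatingMap (W p).toAlternatingMap

/-- The covariant exterior derivative `∇_W E = dE + W ∧ E + E ∧ W`. -/
def covD (W E : DiffForm 6 P ℍ[ℝ] 1) (p : P) : TangentSpace (𝓡 6) p [⋀^Fin 2]→ₗ[ℝ] ℍ[ℝ] :=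
  (extD E p).toAlternatingMap + wedge (W p).toAlternatingMap (E p).toAlternatingMap
    + wedge (E p).toAlternatingMap (W p).toAlternatingMap

/-- The Chern-Simons form `CS(W) = Tr (W ∧ dW + (2/3) W ∧ W ∧ W)`. -/
def chernSimons (W : DiffForm 6 P ℍ[ℝ] 1) : ThreeForm P := fun p =>
  tr.compAlternatingMap (wedge (W p).toAlternatingMap (extD W p).toAlternatingMap)
    + (2 / 3 : ℝ) • trCube (W p).toAlternatingMap

end LieForms

/-! ### Principal `SU(2)`-bundles and connections -/

/-- A smooth principal `SU(2)`-bundle `P → M` over a 3-manifold, with right action of `SU(2)`. -/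
structure PrincipalSU2Bundle (M P : Type*)
    [TopologicalSpace M] [ChartedSpace (EuclideanSpace ℝ (Fin 3)) M]
    [TopologicalSpace P] [ChartedSpace (EuclideanSpace ℝ (Fin 6)) P] where
  /-- the projection -/
  proj : P → M
  /-- the right action -/
  act : P → SU2 → P
  contMDiff_proj : ContMDiff (𝓡 6) (𝓡 3) ∞ proj
  contMDiff_act : ContMDiff ((𝓡 6).prod (𝓡 3)) (𝓡 6) ∞ fun z : P × SU2 => act z.1 z.2
  act_one : ∀ p, act p 1 = p
  act_mul : ∀ p g h, act p (g * h) = act (act p g) h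
  proj_act : ∀ p g, proj (act p g) = proj p
  /-- equivariant smooth local trivialisations `π⁻¹(U) ≅ U × SU(2)` -/
  locally_trivial : ∀ x : M, ∃ (U : Set M) (φ : OpenPartialHomeomorph P (M × SU2)),
    x ∈ U ∧ IsOpen U ∧ φ.source = proj ⁻¹' U ∧ φ.target = U ×ˢ Set.univ ∧
    ContMDiffOn (𝓡 6) ((𝓡 3).prod (𝓡 3)) ∞ φ φ.source ∧
    ContMDiffOn ((𝓡 3).prod (𝓡 3)) (𝓡 6) ∞ φ.symm φ.target ∧
    ∀ p ∈ φ.source, (φ p).1 = proj p ∧ ∀ g, φ (act p g) = ((φ p).1, (φ p).2 * g)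

/-- The Maurer-Cartan form `m = g⁻¹ dg` on `SU(2)`. -/
def maurerCartan (g : SU2) : TangentSpace (𝓡 3) g →ₗ[ℝ] ℍ[ℝ] :=
  LinearMap.mulLeft ℝ ((g⁻¹ : SU2) : ℍ[ℝ]) ∘ₗ
    (mfderiv (𝓡 3) 𝓘(ℝ, ℍ[ℝ]) (fun h : SU2 => (h : ℍ[ℝ])) g).toLinearMap

/-- The volume of the fibre, `∫_{SU(2)} (1/3) Tr (m ∧ m ∧ m)` (in absolute value). -/
def fibreVolume : ℝ≥0∞ :=
  densityMeasure (M := SU2) (n := 3) (fun g X =>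
    |(1 / 3 : ℝ) * trCube (AlternatingMap.ofSubsingleton ℝ (TangentSpace (𝓡 3) g) ℍ[ℝ] (0 : Fin 1)
      (maurerCartan g)) X|) Set.univ

namespace PrincipalSU2Bundle

variable {M P : Type*} [TopologicalSpace M] [ChartedSpace (EuclideanSpace ℝ (Fin 3)) M]
  [TopologicalSpace P] [ChartedSpace (EuclideanSpace ℝ (Fin 6)) P] (B : PrincipalSU2Bundle M P)

theorem proj_surjective : Function.Surjective B.proj := by
  intro x
  obtain ⟨U, φ, hx, -, -, ht, -, -, h⟩ := B.locally_trivial x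
  have hm : (x, (1 : SU2)) ∈ φ.target := by rw [ht]; exact ⟨hx, Set.mem_univ _⟩
  refine ⟨φ.symm (x, 1), ?_⟩
  rw [← (h _ (φ.map_target hm)).1, φ.right_inv hm]

/-- The 1-form takes values in `su(2)`. -/
def IsLieValued (α : DiffForm 6 P ℍ[ℝ] 1) : Prop :=
  ∀ (p : P) (X : TangentSpace (𝓡 6) p), (α p ![X]).re = 0

/-- Equivariance `R_g^* α = g⁻¹ α g`. -/
def IsEquivariant (α : DiffForm 6 P ℍ[ℝ] 1) : Prop :=
  ∀ (p : P) (g : SU2) (X : TangentSpace (𝓡 6) p),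
    α (B.act p g) ![mfderiv (𝓡 6) (𝓡 6) (fun q => B.act q g) p X]
      = ((g⁻¹ : SU2) : ℍ[ℝ]) * α p ![X] * (g : ℍ[ℝ])

/-- The 1-form vanishes on vertical vectors at `p`. -/
def IsHorizontalAt (p : P) (α : TangentSpace (𝓡 6) p [⋀^Fin 1]→L[ℝ] ℍ[ℝ]) : Prop :=
  ∀ X : TangentSpace (𝓡 6) p, mfderiv (𝓡 6) (𝓡 3) B.proj p X = 0 → α ![X] = 0

/-- Connections: smooth equivariant `su(2)`-valued 1-forms whose pullback under every orbit map
`g ↦ p g` is the Maurer-Cartan form. -/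
structure IsConnection (W : DiffForm 6 P ℍ[ℝ] 1) : Prop where
  smooth : IsSmoothForm W
  lieValued : IsLieValued W
  equivariant : B.IsEquivariant W
  vertical : ∀ (p : P) (g : SU2) (X : TangentSpace (𝓡 3) g),
    W (B.act p g) ![mfderiv (𝓡 3) (𝓡 6) (B.act p) g X] = maurerCartan g X

/-- Variations of connections (differences of connections): smooth equivariant horizontal
`su(2)`-valued 1-forms. -/
structure IsVariation (A : DiffForm 6 P ℍ[ℝ] 1) : Prop where
  smooth : IsSmoothForm A
  lieValued : IsLieValued A
  equivariant : B.IsEquivariant A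
  horizontal : ∀ p, B.IsHorizontalAt p (A p)

/-- The connection is negative definite: `CS(W)` is stable of negative type. -/
def IsNegativeDefinite (v : DiffForm 6 P ℝ 6) (W : DiffForm 6 P ℍ[ℝ] 1) : Prop :=
  B.IsConnection W ∧ IsNegativeType v (chernSimons W)

/-- The conditions, including the equation `F(W) = E ∧ E`, that determine `E_W` at the point `p`:
`e` is horizontal and `su(2)`-valued, solves the equation, and its volume form
`-(2/3) Tr (e ∧ e ∧ e)` is a positive multiple of the pullback of the orientation form `vM` of the
base (this fixes the sign of `e`). -/
structure IsFrameAt (vM : DiffForm 3 M ℝ 3) (W : DiffForm 6 P ℍ[ℝ] 1) (p : P)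
    (e : TangentSpace (𝓡 6) p [⋀^Fin 1]→L[ℝ] ℍ[ℝ]) : Prop where
  lieValued : ∀ X : TangentSpace (𝓡 6) p, (e ![X]).re = 0
  horizontal : B.IsHorizontalAt p e
  eq : curvature W p = wedge e.toAlternatingMap e.toAlternatingMap
  oriented : ∃ c : ℝ, 0 < c ∧ ∀ X : Fin 3 → TangentSpace (𝓡 6) p,
    -(2 / 3 : ℝ) * trCube e.toAlternatingMap X
      = c * vM (B.proj p) fun i => mfderiv (𝓡 6) (𝓡 3) B.proj p (X i)

/-- The frame `E_W`, the solution of `F(W) = E_W ∧ E_W`. -/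
def frame (vM : DiffForm 3 M ℝ 3) (W : DiffForm 6 P ℍ[ℝ] 1) : DiffForm 6 P ℍ[ℝ] 1 := fun p =>
  Classical.epsilon (B.IsFrameAt vM W p)

/-- A point over `x`. -/
def liftPoint (x : M) : P := Function.surjInv B.proj_surjective x

/-- A lift of a tangent vector `u` of the base to `P` at the point `p`. -/
def liftVector (p : P) (u : EuclideanSpace ℝ (Fin 3)) : TangentSpace (𝓡 6) p :=
  Function.invFun (fun X : EuclideanSpace ℝ (Fin 6) =>
    (mfderiv (𝓡 6) (𝓡 3) B.proj p X : EuclideanSpace ℝ (Fin 3))) u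

/-- The metric on the base whose pullback to `P` is `-2 Tr (E ⊗ E)`, for a horizontal equivariant
`E`: evaluate at any point over `x` and on any lifts of the tangent vectors. -/
def baseMetric (E : DiffForm 6 P ℍ[ℝ] 1) (x : M) (u w : TangentSpace (𝓡 3) x) : ℝ :=
  -2 * tr (E (B.liftPoint x) ![B.liftVector (B.liftPoint x) u] *
    E (B.liftPoint x) ![B.liftVector (B.liftPoint x) w])

/-- The volume measure on the base of the metric of `E_W`. -/
def baseVolume [MeasurableSpace M] (vM : DiffForm 3 M ℝ 3) (W : DiffForm 6 P ℍ[ℝ] 1) : Measure M :=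
  riemannianMeasure (B.baseMetric (B.frame vM W))

/-- `W` is an extremum (critical point) of the volume of the base in the metric of `E_W`: the first
variation vanishes for all variations of `W` supported over a compact set `K`, where the volume
that is varied is the volume of `K` (which is all of `M` if `M` is compact and `K = M`). -/
def IsCritical [MeasurableSpace M] (vM : DiffForm 3 M ℝ 3) (W : DiffForm 6 P ℍ[ℝ] 1) : Prop :=
  ∀ (A : DiffForm 6 P ℍ[ℝ] 1) (K : Set M), B.IsVariation A → IsCompact K →
    (∀ p, B.proj p ∉ K → A p = 0) →
    HasDerivAt (fun t : ℝ => (B.baseVolume vM (W + t • A) K).toReal) 0 0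

end PrincipalSU2Bundle

end HitchinGravity

end

open HitchinGravity

noncomputable section

namespace HitchinGravity

/-! ### Explicit formulas for wedge products -/

section WedgeFormulas

variable {V : Type*} [AddCommGroup V] [Module ℝ V] {A : Type*} [Ring A] [Algebra ℝ A]

/-! The whole theorem is an identity between 3 × 3 determinants, integrated.

Equivariance and the Maurer-Cartan condition make the curvature vanish as soon as one argument is
vertical (`extD_dorbit`, `curvature_horizontal`). Take a basis of three vertical vectors and three
vectors killed by `W`; let `w` be the matrix of `W` on the former and `m` the matrix of `F` on the
cyclic pairs of the latter. Then `CS(W)` has only two kinds of components: `4 det w` on the vertical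
triple, and the block `-2 wᵀ m` with one vertical and two horizontal arguments. For such a form
`K_Ω` is block off-diagonal, and `λ = -128 (det w)² (det m) / v²` (`hitchinLambda_eq_det`,
`hitchinLambda_chernSimons`). Negative type therefore forces `det m > 0`.

Commutators of imaginary quaternions are twice cross products, so `F = E ∧ E` reads `m = 2 cof A`,
where `A` is the matrix of `E`. For `det m > 0` this determines `A` up to sign, and the orientation
of the base fixes the sign `σ`: `A = σ cof m / (4 √(det m / 8))` (`frameMatrix_iff`,
`frame_conditions_iff`). The formula is smooth in `m`, hence `E_W` is smooth; uniqueness carries the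
solution at `p` to the solution at `p g`, hence `E_W` is equivariant.

For (1), in the parametrisation `(g, y) ↦ S(y) g` by a local section, `√(-λ) |v|` factors as `4 |det
w|` times `8 √(det m / 8)` (`totalDensity_param`). The first factor is the density of `(1/3) Tr m³`
for the Maurer-Cartan form and depends only on `g`; the second is the Riemannian density of the
metric of `E_W` and depends only on `y`. Tonelli's theorem gives the product formula on pieces, and
countable covers of the group and of the base make it global.

For (2), the curvature of `W + tA` is `F + t ∇_W A + t² A ∧ A`. By Jacobi's formula the derivative
of `8 √(det m / 8)` at `t = 0` is, up to a constant, `Tr (E ∧ ∇_W A)`, because `cof m` is a multiple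
of the matrix of `E`. The Leibniz rule moves `∇_W` to `E` at the cost of an exact term, which
integrates to zero when `A` has compact support in a section (`integral_variationFun`). If the
torsion vanishes, a partition of unity shows that the first variation is zero. Conversely, a bump
function times the value of a torsion component gives a variation whose derivative is a nonzero
integral (`torsion_eq_zero`). Since `∇_W E` is horizontal, its components in a section decide
whether it vanishes. -/

theorem wedge_apply_of_transversal {k l : ℕ} {ι : Type*} [Fintype ι]
    (τ : ι → Equiv.Perm (Fin (k + l)))
    (hinj : Function.Injective fun i => Finset.univ.image fun j : Fin k => τ i (Fin.castAdd l j))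
    (hcard : Fintype.card ι = (k + l).choose k)
    (α : V [⋀^Fin k]→ₗ[ℝ] A) (β : V [⋀^Fin l]→ₗ[ℝ] A) (v : Fin (k + l) → V) :
    wedge α β v = ∑ i, Equiv.Perm.sign (τ i) •
      (α (fun j => v (τ i (Fin.castAdd l j))) * β (fun j => v (τ i (Fin.natAdd k j)))) := by
  classical
  let s : ι → Equiv.Perm (Fin k ⊕ Fin l) := fun i => finSumFinEquiv.symm.permCongr (τ i)
  let f : ι → Equiv.Perm.ModSumCongr (Fin k) (Fin l) := fun i => Quotient.mk'' (s i)
  -- Representatives of one coset differ by permutations inside the two blocks, so the coset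
  -- determines the set of values on the first `k` positions. Distinct sets therefore give distinct
  -- cosets.
  have hf : Function.Injective f := by
    intro i j hij
    apply hinj
    obtain ⟨⟨σ, ρ⟩, h⟩ := QuotientGroup.leftRel_apply.mp (Quotient.exact' hij)
    have h' : s j = s i * Equiv.Perm.sumCongrHom _ _ (σ, ρ) := by
      rw [h, mul_inv_cancel_left]
    have key : ∀ a : Fin k, τ j (Fin.castAdd l a) = τ i (Fin.castAdd l (σ a)) := by
      intro a
      have := congrArg finSumFinEquiv (Equiv.congr_fun h' (Sum.inl a))
      simpa [s, Equiv.permCongr_apply] using this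
    ext x
    simp only [Finset.mem_image, Finset.mem_univ, true_and, key]
    constructor
    · rintro ⟨a, rfl⟩; exact ⟨σ.symm a, by simp⟩
    · rintro ⟨a, rfl⟩; exact ⟨σ a, rfl⟩
  -- Lagrange: the block permutations have `k! l!` elements, so there are `(k + l).choose k` cosets,
  -- and the injection is a bijection.
  have hc : Fintype.card ι = Fintype.card (Equiv.Perm.ModSumCongr (Fin k) (Fin l)) := by
    have h1 := Subgroup.card_eq_card_quotient_mul_card_subgroup
      (Equiv.Perm.sumCongrHom (Fin k) (Fin l)).range
    rw [Nat.card_congr (MonoidHom.ofInjective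
      (Equiv.Perm.sumCongrHom_injective (α := Fin k) (β := Fin l))).toEquiv.symm] at h1
    simp only [Nat.card_eq_fintype_card, Fintype.card_prod, Fintype.card_perm, Fintype.card_sum,
      Fintype.card_fin] at h1
    have h2 := Nat.add_choose_mul_factorial_mul_factorial k l
    rw [hcard]
    have h3 : 0 < k.factorial * l.factorial := by positivity
    apply Nat.eq_of_mul_eq_mul_right h3
    rw [← mul_assoc, Nat.choose_symm_add, h2, h1]
  have hbij : Function.Bijective f := (Fintype.bijective_iff_injective_and_card f).2 ⟨hf, hc⟩
  have e1 : wedge α β v = LinearMap.mul' ℝ A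
      ((∑ σ : Equiv.Perm.ModSumCongr (Fin k) (Fin l), AlternatingMap.domCoprod.summand α β σ)
        (v ∘ finSumFinEquiv)) := by
    simp [wedge, AlternatingMap.domCoprod_apply, Function.comp_def]
  rw [e1, ← Equiv.sum_comp (Equiv.ofBijective f hbij), _root_.sum_apply, map_sum]
  refine Finset.sum_congr rfl fun i _ => ?_
  simp only [Equiv.ofBijective_apply, f, AlternatingMap.domCoprod.summand_mk'']
  have hs : Equiv.Perm.sign (s i) = Equiv.Perm.sign (τ i) := by simp [s]
  rw [hs]
  rcases Int.units_eq_one_or (Equiv.Perm.sign (τ i)) with h | h <;>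
    simp [h, s, Equiv.permCongr_apply]

/-- The inverse of `Fin.cycleRange i` moves position `0` to `i` and keeps the order of the others.
These are the `(1, l)`-shuffles, of sign `(-1)^i`; the casts only reconcile `1 + l` with `l + 1`. -/
theorem wedge_one_left_apply {l : ℕ} (α : V [⋀^Fin 1]→ₗ[ℝ] A) (β : V [⋀^Fin l]→ₗ[ℝ] A)
    (v : Fin (1 + l) → V) :
    wedge α β v = ∑ i : Fin (l + 1), (-1 : ℝ) ^ (i : ℕ) •
      (α (fun _ => v (Fin.cast (add_comm l 1) i)) *
        β (fun j => v (Fin.cast (add_comm l 1) (i.succAbove j)))) := by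
  rw [wedge_apply_of_transversal
    (fun i : Fin (l + 1) => (finCongr (add_comm l 1)).permCongr (Fin.cycleRange i).symm)]
  · refine Finset.sum_congr rfl fun i _ => ?_
    have h0 : ∀ j : Fin 1, ((finCongr (add_comm l 1)).permCongr (Fin.cycleRange i).symm)
        (Fin.castAdd l j) = Fin.cast (add_comm l 1) i := by
      intro j
      have : (finCongr (add_comm l 1)).symm (Fin.castAdd l j) = 0 := by
        ext; simp
      rw [Equiv.permCongr_apply, this, Fin.cycleRange_symm_zero]
      rfl
    have h1 : ∀ j : Fin l, ((finCongr (add_comm l 1)).permCongr (Fin.cycleRange i).symm)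
        (Fin.natAdd 1 j) = Fin.cast (add_comm l 1) (i.succAbove j) := by
      intro j
      have : (finCongr (add_comm l 1)).symm (Fin.natAdd 1 j) = j.succ := by
        ext; simp
      rw [Equiv.permCongr_apply, this, Fin.cycleRange_symm_succ]
      rfl
    simp only [h0, h1, Equiv.Perm.sign_permCongr, Equiv.Perm.sign_symm, Fin.sign_cycleRange]
    rcases Nat.even_or_odd (i : ℕ) with h | h <;> simp [h.neg_one_pow]
  · intro i j hij
    have h0 : ∀ (i : Fin (l + 1)) (j : Fin 1),
        ((finCongr (add_comm l 1)).permCongr (Fin.cycleRange i).symm)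
        (Fin.castAdd l j) = Fin.cast (add_comm l 1) i := by
      intro i j
      have : (finCongr (add_comm l 1)).symm (Fin.castAdd l j) = 0 := by
        ext; simp
      rw [Equiv.permCongr_apply, this, Fin.cycleRange_symm_zero]
      rfl
    simp only [h0] at hij
    simpa using hij
  · simp [add_comm]

theorem wedge_one_one_apply (α β : V [⋀^Fin 1]→ₗ[ℝ] A) (v : Fin 2 → V) :
    wedge α β v = α ![v 0] * β ![v 1] - α ![v 1] * β ![v 0] := by
  have h := wedge_one_left_apply α β v
  rw [Fin.sum_univ_two] at h
  rw [h]
  have e : ∀ x : V, (fun _ : Fin 1 => x) = ![x] := fun x => by ext i; fin_cases i; rfl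
  have e1 : (fun j : Fin 1 => v (Fin.cast (add_comm 1 1) ((0 : Fin 2).succAbove j))) = ![v 1] := by
    ext i; fin_cases i; rfl
  have e2 : (fun j : Fin 1 => v (Fin.cast (add_comm 1 1) ((1 : Fin 2).succAbove j))) = ![v 0] := by
    ext i; fin_cases i; rfl
  rw [e1, e2, e, e]
  simp [sub_eq_add_neg]

theorem wedge_one_two_apply (α : V [⋀^Fin 1]→ₗ[ℝ] A) (β : V [⋀^Fin 2]→ₗ[ℝ] A) (v : Fin 3 → V) :
    wedge α β v = α ![v 0] * β ![v 1, v 2] - α ![v 1] * β ![v 0, v 2]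
      + α ![v 2] * β ![v 0, v 1] := by
  have h := wedge_one_left_apply α β v
  rw [Fin.sum_univ_three] at h
  rw [h]
  have e : ∀ x : V, (fun _ : Fin 1 => x) = ![x] := fun x => by ext i; fin_cases i; rfl
  have e0 : (fun j : Fin 2 => v (Fin.cast (add_comm 2 1) ((0 : Fin 3).succAbove j)))
      = ![v 1, v 2] := by
    ext i; fin_cases i <;> rfl
  have e1 : (fun j : Fin 2 => v (Fin.cast (add_comm 2 1) ((1 : Fin 3).succAbove j)))
      = ![v 0, v 2] := by
    ext i; fin_cases i <;> rfl
  have e2 : (fun j : Fin 2 => v (Fin.cast (add_comm 2 1) ((2 : Fin 3).succAbove j)))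
      = ![v 0, v 1] := by
    ext i; fin_cases i <;> rfl
  rw [e0, e1, e2, e, e, e]
  simp [sub_eq_add_neg]

/-- The permutation of `Fin 5` that begins with the `i`-th two-element subset. -/
def shuffleTwoThree (i : Fin 10) : Fin 5 → Fin 5 :=
  ![![0, 1, 2, 3, 4], ![0, 2, 1, 3, 4], ![0, 3, 1, 2, 4], ![0, 4, 1, 2, 3], ![1, 2, 0, 3, 4],
    ![1, 3, 0, 2, 4], ![1, 4, 0, 2, 3], ![2, 3, 0, 1, 4], ![2, 4, 0, 1, 3], ![3, 4, 0, 1, 2]] i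

theorem shuffleTwoThree_bijective (i : Fin 10) : Function.Bijective (shuffleTwoThree i) := by
  revert i; decide

def shuffleTwoThreePerm (i : Fin 10) : Equiv.Perm (Fin 5) :=
  Equiv.ofBijective _ (shuffleTwoThree_bijective i)

theorem sign_shuffleTwoThreePerm (i : Fin 10) :
    Equiv.Perm.sign (shuffleTwoThreePerm i) = ![1, -1, 1, -1, 1, -1, 1, 1, -1, 1] i := by
  -- Counting inversions turns the sign into a finite product that `decide` evaluates.
  have key : ∀ i, ∏ x : Fin 5, ∏ y ∈ Finset.univ.filter (fun y => x < y),
      (if shuffleTwoThree i x < shuffleTwoThree i y then (1 : ℤˣ) else -1)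
      = ![1, -1, 1, -1, 1, -1, 1, 1, -1, 1] i := by decide
  rw [← key i, Equiv.Perm.sign_eq_prod_prod_Ioi]
  refine Finset.prod_congr rfl fun x _ => ?_
  refine Finset.prod_congr (by ext; simp) fun y _ => ?_
  rfl

theorem wedge_two_three_apply (α : V [⋀^Fin 2]→ₗ[ℝ] A) (β : V [⋀^Fin 3]→ₗ[ℝ] A) (v : Fin 5 → V) :
    wedge α β v = α ![v 0, v 1] * β ![v 2, v 3, v 4] - α ![v 0, v 2] * β ![v 1, v 3, v 4]
      + α ![v 0, v 3] * β ![v 1, v 2, v 4] - α ![v 0, v 4] * β ![v 1, v 2, v 3]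
      + α ![v 1, v 2] * β ![v 0, v 3, v 4] - α ![v 1, v 3] * β ![v 0, v 2, v 4]
      + α ![v 1, v 4] * β ![v 0, v 2, v 3] + α ![v 2, v 3] * β ![v 0, v 1, v 4]
      - α ![v 2, v 4] * β ![v 0, v 1, v 3] + α ![v 3, v 4] * β ![v 0, v 1, v 2] := by
  have h := wedge_apply_of_transversal (k := 2) (l := 3) shuffleTwoThreePerm
    (by
      have : Function.Injective fun i : Fin 10 => Finset.univ.image fun j : Fin 2 =>
        shuffleTwoThree i (Fin.castAdd 3 j) := by decide
      exact this) (by decide) α β v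
  rw [h]
  have e1 : ∀ i, (fun j : Fin 2 => v (shuffleTwoThreePerm i (Fin.castAdd 3 j)))
      = ![v (shuffleTwoThree i 0), v (shuffleTwoThree i 1)] := by
    intro i; ext j; fin_cases j <;> rfl
  have e2 : ∀ i, (fun j : Fin 3 => v (shuffleTwoThreePerm i (Fin.natAdd 2 j)))
      = ![v (shuffleTwoThree i 2), v (shuffleTwoThree i 3), v (shuffleTwoThree i 4)] := by
    intro i; ext j; fin_cases j <;> rfl
  have e3 : ∀ i, @Equiv.Perm.sign (Fin (2 + 3)) _ _ (shuffleTwoThreePerm i)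
      = ![1, -1, 1, -1, 1, -1, 1, 1, -1, 1] i := sign_shuffleTwoThreePerm
  simp only [e1, e2, e3]
  simp only [Fin.sum_univ_succ, shuffleTwoThree]
  simp [sub_eq_add_neg, add_assoc]

end WedgeFormulas

/-! ### The quartic invariant of a three-form adapted to a splitting -/

section Lambda

/-- Both forms are multiples of `b.det`, whose nonzero value on the standard basis cancels. This
frees `K_Ω` from the standard basis. -/
theorem ratio_eq_of_basis {n : ℕ} (b : Module.Basis (Fin n) ℝ (EuclideanSpace ℝ (Fin n)))
    (η v : EuclideanSpace ℝ (Fin n) [⋀^Fin n]→ₗ[ℝ] ℝ) :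
    ratio η v = η b / v b := by
  have h1 := AlternatingMap.eq_smul_basis_det b η
  have h2 := AlternatingMap.eq_smul_basis_det b v
  have hd : b.det (EuclideanSpace.basisFun (Fin n) ℝ) ≠ 0 := by
    have := b.isUnit_det (EuclideanSpace.basisFun (Fin n) ℝ).toBasis
    simpa using this.ne_zero
  rw [ratio, h1, h2]
  simp only [AlternatingMap.smul_apply, smul_eq_mul, b.det_self, mul_one]
  exact mul_div_mul_right _ _ hd

-- In the expansion along the 1-form only the `j`-th basis vector pairs nontrivially with `b.coord
-- j`; its position gives the sign.
set_option maxRecDepth 4000 in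
theorem hitchinK_coord_apply (b : Module.Basis (Fin 6) ℝ (EuclideanSpace ℝ (Fin 6)))
    (v : EuclideanSpace ℝ (Fin 6) [⋀^Fin 6]→ₗ[ℝ] ℝ)
    (Ω : EuclideanSpace ℝ (Fin 6) [⋀^Fin 3]→ₗ[ℝ] ℝ) (j : Fin 6) (ξ : EuclideanSpace ℝ (Fin 6)) :
    hitchinK v Ω (b.coord j) ξ =
      (-1) ^ (j : ℕ) * wedge (Ω.curryLeft (n := 2) ξ) Ω (fun k => b (j.succAbove k)) / v b := by
  have h0 : hitchinK v Ω (b.coord j) ξ =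
    ratio (n := 6) (wedge (oneForm (b.coord j)) (wedge (Ω.curryLeft (n := 2) ξ) Ω)) v := rfl
  rw [h0, ratio_eq_of_basis b]
  congr 1
  have h1 := wedge_one_left_apply (oneForm (b.coord j)) (wedge (Ω.curryLeft (n := 2) ξ) Ω) b
  refine h1.trans ?_
  rw [Finset.sum_eq_single (a := (j : Fin (5 + 1)))]
  · have : oneForm (b.coord j) (fun _ => b (Fin.cast (add_comm 5 1) j)) = 1 := by
      simp [oneForm]
    erw [this]
    rw [one_mul]
    rfl
  · intro i _ hij
    have : oneForm (b.coord j) (fun _ => b (Fin.cast (add_comm 5 1) i)) = 0 := by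
      simp [oneForm, hij]
    erw [this]
    rw [zero_mul, smul_zero]
  · simp

theorem hitchinLambda_eq_sum (b : Module.Basis (Fin 6) ℝ (EuclideanSpace ℝ (Fin 6)))
    (v : EuclideanSpace ℝ (Fin 6) [⋀^Fin 6]→ₗ[ℝ] ℝ)
    (Ω : EuclideanSpace ℝ (Fin 6) [⋀^Fin 3]→ₗ[ℝ] ℝ) :
    hitchinLambda v Ω = (1 / 6) * ∑ i, ∑ j,
      hitchinK v Ω (b.coord j) (b i) * hitchinK v Ω (b.coord i) (b j) := by
  have h : ∀ i j, LinearMap.toMatrix b.dualBasis b.dualBasis (hitchinK v Ω) i j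
      = hitchinK v Ω (b.coord j) (b i) := by
    intro i j
    rw [LinearMap.toMatrix_apply, b.dualBasis_repr]
    simp
  rw [hitchinLambda, LinearMap.trace_eq_matrix_trace ℝ b.dualBasis, LinearMap.toMatrix_mul]
  simp only [Matrix.trace, Matrix.diag, Matrix.mul_apply, h]

theorem alternating_three_perm {V : Type*} [AddCommGroup V] [Module ℝ V]
    (Ω : V [⋀^Fin 3]→ₗ[ℝ] ℝ) (x y z : V) :
    Ω ![y, x, z] = -Ω ![x, y, z] ∧ Ω ![x, z, y] = -Ω ![x, y, z] ∧ Ω ![z, y, x] = -Ω ![x, y, z] ∧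
    Ω ![y, z, x] = Ω ![x, y, z] ∧ Ω ![z, x, y] = Ω ![x, y, z] := by
  have s01 : ∀ x y z, Ω ![y, x, z] = -Ω ![x, y, z] := by
    intro x y z
    rw [← Ω.map_swap ![x, y, z] (show (0 : Fin 3) ≠ 1 by decide)]
    congr 1; ext i; fin_cases i <;> rfl
  have s12 : ∀ x y z, Ω ![x, z, y] = -Ω ![x, y, z] := by
    intro x y z
    rw [← Ω.map_swap ![x, y, z] (show (1 : Fin 3) ≠ 2 by decide)]
    congr 1; ext i; fin_cases i <;> rfl
  refine ⟨s01 x y z, s12 x y z, ?_, ?_, ?_⟩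
  · rw [s01 y z x, s12 y x z, s01 x y z, neg_neg]
  · rw [s12 y x z, s01 x y z, neg_neg]
  · rw [s01 x z y, s12 x y z, neg_neg]

theorem alternating_three_self {V : Type*} [AddCommGroup V] [Module ℝ V]
    (Ω : V [⋀^Fin 3]→ₗ[ℝ] ℝ) (x y : V) :
    Ω ![x, x, y] = 0 ∧ Ω ![x, y, x] = 0 ∧ Ω ![y, x, x] = 0 :=
  ⟨Ω.map_eq_zero_of_eq _ (i := 0) (j := 1) rfl (by decide),
   Ω.map_eq_zero_of_eq _ (i := 0) (j := 2) rfl (by decide),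
   Ω.map_eq_zero_of_eq _ (i := 1) (j := 2) rfl (by decide)⟩

set_option maxHeartbeats 2000000 in
/-- `λ` for a three-form `Ω = p w₁w₂w₃ + Σ q_ac w_a ∧ (∗E)_c` in the coframe `(w, E)` dual
to `b`. -/
theorem hitchinLambda_eq_det (b : Module.Basis (Fin 6) ℝ (EuclideanSpace ℝ (Fin 6)))
    (v : EuclideanSpace ℝ (Fin 6) [⋀^Fin 6]→ₗ[ℝ] ℝ)
    (Ω : EuclideanSpace ℝ (Fin 6) [⋀^Fin 3]→ₗ[ℝ] ℝ) (p : ℝ) (q : Matrix (Fin 3) (Fin 3) ℝ)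
    (hp : Ω ![b 0, b 1, b 2] = p)
    (hvvh : ∀ a c : Fin 3, ∀ i : Fin 3,
      Ω ![b (Fin.castAdd 3 a), b (Fin.castAdd 3 c), b (Fin.natAdd 3 i)] = 0)
    (h0 : ∀ a : Fin 3, Ω ![b (Fin.castAdd 3 a), b 4, b 5] = q a 0)
    (h1 : ∀ a : Fin 3, Ω ![b (Fin.castAdd 3 a), b 5, b 3] = q a 1)
    (h2 : ∀ a : Fin 3, Ω ![b (Fin.castAdd 3 a), b 3, b 4] = q a 2)
    (hhhh : Ω ![b 3, b 4, b 5] = 0) :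
    hitchinLambda v Ω = 4 * p * q.det / (v b) ^ 2 := by
  have zz := fun x y => alternating_three_self Ω x y
  have z1 := fun x y => (zz x y).1
  have z2 := fun x y => (zz x y).2.1
  have z3 := fun x y => (zz x y).2.2
  have P := fun x y z => alternating_three_perm Ω x y z
  have key : ∀ x y z t, Ω ![x, y, z] = t → Ω ![x, y, z] = t ∧
    Ω ![y, x, z] = -t ∧ Ω ![x, z, y] = -t ∧ Ω ![z, y, x] = -t ∧
    Ω ![y, z, x] = t ∧ Ω ![z, x, y] = t := by
    rintro x y z t rfl; exact ⟨rfl, P x y z⟩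
  have t012 := key _ _ _ _ hp
  have t345 := key _ _ _ _ hhhh
  have a0 := key _ _ _ _ (h0 0)
  have a1 := key _ _ _ _ (h0 1)
  have a2 := key _ _ _ _ (h0 2)
  have b0 := key _ _ _ _ (h1 0)
  have b1 := key _ _ _ _ (h1 1)
  have b2 := key _ _ _ _ (h1 2)
  have c0 := key _ _ _ _ (h2 0)
  have c1 := key _ _ _ _ (h2 1)
  have c2 := key _ _ _ _ (h2 2)
  have d010 := key _ _ _ _ (hvvh 0 1 0)
  have d011 := key _ _ _ _ (hvvh 0 1 1)
  have d012 := key _ _ _ _ (hvvh 0 1 2)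
  have d020 := key _ _ _ _ (hvvh 0 2 0)
  have d021 := key _ _ _ _ (hvvh 0 2 1)
  have d022 := key _ _ _ _ (hvvh 0 2 2)
  have d120 := key _ _ _ _ (hvvh 1 2 0)
  have d121 := key _ _ _ _ (hvvh 1 2 1)
  have d122 := key _ _ _ _ (hvvh 1 2 2)
  have e0 : Fin.castAdd 3 (0 : Fin 3) = (0 : Fin 6) := rfl
  have e1 : Fin.castAdd 3 (1 : Fin 3) = (1 : Fin 6) := rfl
  have e2 : Fin.castAdd 3 (2 : Fin 3) = (2 : Fin 6) := rfl
  have e3 : Fin.natAdd 3 (0 : Fin 3) = (3 : Fin 6) := rfl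
  have e4 : Fin.natAdd 3 (1 : Fin 3) = (4 : Fin 6) := rfl
  have e5 : Fin.natAdd 3 (2 : Fin 3) = (5 : Fin 6) := rfl
  rw [e0] at a0 b0 c0 d010 d011 d012 d020 d021 d022
  rw [e1] at a1 b1 c1 d010 d011 d012 d120 d121 d122
  rw [e2] at a2 b2 c2 d020 d021 d022 d120 d121 d122
  rw [e3] at d010 d020 d120
  rw [e4] at d011 d021 d121
  rw [e5] at d012 d022 d122
  let S : Fin 6 → Fin 5 → Fin 6 := ![![1, 2, 3, 4, 5], ![0, 2, 3, 4, 5], ![0, 1, 3, 4, 5],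
    ![0, 1, 2, 4, 5], ![0, 1, 2, 3, 5], ![0, 1, 2, 3, 4]]
  have hS : ∀ j k, Fin.succAbove j k = S j k := by decide
  let N : Fin 6 → Fin 6 → ℝ := fun i j =>
    (-1) ^ (j : ℕ) * wedge (Ω.curryLeft (n := 2) (b i)) Ω (fun k => b (S j k))
  -- The off-diagonal blocks are `-2 p q` and the transpose of `-2 cof q`. Each product of the two
  -- blocks has trace `12 p det q`, so the trace of the square is `24 p det q`, and the factor `1/6`
  -- leaves `4 p det q`.
  have hN : N = ![![0, 0, 0, -(2 * p * q 0 0), -(2 * p * q 0 1), -(2 * p * q 0 2)],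
      ![0, 0, 0, -(2 * p * q 1 0), -(2 * p * q 1 1), -(2 * p * q 1 2)],
      ![0, 0, 0, -(2 * p * q 2 0), -(2 * p * q 2 1), -(2 * p * q 2 2)],
      ![-(2 * (q 1 1 * q 2 2 - q 1 2 * q 2 1)),
        -(2 * (q 2 1 * q 0 2 - q 2 2 * q 0 1)),
        -(2 * (q 0 1 * q 1 2 - q 0 2 * q 1 1)), 0, 0, 0],
      ![-(2 * (q 1 2 * q 2 0 - q 1 0 * q 2 2)),
        -(2 * (q 2 2 * q 0 0 - q 2 0 * q 0 2)),
        -(2 * (q 0 2 * q 1 0 - q 0 0 * q 1 2)), 0, 0, 0],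
      ![-(2 * (q 1 0 * q 2 1 - q 1 1 * q 2 0)),
        -(2 * (q 2 0 * q 0 1 - q 2 1 * q 0 0)),
        -(2 * (q 0 0 * q 1 1 - q 0 1 * q 1 0)), 0, 0, 0]] := by
    ext i j
    fin_cases i <;> fin_cases j <;>
    · simp [N, S, wedge_two_three_apply, AlternatingMap.curryLeft_apply_apply, z1, z2, t012, t345, a0, a1,
        a2, b0, b1, b2, c0, c1, c2, d010, d011, d012, d020, d021, d022, d120, d121, d122]
      try ring_nf
  have hK : ∀ i j, hitchinK v Ω (b.coord j) (b i) = N i j / v b := by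
    intro i j
    rw [hitchinK_coord_apply]
    simp only [hS, N]
  rw [hitchinLambda_eq_sum b]
  simp only [hK, hN, Fin.sum_univ_six, Matrix.det_fin_three]
  simp
  ring

end Lambda

/-! ### Imaginary quaternions -/

section Imaginary

/-- The imaginary components of a quaternion. -/
def im : ℍ[ℝ] →ₗ[ℝ] (Fin 3 → ℝ) where
  toFun q := ![q.imI, q.imJ, q.imK]
  map_add' p q := by ext i; fin_cases i <;> simp
  map_smul' c q := by ext i; fin_cases i <;> simp

/-- The imaginary quaternion with given components. -/
def ofIm : (Fin 3 → ℝ) →ₗ[ℝ] ℍ[ℝ] where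
  toFun x := ⟨0, x 0, x 1, x 2⟩
  map_add' p q := by ext <;> first | exact (add_zero 0).symm | rfl
  map_smul' c q := by ext <;> first | exact (mul_zero c).symm | rfl

@[simp] theorem im_apply_zero (q : ℍ[ℝ]) : im q 0 = q.imI := rfl
@[simp] theorem im_apply_one (q : ℍ[ℝ]) : im q 1 = q.imJ := rfl
@[simp] theorem im_apply_two (q : ℍ[ℝ]) : im q 2 = q.imK := rfl
@[simp] theorem re_ofIm (x : Fin 3 → ℝ) : (ofIm x).re = 0 := rfl
@[simp] theorem imI_ofIm (x : Fin 3 → ℝ) : (ofIm x).imI = x 0 := rfl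
@[simp] theorem imJ_ofIm (x : Fin 3 → ℝ) : (ofIm x).imJ = x 1 := rfl
@[simp] theorem imK_ofIm (x : Fin 3 → ℝ) : (ofIm x).imK = x 2 := rfl

@[simp] theorem im_ofIm (x : Fin 3 → ℝ) : im (ofIm x) = x := by
  ext i; fin_cases i <;> rfl

theorem ofIm_im {q : ℍ[ℝ]} (h : q.re = 0) : ofIm (im q) = q := by
  ext <;> simp [h]

theorem eq_of_im_eq {p q : ℍ[ℝ]} (hp : p.re = 0) (hq : q.re = 0) (h : im p = im q) : p = q := by
  rw [← ofIm_im hp, ← ofIm_im hq, h]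

@[simp] theorem tr_apply (q : ℍ[ℝ]) : tr q = 2 * q.re := rfl

end Imaginary

/-! ### Component matrices of `su(2)`-valued forms and the invariant of the Chern-Simons form -/

section MatrixOfForms

variable {V : Type*} [AddCommGroup V] [Module ℝ V]

/-- A 1-form as a linear map. -/
def lin1 {A : Type*} [AddCommGroup A] [Module ℝ A] (e : V [⋀^Fin 1]→ₗ[ℝ] A) : V →ₗ[ℝ] A :=
  (AlternatingMap.ofSubsingleton ℝ V A (0 : Fin 1)).symm e

theorem lin1_apply {A : Type*} [AddCommGroup A] [Module ℝ A] (e : V [⋀^Fin 1]→ₗ[ℝ] A) (X : V) :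
    lin1 e X = e ![X] := by
  rw [lin1, AlternatingMap.ofSubsingleton_symm_apply_apply]
  congr 1; ext i; fin_cases i; rfl

/-- A 2-form as a bilinear map. -/
def lin2 {A : Type*} [AddCommGroup A] [Module ℝ A] (F : V [⋀^Fin 2]→ₗ[ℝ] A) :
    V →ₗ[ℝ] V →ₗ[ℝ] A where
  toFun x := lin1 (F.curryLeft x)
  map_add' x y := by ext z; simp [lin1_apply]
  map_smul' c x := by ext z; simp [lin1_apply]

theorem lin2_apply {A : Type*} [AddCommGroup A] [Module ℝ A] (F : V [⋀^Fin 2]→ₗ[ℝ] A) (X Y : V) :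
    lin2 F X Y = F ![X, Y] := by
  change lin1 (F.curryLeft X) Y = _
  rw [lin1_apply, AlternatingMap.curryLeft_apply_apply]

theorem twoForm_swap {A : Type*} [AddCommGroup A] [Module ℝ A] (F : V [⋀^Fin 2]→ₗ[ℝ] A) (X Y : V) :
    F ![Y, X] = -F ![X, Y] := by
  rw [← F.map_swap ![X, Y] (show (0 : Fin 2) ≠ 1 by decide)]
  congr 1; ext i; fin_cases i <;> rfl

theorem twoForm_self {A : Type*} [AddCommGroup A] [Module ℝ A] (F : V [⋀^Fin 2]→ₗ[ℝ] A) (X : V) :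
    F ![X, X] = 0 :=
  F.map_eq_zero_of_eq _ (i := 0) (j := 1) rfl (by decide)

/-- The components `im_a (e(X_i))`. -/
def formMatrix (e : V [⋀^Fin 1]→ₗ[ℝ] ℍ[ℝ]) (X : Fin 3 → V) : Matrix (Fin 3) (Fin 3) ℝ :=
  Matrix.of fun a i => im (e ![X i]) a

/-- The components `im_a (F(X_{c+1}, X_{c+2}))`. -/
def twoFormMatrix (F : V [⋀^Fin 2]→ₗ[ℝ] ℍ[ℝ]) (X : Fin 3 → V) : Matrix (Fin 3) (Fin 3) ℝ :=
  Matrix.of fun a c => im (F ![X (c + 1), X (c + 2)]) a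

/-- For imaginary quaternions `re (xyz) = -det (x, y, z)`. The six permutations contribute equally
and `tr` doubles the real part, whence `-12`. -/
theorem trCube_apply (e : V [⋀^Fin 1]→ₗ[ℝ] ℍ[ℝ]) (X : Fin 3 → V)
    (he : ∀ i, (e ![X i]).re = 0) :
    trCube e X = -12 * (formMatrix e X).det := by
  have h0 := he 0
  have h1 := he 1
  have h2 := he 2
  simp only [trCube, LinearMap.compAlternatingMap_apply, wedge_one_two_apply, wedge_one_one_apply,
    Matrix.det_fin_three, formMatrix, Matrix.of_apply]
  simp [h0, h1, h2]
  ring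

/-- The commutator of imaginary quaternions is twice their cross product, and the cross products of
the columns of a matrix in cyclic order are the columns of its cofactor matrix. -/
theorem twoFormMatrix_wedge (e : V [⋀^Fin 1]→ₗ[ℝ] ℍ[ℝ]) (X : Fin 3 → V)
    (he : ∀ i, (e ![X i]).re = 0) :
    twoFormMatrix (wedge e e) X = (2 : ℝ) • (formMatrix e X).adjugate.transpose := by
  have h0 := he 0
  have h1 := he 1
  have h2 := he 2
  ext a c
  rw [Matrix.adjugate_fin_three]
  fin_cases a <;> fin_cases c <;>
    simp [twoFormMatrix, formMatrix, wedge_one_one_apply, h0, h1, h2] <;> ring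

/-- The value of the Chern-Simons form on an adapted basis. -/
theorem hitchinLambda_chernSimons_of_horizontal
    (b : Module.Basis (Fin 6) ℝ (EuclideanSpace ℝ (Fin 6)))
    (v : EuclideanSpace ℝ (Fin 6) [⋀^Fin 6]→ₗ[ℝ] ℝ)
    (W : EuclideanSpace ℝ (Fin 6) [⋀^Fin 1]→ₗ[ℝ] ℍ[ℝ])
    (D : EuclideanSpace ℝ (Fin 6) [⋀^Fin 2]→ₗ[ℝ] ℍ[ℝ])
    (hW : ∀ X, (W ![X]).re = 0)
    (hF : ∀ (a : Fin 3) X, (D + wedge W W) ![b (Fin.castAdd 3 a), X] = 0)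
    (hh : ∀ i : Fin 3, W ![b (Fin.natAdd 3 i)] = 0) :
    hitchinLambda v (tr.compAlternatingMap (wedge W D) + (2 / 3 : ℝ) • trCube W) =
      -128 * (formMatrix W fun a => b (Fin.castAdd 3 a)).det ^ 2 *
        (twoFormMatrix (D + wedge W W) fun i => b (Fin.natAdd 3 i)).det / (v b) ^ 2 := by
  set w := formMatrix W fun a => b (Fin.castAdd 3 a)
  set m := twoFormMatrix (D + wedge W W) fun i => b (Fin.natAdd 3 i)
  -- Vanishing of the curvature on vertical arguments expresses `dW` there through the commutator of
  -- values of `W`.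
  have hD : ∀ (a : Fin 3) X, D ![b (Fin.castAdd 3 a), X] =
      -(W ![b (Fin.castAdd 3 a)] * W ![X] - W ![X] * W ![b (Fin.castAdd 3 a)]) := by
    intro a X
    have := hF a X
    rw [AlternatingMap.add_apply, wedge_one_one_apply] at this
    exact eq_neg_of_add_eq_zero_left this
  have hvh : ∀ a i : Fin 3, D ![b (Fin.castAdd 3 a), b (Fin.natAdd 3 i)] = 0 := by
    intro a i
    rw [hD, hh]; simp
  have e0 : W ![b 3] = 0 := hh 0
  have e1 : W ![b 4] = 0 := hh 1
  have e2 : W ![b 5] = 0 := hh 2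
  have hm : ∀ x y, W ![x] = 0 → (D + wedge W W) ![x, y] = D ![x, y] := by
    intro x y hx
    simp [wedge_one_one_apply, hx]
  -- On the vertical triple `W ∧ dW` gives `-Tr W³`, so the total is `-(1/3) Tr W³ = 4 det w`. In
  -- the mixed components only `Tr (W F)` survives, and the trace of a product of imaginary
  -- quaternions is `-2` times their inner product. The constant is `4 · 4 · (-2)³ = -128`.
  rw [hitchinLambda_eq_det b v _ (4 * w.det) ((-2 : ℝ) • (w.transpose * m))]
  · rw [Matrix.det_smul, Matrix.det_mul, Matrix.det_transpose]
    simp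
    ring
  · have h3 := trCube_apply W ![b 0, b 1, b 2] (fun i => hW _)
    have h4 : formMatrix W ![b 0, b 1, b 2] = w := by
      ext a i
      fin_cases i <;> rfl
    rw [h4] at h3
    have h5 := h3
    simp only [trCube, LinearMap.compAlternatingMap_apply, wedge_one_two_apply,
      wedge_one_one_apply] at h5
    have d01 : D ![b 0, b 1] = _ := hD 0 (b 1)
    have d02 : D ![b 0, b 2] = _ := hD 0 (b 2)
    have d12 : D ![b 1, b 2] = _ := hD 1 (b 2)
    simp only [AlternatingMap.add_apply, AlternatingMap.smul_apply, h3,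
      LinearMap.compAlternatingMap_apply, wedge_one_two_apply, Matrix.cons_val_zero,
      Matrix.cons_val_one, Matrix.cons_val_two, Matrix.head_cons, Matrix.tail_cons, d01, d02, d12] at h5 ⊢
    have : ∀ x y z : ℍ[ℝ], ∀ t : ℝ, tr (x - y + z) = t → tr (-x - -y + -z) = -t := by
      rintro x y z t rfl; simp; ring
    have h6 := this _ _ _ _ h5
    simp only [← mul_neg] at h6
    erw [h6]
    simp
    ring
  · intro a c i
    have d1 := hvh a i
    have d2 := hvh c i
    simp only [AlternatingMap.add_apply, AlternatingMap.smul_apply, trCube,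
      LinearMap.compAlternatingMap_apply, wedge_one_two_apply, wedge_one_one_apply,
      Matrix.cons_val_zero, Matrix.cons_val_one, Matrix.cons_val, hh, d1, d2, hD]
    simp only [mul_zero, zero_mul, sub_zero, smul_eq_mul]
    simp
  · intro a
    have hx : D ![b 4, b 5] = (D + wedge W W) ![b 4, b 5] := (hm _ _ e1).symm
    have d1 : D ![b (Fin.castAdd 3 a), b 5] = 0 := hvh a 2
    have d2 : D ![b (Fin.castAdd 3 a), b 4] = 0 := hvh a 1
    have hm0 : ∀ c, m c 0 = im (D ![b 4, b 5]) c := by intro c; rw [hx]; rfl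
    have hwr := hW (b (Fin.castAdd 3 a))
    simp only [AlternatingMap.add_apply, AlternatingMap.smul_apply, trCube,
      LinearMap.compAlternatingMap_apply, wedge_one_two_apply, wedge_one_one_apply,
      Matrix.cons_val_zero, Matrix.cons_val_one, Matrix.cons_val, e1, e2, d1, d2]
    simp [Matrix.mul_apply, Fin.sum_univ_three, hm0, w, formMatrix, hwr]
    ring
  · intro a
    have hx : D ![b 5, b 3] = (D + wedge W W) ![b 5, b 3] := (hm _ _ e2).symm
    have d1 : D ![b (Fin.castAdd 3 a), b 5] = 0 := hvh a 2
    have d2 : D ![b (Fin.castAdd 3 a), b 3] = 0 := hvh a 0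
    have hm0 : ∀ c, m c 1 = im (D ![b 5, b 3]) c := by intro c; rw [hx]; rfl
    have hwr := hW (b (Fin.castAdd 3 a))
    simp only [AlternatingMap.add_apply, AlternatingMap.smul_apply, trCube,
      LinearMap.compAlternatingMap_apply, wedge_one_two_apply, wedge_one_one_apply,
      Matrix.cons_val_zero, Matrix.cons_val_one, Matrix.cons_val, e0, e2, d1, d2]
    simp [Matrix.mul_apply, Fin.sum_univ_three, hm0, w, formMatrix, hwr]
    ring
  · intro a
    have hx : D ![b 3, b 4] = (D + wedge W W) ![b 3, b 4] := (hm _ _ e0).symm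
    have d1 : D ![b (Fin.castAdd 3 a), b 3] = 0 := hvh a 0
    have d2 : D ![b (Fin.castAdd 3 a), b 4] = 0 := hvh a 1
    have hm0 : ∀ c, m c 2 = im (D ![b 3, b 4]) c := by intro c; rw [hx]; rfl
    have hwr := hW (b (Fin.castAdd 3 a))
    simp only [AlternatingMap.add_apply, AlternatingMap.smul_apply, trCube,
      LinearMap.compAlternatingMap_apply, wedge_one_two_apply, wedge_one_one_apply,
      Matrix.cons_val_zero, Matrix.cons_val_one, Matrix.cons_val, e0, e1, d1, d2]
    simp [Matrix.mul_apply, Fin.sum_univ_three, hm0, w, formMatrix, hwr]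
    ring
  · simp [trCube, wedge_one_two_apply, wedge_one_one_apply, e0, e1, e2]

/-- The change of basis is unipotent triangular, so its determinant is one and every top-degree form
keeps its value. -/
theorem exists_horizontal_basis (b : Module.Basis (Fin 6) ℝ (EuclideanSpace ℝ (Fin 6)))
    (c : Fin 3 → Fin 3 → ℝ) :
    ∃ b' : Module.Basis (Fin 6) ℝ (EuclideanSpace ℝ (Fin 6)),
      (∀ a : Fin 3, b' (Fin.castAdd 3 a) = b (Fin.castAdd 3 a)) ∧
      (∀ i : Fin 3, b' (Fin.natAdd 3 i) =
        b (Fin.natAdd 3 i) - ∑ a, c i a • b (Fin.castAdd 3 a)) ∧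
      ∀ v : EuclideanSpace ℝ (Fin 6) [⋀^Fin 6]→ₗ[ℝ] ℝ, v b' = v b := by
  let f : Fin 6 → EuclideanSpace ℝ (Fin 6) := Fin.append (fun a => b (Fin.castAdd 3 a))
    (fun i => b (Fin.natAdd 3 i) - ∑ a, c i a • b (Fin.castAdd 3 a))
  have f1 : ∀ a : Fin 3, f (Fin.castAdd 3 a) = b (Fin.castAdd 3 a) :=
    fun a => Fin.append_left _ _ a
  have f2 : ∀ i : Fin 3, f (Fin.natAdd 3 i) =
      b (Fin.natAdd 3 i) - ∑ a, c i a • b (Fin.castAdd 3 a) :=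
    fun i => Fin.append_right _ _ i
  have key : ∀ i : Fin 3, ∀ j : Fin 6, Fin.natAdd 3 i ≤ j →
      b.repr (f (Fin.natAdd 3 i)) j = if Fin.natAdd 3 i = j then 1 else 0 := by
    intro i j hij
    rw [f2, map_sub, map_sum]
    simp only [map_smul, Module.Basis.repr_self, Finsupp.sub_apply, Finsupp.finsetSum_apply,
      Finsupp.smul_apply, Finsupp.single_apply]
    rw [Finset.sum_eq_zero, sub_zero]
    intro a _
    rw [if_neg]
    · simp
    · rintro rfl
      have := Fin.le_def.1 hij
      simp at this
      omega
  have hdet : b.det f = 1 := by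
    rw [Module.Basis.det_apply, Matrix.det_of_isUpperTriangular]
    · refine Finset.prod_eq_one fun j _ => ?_
      rw [Module.Basis.toMatrix_apply]
      refine Fin.addCases (m := 3) (n := 3) (motive := fun j => b.repr (f j) j = 1) ?_ ?_ j
      · intro a; rw [f1]; simp
      · intro i; rw [key i _ le_rfl]; simp
    · intro j k hkj
      rw [Module.Basis.toMatrix_apply]
      revert hkj
      refine Fin.addCases (m := 3) (n := 3)
        (motive := fun k => k < j → b.repr (f k) j = 0) ?_ ?_ k
      · intro a h
        rw [f1, b.repr_self, Finsupp.single_apply, if_neg h.ne]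
      · intro i h
        rw [key i _ h.le, if_neg h.ne]
  have hu : IsUnit (b.det f) := by rw [hdet]; exact isUnit_one
  obtain ⟨hl, hs⟩ := (b.is_basis_iff_det).2 hu
  refine ⟨Module.Basis.mk hl hs.ge, fun a => ?_, fun i => ?_, fun v => ?_⟩
  · rw [Module.Basis.mk_apply, f1]
  · rw [Module.Basis.mk_apply, f2]
  · rw [Module.Basis.coe_mk]
    conv_lhs => rw [AlternatingMap.eq_smul_basis_det b v]
    rw [AlternatingMap.smul_apply, hdet]
    simp

/-- `λ` of the Chern-Simons form, in terms of a basis whose first three vectors are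
vertical. -/
theorem hitchinLambda_chernSimons
    (b : Module.Basis (Fin 6) ℝ (EuclideanSpace ℝ (Fin 6)))
    (v : EuclideanSpace ℝ (Fin 6) [⋀^Fin 6]→ₗ[ℝ] ℝ)
    (W : EuclideanSpace ℝ (Fin 6) [⋀^Fin 1]→ₗ[ℝ] ℍ[ℝ])
    (D : EuclideanSpace ℝ (Fin 6) [⋀^Fin 2]→ₗ[ℝ] ℍ[ℝ])
    (hW : ∀ X, (W ![X]).re = 0)
    (hF : ∀ (a : Fin 3) X, (D + wedge W W) ![b (Fin.castAdd 3 a), X] = 0)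
    (hw : (formMatrix W fun a => b (Fin.castAdd 3 a)).det ≠ 0) :
    hitchinLambda v (tr.compAlternatingMap (wedge W D) + (2 / 3 : ℝ) • trCube W) =
      -128 * (formMatrix W fun a => b (Fin.castAdd 3 a)).det ^ 2 *
        (twoFormMatrix (D + wedge W W) fun i => b (Fin.natAdd 3 i)).det / (v b) ^ 2 := by
  set w := formMatrix W fun a => b (Fin.castAdd 3 a) with hwdef
  -- The coefficients solve `w c = W(b_{3+i})`: each transversal vector loses the vertical vector
  -- with the same value of `W`. The components of `F` do not notice, because `F` kills vertical
  -- arguments.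
  obtain ⟨b', h1, h2, h3⟩ := exists_horizontal_basis b
    (fun i a => (w⁻¹.mulVec (im (W ![b (Fin.natAdd 3 i)]))) a)
  have hF' : ∀ X (a : Fin 3), (D + wedge W W) ![X, b (Fin.castAdd 3 a)] = 0 := by
    intro X a
    rw [twoForm_swap, hF, neg_zero]
  have hFb : ∀ i j : Fin 3, (D + wedge W W) ![b' (Fin.natAdd 3 i), b' (Fin.natAdd 3 j)]
      = (D + wedge W W) ![b (Fin.natAdd 3 i), b (Fin.natAdd 3 j)] := by
    intro i j
    rw [h2, h2, ← lin2_apply, ← lin2_apply]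
    simp only [map_sub, map_sum, map_smul, LinearMap.sub_apply, LinearMap.sum_apply,
      LinearMap.smul_apply, lin2_apply, hF, hF', smul_zero, Finset.sum_const_zero, sub_zero]
  have ew : (formMatrix W fun a => b' (Fin.castAdd 3 a)) = w := by
    ext a i; simp [h1, hwdef]
  have em : (twoFormMatrix (D + wedge W W) fun i => b' (Fin.natAdd 3 i)) =
      twoFormMatrix (D + wedge W W) fun i => b (Fin.natAdd 3 i) := by
    ext a i
    simp only [twoFormMatrix, Matrix.of_apply, hFb]
  rw [hitchinLambda_chernSimons_of_horizontal b' v W D hW, h3, ew, em]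
  · intro a X; rw [h1, hF]
  · intro i
    apply eq_of_im_eq (hW _) (by simp)
    rw [h2, ← lin1_apply]
    simp only [map_smul, map_sub, map_sum, map_zero, lin1_apply]
    ext c
    have hinv : w * w⁻¹ = 1 := Matrix.mul_nonsing_inv w (Ne.isUnit hw)
    have := congrFun (congrArg (fun A => A.mulVec (im (W ![b (Fin.natAdd 3 i)]))) hinv) c
    simp only [← Matrix.mulVec_mulVec, Matrix.one_mulVec] at this
    rw [Matrix.mulVec, dotProduct] at this
    simp only [Pi.sub_apply, Finset.sum_apply, Pi.smul_apply, smul_eq_mul, Pi.zero_apply]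
    rw [← this, sub_eq_zero]
    refine Finset.sum_congr rfl fun a _ => ?_
    rw [mul_comm]
    rfl

end MatrixOfForms

/-! ### The equation `F = E ∧ E` -/

section FrameAlgebra

/-- The solution `A` of `m = 2 cof A` with `σ det A > 0`. -/
def frameMatrix (σ : ℝ) (m : Matrix (Fin 3) (Fin 3) ℝ) : Matrix (Fin 3) (Fin 3) ℝ :=
  (σ / (4 * √(m.det / 8))) • m.adjugate.transpose

theorem adjugate_adjugate_fin_three (A : Matrix (Fin 3) (Fin 3) ℝ) :
    A.adjugate.adjugate = A.det • A := by
  have := Matrix.adjugate_adjugate A (by simp)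
  simpa using this

theorem det_of_eq_two_cof {A m : Matrix (Fin 3) (Fin 3) ℝ}
    (h : m = (2 : ℝ) • A.adjugate.transpose) : m.det = 8 * A.det ^ 2 := by
  rw [h, Matrix.det_smul, Matrix.det_transpose, Matrix.det_adjugate]
  norm_num

/-- From `m = 2 cof A` follow `det m = 8 (det A)²` and `cof m = 4 (det A) A`. The first gives `|det
A|`, the sign `σ` gives `det A`, and the second then gives `A`; `σ² = 1` makes `σ` its own inverse.
-/
theorem frameMatrix_iff {σ : ℝ} (hσ : σ ^ 2 = 1) {A m : Matrix (Fin 3) (Fin 3) ℝ}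
    (hm : 0 < m.det) :
    (m = (2 : ℝ) • A.adjugate.transpose ∧ 0 < σ * A.det) ↔ A = frameMatrix σ m := by
  constructor
  · rintro ⟨h, h0⟩
    have h1 := det_of_eq_two_cof h
    have h2 : √(m.det / 8) = σ * A.det := by
      rw [h1, show 8 * A.det ^ 2 / 8 = (σ * A.det) ^ 2 by rw [mul_pow, hσ]; ring,
        Real.sqrt_sq h0.le]
    have h3 : m.adjugate.transpose = (4 * A.det) • A := by
      rw [h, Matrix.adjugate_smul, Matrix.adjugate_transpose, Matrix.transpose_smul,
        Matrix.adjugate_transpose, Matrix.adjugate_transpose, Matrix.transpose_transpose, adjugate_adjugate_fin_three, smul_smul]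
      norm_num
    rw [frameMatrix, h2, h3, smul_smul]
    have h4 : σ ≠ 0 := by rintro rfl; simp at hσ
    have h5 : A.det ≠ 0 := by intro h; simp [h] at h0
    rw [show σ / (4 * (σ * A.det)) * (4 * A.det) = 1 by field_simp, one_smul]
  · rintro rfl
    have hd : 0 < m.det / 8 := by positivity
    set s := √(m.det / 8) with hs
    have hs0 : 0 < s := Real.sqrt_pos.2 hd
    have hs2 : s ^ 2 = m.det / 8 := Real.sq_sqrt hd.le
    have hmd : m.det = 8 * s ^ 2 := by rw [hs2]; ring
    constructor
    · rw [frameMatrix, ← hs, Matrix.adjugate_smul, Matrix.adjugate_transpose,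
        Matrix.transpose_smul, Matrix.adjugate_transpose, Matrix.adjugate_transpose,
        Matrix.transpose_transpose, adjugate_adjugate_fin_three, smul_smul,
        smul_smul, hmd]
      rw [show 2 * (σ / (4 * s)) ^ (Fintype.card (Fin 3) - 1) * (8 * s ^ 2) = 1 by
        simp only [Fintype.card_fin, Nat.add_one_sub_one, div_pow, hσ]
        field_simp
        norm_num, one_smul]
    · rw [frameMatrix, ← hs, Matrix.det_smul, Matrix.det_transpose, Matrix.det_adjugate, hmd]
      have : σ * ((σ / (4 * s)) ^ Fintype.card (Fin 3) * (8 * s ^ 2) ^ (Fintype.card (Fin 3) - 1))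
          = (σ ^ 2) ^ 2 * s := by
        simp only [Fintype.card_fin, Nat.add_one_sub_one]
        field_simp
        ring
      rw [this, hσ]; simpa using hs0

variable {V : Type*} [AddCommGroup V] [Module ℝ V]
  (L : V →ₗ[ℝ] EuclideanSpace ℝ (Fin 3)) (X : Fin 3 → V)
  (β : Module.Basis (Fin 3) ℝ (EuclideanSpace ℝ (Fin 3)))

theorem horizontal_oneForm_apply (hβ : ∀ i, β i = L (X i)) {e : V [⋀^Fin 1]→ₗ[ℝ] ℍ[ℝ]}
    (he : ∀ Y, L Y = 0 → e ![Y] = 0) (Y : V) :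
    e ![Y] = ∑ i, β.repr (L Y) i • e ![X i] := by
  have h : L (Y - ∑ i, β.repr (L Y) i • X i) = 0 := by
    rw [map_sub, map_sum]
    simp only [map_smul, ← hβ]
    rw [β.sum_repr, sub_self]
  have := he _ h
  rw [← lin1_apply, map_sub, map_sum, sub_eq_zero] at this
  simpa [lin1_apply] using this

theorem formMatrix_of_horizontal (hβ : ∀ i, β i = L (X i)) {e : V [⋀^Fin 1]→ₗ[ℝ] ℍ[ℝ]}
    (he : ∀ Y, L Y = 0 → e ![Y] = 0) (Y : Fin 3 → V) :
    formMatrix e Y = formMatrix e X * β.toMatrix (fun j => L (Y j)) := by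
  ext a j
  rw [formMatrix, Matrix.of_apply, horizontal_oneForm_apply L X β hβ he (Y j), map_sum,
    Matrix.mul_apply, Finset.sum_apply]
  refine Finset.sum_congr rfl fun i _ => ?_
  rw [map_smul, Pi.smul_apply, smul_eq_mul, mul_comm]
  rfl

/-- The `X i` lift a basis, so they span modulo the kernel of `L`, and the cyclic pairs exhaust all
pairs up to sign and the diagonal. It suffices to treat the difference of the two forms. -/
theorem horizontal_twoForm_ext (hβ : ∀ i, β i = L (X i)) {F G : V [⋀^Fin 2]→ₗ[ℝ] ℍ[ℝ]}
    (hF : ∀ Y Z, L Y = 0 → F ![Y, Z] = 0) (hG : ∀ Y Z, L Y = 0 → G ![Y, Z] = 0)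
    (hFr : ∀ Y Z, (F ![Y, Z]).re = 0) (hGr : ∀ Y Z, (G ![Y, Z]).re = 0)
    (h : twoFormMatrix F X = twoFormMatrix G X) : F = G := by
  suffices hs : ∀ D : V [⋀^Fin 2]→ₗ[ℝ] ℍ[ℝ], (∀ Y Z, L Y = 0 → D ![Y, Z] = 0) →
      (∀ c, D ![X (c + 1), X (c + 2)] = 0) → D = 0 by
    rw [← sub_eq_zero]
    refine hs (F - G) (fun Y Z hY => by simp [hF Y Z hY, hG Y Z hY]) fun c => ?_
    rw [AlternatingMap.sub_apply, sub_eq_zero]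
    refine eq_of_im_eq (hFr _ _) (hGr _ _) ?_
    ext a
    exact congrFun (congrFun h a) c
  intro D hD hX
  have hD' : ∀ Y Z, L Z = 0 → D ![Y, Z] = 0 := fun Y Z hZ => by
    rw [twoForm_swap, hD _ _ hZ, neg_zero]
  have hXX : ∀ i j, D ![X i, X j] = 0 := by
    have h0 := hX 0
    have h1 := hX 1
    have h2 := hX 2
    intro i j
    fin_cases i <;> fin_cases j
    · exact twoForm_self _ _
    · exact h2
    · exact (twoForm_swap _ _ _).trans (neg_eq_zero.2 h1)
    · exact (twoForm_swap _ _ _).trans (neg_eq_zero.2 h2)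
    · exact twoForm_self _ _
    · exact h0
    · exact h1
    · exact (twoForm_swap _ _ _).trans (neg_eq_zero.2 h0)
    · exact twoForm_self _ _
  have hdec : ∀ Y, ∃ c : Fin 3 → ℝ, L (Y - ∑ i, c i • X i) = 0 := by
    intro Y
    refine ⟨fun i => β.repr (L Y) i, ?_⟩
    rw [map_sub, map_sum]
    simp only [map_smul, ← hβ]
    rw [β.sum_repr, sub_self]
  ext1 Y
  have hY : Y = ![Y 0, Y 1] := by ext i; fin_cases i <;> rfl
  rw [hY]
  obtain ⟨c, hc⟩ := hdec (Y 0)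
  obtain ⟨d, hd⟩ := hdec (Y 1)
  have e1 := hD _ (Y 1) hc
  rw [← lin2_apply, map_sub, LinearMap.sub_apply, lin2_apply, sub_eq_zero] at e1
  have e2 : ∀ i, D ![X i, Y 1] = 0 := by
    intro i
    have := hD' (X i) _ hd
    rw [← lin2_apply, map_sub, lin2_apply, sub_eq_zero] at this
    rw [this]
    simp [lin2_apply, hXX]
  rw [e1]
  simp [lin2_apply, e2]

/-- The horizontal 1-form with given components on a transversal triple. -/
def horizontalForm (A : Matrix (Fin 3) (Fin 3) ℝ) : V [⋀^Fin 1]→ₗ[ℝ] ℍ[ℝ] :=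
  AlternatingMap.ofSubsingleton ℝ V ℍ[ℝ] (0 : Fin 1)
    (ofIm ∘ₗ A.mulVecLin ∘ₗ β.equivFun.toLinearMap ∘ₗ L)

theorem horizontalForm_apply (A : Matrix (Fin 3) (Fin 3) ℝ) (Y : V) :
    horizontalForm L β A ![Y] = ofIm (A.mulVec (β.repr (L Y))) := by
  simp [horizontalForm, Module.Basis.equivFun_apply]

theorem formMatrix_horizontalForm (hβ : ∀ i, β i = L (X i)) (A : Matrix (Fin 3) (Fin 3) ℝ) :
    formMatrix (horizontalForm L β A) X = A := by
  ext a i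
  rw [formMatrix, Matrix.of_apply, horizontalForm_apply, ← hβ, im_ofIm, β.repr_self,
    Finsupp.single_eq_pi_single, Matrix.mulVec_single_one]
  rfl

theorem eq_horizontalForm (hβ : ∀ i, β i = L (X i)) {e : V [⋀^Fin 1]→ₗ[ℝ] ℍ[ℝ]}
    (hr : ∀ Y, (e ![Y]).re = 0) (he : ∀ Y, L Y = 0 → e ![Y] = 0) :
    e = horizontalForm L β (formMatrix e X) := by
  ext1 Y
  have hY : Y = ![Y 0] := by ext i; fin_cases i; rfl
  rw [hY]
  refine eq_of_im_eq (hr _) (by rw [horizontalForm_apply, re_ofIm]) ?_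
  rw [horizontalForm_apply, im_ofIm, horizontal_oneForm_apply L X β hβ he, map_sum]
  ext a
  rw [Finset.sum_apply, Matrix.mulVec, dotProduct]
  refine Finset.sum_congr rfl fun i _ => ?_
  rw [map_smul, Pi.smul_apply, smul_eq_mul, mul_comm]
  rfl

/-- The two conditions translate separately. Both sides of `F = e ∧ e` are horizontal and imaginary,
so the equation can be tested on the triple, where it is the cofactor equation. On the same triple
`-(2/3) Tr e³` equals `8 det A`; since both 3-forms descend to the base, a positive factor exists
exactly when `det A` has the sign of `ν β`. -/
theorem frame_conditions_iff (hβ : ∀ i, β i = L (X i)) {F : V [⋀^Fin 2]→ₗ[ℝ] ℍ[ℝ]}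
    (hF : ∀ Y Z, L Y = 0 → F ![Y, Z] = 0) (hFr : ∀ Y Z, (F ![Y, Z]).re = 0)
    (hm : 0 < (twoFormMatrix F X).det)
    (ν : EuclideanSpace ℝ (Fin 3) [⋀^Fin 3]→ₗ[ℝ] ℝ) (hν : ν ≠ 0)
    {e : V [⋀^Fin 1]→ₗ[ℝ] ℍ[ℝ]}
    (hr : ∀ Y, (e ![Y]).re = 0) (he : ∀ Y, L Y = 0 → e ![Y] = 0) :
    (F = wedge e e ∧ ∃ c : ℝ, 0 < c ∧ ∀ Y : Fin 3 → V,
      -(2 / 3 : ℝ) * trCube e Y = c * ν fun i => L (Y i)) ↔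
    formMatrix e X = frameMatrix (SignType.sign (ν β)) (twoFormMatrix F X) := by
  have hνβ : ν β ≠ 0 := by
    intro h
    apply hν
    rw [AlternatingMap.eq_smul_basis_det β ν, h, zero_smul]
  have hσ : ((SignType.sign (ν β) : ℝ)) ^ 2 = 1 := by
    rcases lt_or_gt_of_ne hνβ with h | h <;> simp [h]
  have hσν : 0 < (SignType.sign (ν β) : ℝ) * ν β := by
    rcases lt_or_gt_of_ne hνβ with h | h <;> simp [h]
  rw [← frameMatrix_iff hσ hm]
  have hβL : (fun i => L (X i)) = β := by ext1 i; rw [hβ]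
  refine and_congr ?_ ?_
  · constructor
    · rintro rfl
      exact twoFormMatrix_wedge e X fun i => hr _
    · intro h
      refine horizontal_twoForm_ext L X β hβ hF ?_ hFr ?_ ?_
      · intro Y Z hY
        simp [wedge_one_one_apply, he Y hY]
      · intro Y Z
        rw [wedge_one_one_apply]
        simp
        ring
      · rw [twoFormMatrix_wedge e X fun i => hr _, ← h]
  · constructor
    · rintro ⟨c, hc, h⟩
      have h1 := h X
      rw [trCube_apply e X fun i => hr _, hβL] at h1
      have h2 : (formMatrix e X).det = c / 8 * ν β := by linarith
      rw [h2, mul_left_comm]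
      positivity
    · intro h
      refine ⟨8 * (formMatrix e X).det / ν β, ?_, fun Y => ?_⟩
      · have : 8 * (formMatrix e X).det / ν β =
          8 * ((SignType.sign (ν β) : ℝ) * (formMatrix e X).det) /
            ((SignType.sign (ν β) : ℝ) * ν β) := by
          have h0 : (SignType.sign (ν β) : ℝ) ≠ 0 := by
            intro h; simp [h] at hσν
          field_simp
        rw [this]
        positivity
      · rw [trCube_apply e Y fun i => hr _, formMatrix_of_horizontal L X β hβ he,
          AlternatingMap.eq_smul_basis_det β ν, Matrix.det_mul]
        rw [AlternatingMap.smul_apply, AlternatingMap.smul_apply, β.det_self,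
          Module.Basis.det_apply]
        simp only [smul_eq_mul, mul_one]
        field_simp
        ring

end FrameAlgebra

/-! ### Pullbacks of one-forms to vector spaces -/

section Pull

variable {n : ℕ} {M : Type*} [TopologicalSpace M] [ChartedSpace (EuclideanSpace ℝ (Fin n)) M]
  {F : Type*} [NormedAddCommGroup F] [NormedSpace ℝ F]
  {E : Type*} [NormedAddCommGroup E] [NormedSpace ℝ E]
  {E' : Type*} [NormedAddCommGroup E'] [NormedSpace ℝ E']

/-- The derivative of a map from a vector space to a manifold. -/
abbrev dmap (f : E → M) (y : E) : E →L[ℝ] EuclideanSpace ℝ (Fin n) :=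
  mfderiv 𝓘(ℝ, E) (𝓡 n) f y

/-- The pullback of a one-form under a map from a vector space. -/
def pull (η : DiffForm n M F 1) (f : E → M) (y : E) : E →L[ℝ] F :=
  ((ContinuousAlternatingMap.ofSubsingleton ℝ (EuclideanSpace ℝ (Fin n)) F (0 : Fin 1)).symm
    (η (f y))).comp (dmap f y)

theorem pull_apply (η : DiffForm n M F 1) (f : E → M) (y u : E) :
    pull η f y u = η (f y) ![dmap f y u] := by
  change η (f y) _ = _
  congr 1
  ext i; fin_cases i; rfl

theorem pull_congr (η : DiffForm n M F 1) {f g : E → M} {y : E} (h : f =ᶠ[𝓝 y] g) :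
    pull η f y = pull η g y := by
  ext u
  rw [pull_apply, pull_apply, dmap, h.mfderiv_eq, h.eq_of_nhds]

theorem pull_comp (η : DiffForm n M F 1) {f : E → M} {g : E' → E} {y : E'}
    (hf : MDifferentiableAt 𝓘(ℝ, E) (𝓡 n) f (g y)) (hg : DifferentiableAt ℝ g y) :
    pull η (f ∘ g) y = (pull η f (g y)).comp (fderiv ℝ g y) := by
  ext u
  rw [pull_apply, ContinuousLinearMap.comp_apply, pull_apply, dmap,
    mfderiv_comp y hf hg.mdifferentiableAt, mfderiv_eq_fderiv]
  rfl

theorem chartRep_eq_pull (η : DiffForm n M F 1) (x₀ : M) (y : EuclideanSpace ℝ (Fin n)) :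
    chartRep η x₀ y = ContinuousAlternatingMap.ofSubsingletonLIE (0 : Fin 1)
      (pull η (extChartAt (𝓡 n) x₀).symm y) := by
  ext u
  change _ = pull η (extChartAt (𝓡 n) x₀).symm y (u 0)
  rw [pull_apply]
  change η _ (fun i => dmap _ y (u i)) = _
  congr 1
  ext1 i; fin_cases i; rfl

theorem isSmoothForm_iff_pull (η : DiffForm n M F 1) :
    IsSmoothForm η ↔ ∀ x₀ : M, ∀ y ∈ (extChartAt (𝓡 n) x₀).target,
      ContDiffAt ℝ ∞ (pull η (extChartAt (𝓡 n) x₀).symm) y := by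
  refine forall_congr' fun x₀ => ?_
  have ho := isOpen_extChartAt_target (I := 𝓡 n) x₀
  have h1 : chartRep η x₀ = fun y => ContinuousAlternatingMap.ofSubsingletonLIE (𝕜 := ℝ)
      (E := EuclideanSpace ℝ (Fin n)) (F := F) (0 : Fin 1)
      (pull η (extChartAt (𝓡 n) x₀).symm y) := funext fun y => chartRep_eq_pull η x₀ y
  have h2 : pull η (extChartAt (𝓡 n) x₀).symm = fun y =>
      (ContinuousAlternatingMap.ofSubsingletonLIE (𝕜 := ℝ)
      (E := EuclideanSpace ℝ (Fin n)) (F := F) (0 : Fin 1)).symm (chartRep η x₀ y) := by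
    funext y; rw [chartRep_eq_pull, LinearIsometryEquiv.symm_apply_apply]
  constructor
  · intro h y hy
    rw [h2]
    exact (LinearIsometryEquiv.contDiff _).contDiffAt.comp y (h.contDiffAt (ho.mem_nhds hy))
  · intro h y hy
    rw [h1]
    exact ((LinearIsometryEquiv.contDiff _).contDiffAt.comp y (h y hy)).contDiffWithinAt

variable [IsManifold (𝓡 n) ∞ M]

theorem contMDiffAt_chart_symm (x₀ : M) {y : EuclideanSpace ℝ (Fin n)}
    (hy : y ∈ (extChartAt (𝓡 n) x₀).target) :
    ContMDiffAt 𝓘(ℝ, EuclideanSpace ℝ (Fin n)) (𝓡 n) ∞ (extChartAt (𝓡 n) x₀).symm y :=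
  (contMDiffOn_extChartAt_symm x₀).contMDiffAt
    ((isOpen_extChartAt_target (I := 𝓡 n) x₀).mem_nhds hy)

theorem contMDiffAt_chart (x₀ : M) {x : M} (hx : x ∈ (extChartAt (𝓡 n) x₀).source) :
    ContMDiffAt (𝓡 n) 𝓘(ℝ, EuclideanSpace ℝ (Fin n)) ∞ (extChartAt (𝓡 n) x₀) x :=
  contMDiffAt_extChartAt' (by rwa [extChartAt_source] at hx)

theorem contDiffAt_chart_comp {f : E → M} {y : E} (x₀ : M)
    (hx : f y ∈ (extChartAt (𝓡 n) x₀).source) (hf : ContMDiffAt 𝓘(ℝ, E) (𝓡 n) ∞ f y) :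
    ContDiffAt ℝ ∞ (extChartAt (𝓡 n) x₀ ∘ f) y :=
  contMDiffAt_iff_contDiffAt.1 ((contMDiffAt_chart x₀ hx).comp y hf)

/-- Locally `f` factors through the chart at `x₀`, which reduces pullbacks along arbitrary maps to
the chart representatives that define smoothness. -/
theorem eventually_pull_eq (η : DiffForm n M F 1) {f : E → M} {y : E} (x₀ : M)
    (hx : f y ∈ (extChartAt (𝓡 n) x₀).source) (hf : ContMDiffAt 𝓘(ℝ, E) (𝓡 n) ∞ f y) :
    ∀ᶠ y' in 𝓝 y, pull η f y' = (pull η (extChartAt (𝓡 n) x₀).symm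
      (extChartAt (𝓡 n) x₀ (f y'))).comp (fderiv ℝ (extChartAt (𝓡 n) x₀ ∘ f) y') := by
  have ho : ∀ᶠ y' in 𝓝 y, f y' ∈ (extChartAt (𝓡 n) x₀).source :=
    hf.continuousAt ((isOpen_extChartAt_source (I := 𝓡 n) x₀).mem_nhds hx)
  have hd : ∀ᶠ y' in 𝓝 y, ContDiffAt ℝ 1 (extChartAt (𝓡 n) x₀ ∘ f) y' :=
    ((contDiffAt_chart_comp x₀ hx hf).of_le (by exact_mod_cast le_top)).eventually (by simp)
  filter_upwards [ho.eventually_nhds, hd] with y' h1 h2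
  have h3 : f =ᶠ[𝓝 y'] (extChartAt (𝓡 n) x₀).symm ∘ (extChartAt (𝓡 n) x₀ ∘ f) := by
    filter_upwards [h1] with z hz
    exact ((extChartAt (𝓡 n) x₀).left_inv hz).symm
  rw [pull_congr η h3, pull_comp η _ (h2.differentiableAt one_ne_zero)]
  · rfl
  · exact (contMDiffAt_chart_symm x₀ ((extChartAt (𝓡 n) x₀).map_source
      h1.self_of_nhds)).mdifferentiableAt (by simp)

theorem contDiffAt_pull {η : DiffForm n M F 1} (hη : IsSmoothForm η) {f : E → M} {y : E}
    (hf : ContMDiffAt 𝓘(ℝ, E) (𝓡 n) ∞ f y) : ContDiffAt ℝ ∞ (pull η f) y := by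
  have hx := mem_extChartAt_source (I := 𝓡 n) (f y)
  have hg := contDiffAt_chart_comp (f y) hx hf
  refine ContDiffAt.congr_of_eventuallyEq ?_ (eventually_pull_eq η (f y) hx hf)
  have h1 : ContDiffAt ℝ ∞ (fun y' => pull η (extChartAt (𝓡 n) (f y)).symm
      (extChartAt (𝓡 n) (f y) (f y'))) y :=
    ((isSmoothForm_iff_pull η).1 hη (f y) _ (mem_extChartAt_target (f y))).comp
      (g := pull η (extChartAt (𝓡 n) (f y)).symm) y hg
  exact h1.clm_comp (hg.fderiv_right (by simp))

/-- The chart at a point has identity derivative at that point. This is the identification of the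
tangent space with Euclidean space on which `extD` rests. -/
theorem fderiv_chart_comp_self {f : E → M} {y : E} (hf : MDifferentiableAt 𝓘(ℝ, E) (𝓡 n) f y)
    (u : E) : fderiv ℝ (extChartAt (𝓡 n) (f y) ∘ f) y u = dmap f y u := by
  rw [← mfderiv_eq_fderiv, mfderiv_comp y
    ((contMDiffAt_chart (f y) (mem_extChartAt_source (f y))).mdifferentiableAt (by simp)) hf,
    mfderiv_extChartAt_self]
  rfl

/-- Naturality of the exterior derivative of one-forms. -/
theorem extD_apply_dmap {η : DiffForm n M F 1} (hη : IsSmoothForm η) {f : E → M} {y : E}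
    (hf : ContMDiffAt 𝓘(ℝ, E) (𝓡 n) ∞ f y) (u v : E) :
    extD η (f y) ![dmap f y u, dmap f y v] =
      fderiv ℝ (pull η f) y u v - fderiv ℝ (pull η f) y v u := by
  have hx := mem_extChartAt_source (I := 𝓡 n) (f y)
  have hg := contDiffAt_chart_comp (f y) hx hf
  have hω : DifferentiableAt ℝ (chartRep η (f y)) ((extChartAt (𝓡 n) (f y) ∘ f) y) :=
    ((hη (f y)).contDiffAt ((isOpen_extChartAt_target (I := 𝓡 n) (f y)).mem_nhds
      (mem_extChartAt_target (f y)))).differentiableAt (by simp)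
  -- Naturality between vector spaces is applied to the coordinate expression of `f` in the chart at
  -- `f y`.
  have h1 := extDeriv_pullback hω hg (r := ∞)
    (by rw [minSmoothness_of_isRCLikeNormedField]; exact WithTop.coe_le_coe.2 (le_top : (2 : ℕ∞) ≤ ⊤))
  have h2 : (fun y' => (chartRep η (f y) ((extChartAt (𝓡 n) (f y) ∘ f) y')).compContinuousLinearMap
      (fderiv ℝ (extChartAt (𝓡 n) (f y) ∘ f) y')) =ᶠ[𝓝 y]
      fun y' => ContinuousAlternatingMap.ofSubsingletonLIE (𝕜 := ℝ) (0 : Fin 1) (pull η f y') := by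
    filter_upwards [eventually_pull_eq η (f y) hx hf] with y' h
    rw [h, chartRep_eq_pull]
    rfl
  rw [h2.extDeriv_eq] at h1
  have hp := (contDiffAt_pull hη hf).differentiableAt (by simp)
  have h3 : DifferentiableAt ℝ (fun y' => ContinuousAlternatingMap.ofSubsingletonLIE (𝕜 := ℝ)
      (0 : Fin 1) (pull η f y')) y :=
    (LinearIsometryEquiv.differentiable _).differentiableAt.comp y hp
  have h4 := congrArg (fun ζ => ζ ![u, v]) h1
  simp only [extDeriv_apply h3] at h4
  have h5 : ∀ w z : E, fderiv ℝ (fun y' => pull η f y' w) y z = fderiv ℝ (pull η f) y z w := by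
    intro w z
    rw [fderiv_clm_apply hp (differentiableAt_const w)]
    simp
  have h6 : ∀ (i : Fin 2) (y' : E), (ContinuousAlternatingMap.ofSubsingletonLIE (𝕜 := ℝ)
      (0 : Fin 1) (pull η f y')) (i.removeNth ![u, v]) = pull η f y' (![v, u] i) := by
    intro i y'
    fin_cases i <;> rfl
  simp only [h6, h5] at h4
  have hd := hf.mdifferentiableAt (by simp : (∞ : WithTop ℕ∞) ≠ 0)
  have h7 : ((extDeriv (chartRep η (f y)) ((extChartAt (𝓡 n) (f y) ∘ f) y)).compContinuousLinearMap
      (fderiv ℝ (extChartAt (𝓡 n) (f y) ∘ f) y)) ![u, v] =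
      extD η (f y) ![dmap f y u, dmap f y v] := by
    rw [ContinuousAlternatingMap.compContinuousLinearMap_apply]
    change extD η (f y) _ = _
    congr 1
    ext1 i
    fin_cases i
    · exact fderiv_chart_comp_self hd u
    · exact fderiv_chart_comp_self hd v
  rw [h7] at h4
  rw [← h4]
  simp [sub_eq_add_neg]

end Pull

/-! ### Principal bundles: vertical vectors and local sections -/

section SU2Geometry

theorem contMDiff_coe_SU2 :
    ContMDiff (𝓡 3) 𝓘(ℝ, ℍ[ℝ]) ∞ fun h : SU2 => (h : ℍ[ℝ]) :=
  contMDiff_coe_sphere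

theorem contMDiff_mul_SU2 :
    ContMDiff ((𝓡 3).prod (𝓡 3)) (𝓡 3) ∞ fun z : SU2 × SU2 => z.1 * z.2 := by
  have h : ContMDiff ((𝓡 3).prod (𝓡 3)) 𝓘(ℝ, ℍ[ℝ]) ∞
      fun z : SU2 × SU2 => (z.1 : ℍ[ℝ]) * (z.2 : ℍ[ℝ]) := by
    have h1 : ContMDiff ((𝓡 3).prod (𝓡 3)) 𝓘(ℝ, ℍ[ℝ] × ℍ[ℝ]) ∞
        fun z : SU2 × SU2 => ((z.1 : ℍ[ℝ]), (z.2 : ℍ[ℝ])) :=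
      (contMDiff_coe_SU2.comp contMDiff_fst).prodMk_space (contMDiff_coe_SU2.comp contMDiff_snd)
    exact (contDiff_mul (𝕜 := ℝ) (𝔸 := ℍ[ℝ])).contMDiff.comp h1
  exact h.codRestrict_sphere fun z => by simp

theorem contMDiff_mul_left_SU2 (g : SU2) : ContMDiff (𝓡 3) (𝓡 3) ∞ fun h : SU2 => g * h :=
  contMDiff_mul_SU2.comp (contMDiff_const.prodMk contMDiff_id)

theorem coe_inv_SU2 (g : SU2) : ((g⁻¹ : SU2) : ℍ[ℝ]) = star (g : ℍ[ℝ]) := by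
  have h1 : ((g⁻¹ : SU2) : ℍ[ℝ]) * (g : ℍ[ℝ]) = 1 := by
    rw [← Metric.unitSphere.coe_mul, inv_mul_cancel]; rfl
  have h2 : (g : ℍ[ℝ]) * star (g : ℍ[ℝ]) = 1 := by
    rw [Quaternion.self_mul_star, Quaternion.normSq_eq_norm_mul_self, mem_sphere_zero_iff_norm.1 g.2]
    simp
  calc ((g⁻¹ : SU2) : ℍ[ℝ]) = ((g⁻¹ : SU2) : ℍ[ℝ]) * ((g : ℍ[ℝ]) * star (g : ℍ[ℝ])) := by
        rw [h2, mul_one]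
    _ = star (g : ℍ[ℝ]) := by rw [← mul_assoc, h1, one_mul]

theorem coe_inv_mul_SU2 (g : SU2) : ((g⁻¹ : SU2) : ℍ[ℝ]) * (g : ℍ[ℝ]) = 1 := by
  rw [← Metric.unitSphere.coe_mul, inv_mul_cancel]; rfl

theorem coe_mul_inv_SU2 (g : SU2) : (g : ℍ[ℝ]) * ((g⁻¹ : SU2) : ℍ[ℝ]) = 1 := by
  rw [← Metric.unitSphere.coe_mul, mul_inv_cancel]; rfl

theorem re_conj_SU2 (g : SU2) (x : ℍ[ℝ]) :
    (((g⁻¹ : SU2) : ℍ[ℝ]) * x * (g : ℍ[ℝ])).re = x.re := by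
  have h : ∀ a b : ℍ[ℝ], (a * b).re = (b * a).re := by intro a b; simp; ring
  rw [h, ← mul_assoc, coe_mul_inv_SU2, one_mul]

/-- Quaternionic conjugation as a continuous linear map. -/
def starCLM : ℍ[ℝ] →L[ℝ] ℍ[ℝ] :=
  LinearMap.toContinuousLinearMap
    { toFun := star
      map_add' := star_add
      map_smul' := fun c x => by ext <;> simp }

@[simp] theorem starCLM_apply (x : ℍ[ℝ]) : starCLM x = star x := rfl

/-- The differential of the inclusion of the group in the quaternions. -/
abbrev dcoe (g : SU2) : EuclideanSpace ℝ (Fin 3) →L[ℝ] ℍ[ℝ] :=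
  mfderiv (𝓡 3) 𝓘(ℝ, ℍ[ℝ]) (fun h : SU2 => (h : ℍ[ℝ])) g

theorem maurerCartan_apply (g : SU2) (Z : EuclideanSpace ℝ (Fin 3)) :
    maurerCartan g Z = ((g⁻¹ : SU2) : ℍ[ℝ]) * dcoe g Z :=
  rfl

theorem maurerCartan_one_apply (Z : EuclideanSpace ℝ (Fin 3)) :
    maurerCartan 1 Z = dcoe 1 Z := by
  rw [maurerCartan_apply, inv_one, Metric.unitSphere.coe_one, one_mul]

theorem dcoe_injective (g : SU2) : Function.Injective (dcoe g) := by
  convert! injective_mvfderiv_subtypeVal_sphere (n := 3) g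

theorem range_dcoe (g : SU2) : (dcoe g).range = (ℝ ∙ (g : ℍ[ℝ]))ᗮ := by
  convert! range_mvfderiv_subtypeVal (n := 3) g

/-- Tangent vectors `u` to the sphere at `g` are orthogonal to `g`, and the inner product of `g` and
`u` is the real part of `star g * u`. -/
theorem re_maurerCartan (g : SU2) (Z : EuclideanSpace ℝ (Fin 3)) : (maurerCartan g Z).re = 0 := by
  have h : dcoe g Z ∈ (ℝ ∙ (g : ℍ[ℝ]))ᗮ := by
    rw [← range_dcoe]; exact ⟨Z, rfl⟩
  rw [Submodule.mem_orthogonal_singleton_iff_inner_left, Quaternion.inner_def] at h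
  rw [maurerCartan_apply, coe_inv_SU2]
  simp at h ⊢
  linarith

theorem maurerCartan_injective (g : SU2) : Function.Injective (maurerCartan g) := by
  intro Z Z' h
  apply dcoe_injective g
  have h' := congrArg (fun x => (g : ℍ[ℝ]) * x) h
  change (g : ℍ[ℝ]) * (((g⁻¹ : SU2) : ℍ[ℝ]) * dcoe g Z) =
    (g : ℍ[ℝ]) * (((g⁻¹ : SU2) : ℍ[ℝ]) * dcoe g Z') at h'
  simpa only [← mul_assoc, coe_mul_inv_SU2, one_mul] using h'

theorem dmap_chart_symm_self {n : ℕ} {M : Type*} [TopologicalSpace M]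
    [ChartedSpace (EuclideanSpace ℝ (Fin n)) M] [IsManifold (𝓡 n) ∞ M] (x : M)
    (v : EuclideanSpace ℝ (Fin n)) :
    dmap (extChartAt (𝓡 n) x).symm (extChartAt (𝓡 n) x x) v = v := by
  have h := mfderivWithin_range_extChartAt_symm (I := 𝓡 n) (x := x)
  rw [ModelWithCorners.range_eq_univ, mfderivWithin_univ] at h
  exact congrArg (fun T => T v) h

theorem dmap_comp {n : ℕ} {M : Type*} [TopologicalSpace M]
    [ChartedSpace (EuclideanSpace ℝ (Fin n)) M]
    {E : Type*} [NormedAddCommGroup E] [NormedSpace ℝ E]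
    {E' : Type*} [NormedAddCommGroup E'] [NormedSpace ℝ E'] {f : E → M} {g : E' → E} {y : E'}
    (hf : MDifferentiableAt 𝓘(ℝ, E) (𝓡 n) f (g y)) (hg : DifferentiableAt ℝ g y) (v : E') :
    dmap (n := n) (fun y => f (g y)) y v = dmap (n := n) f (g y) (fderiv ℝ g y v) := by
  have := mfderiv_comp y hf hg.mdifferentiableAt
  rw [mfderiv_eq_fderiv] at this
  exact congrArg (fun T => T v) this

end SU2Geometry

namespace PrincipalSU2Bundle

variable {M P : Type*} [TopologicalSpace M] [ChartedSpace (EuclideanSpace ℝ (Fin 3)) M]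
  [TopologicalSpace P] [ChartedSpace (EuclideanSpace ℝ (Fin 6)) P] (B : PrincipalSU2Bundle M P)

/-- The differential of the projection. -/
abbrev dproj (p : P) : EuclideanSpace ℝ (Fin 6) →L[ℝ] EuclideanSpace ℝ (Fin 3) :=
  mfderiv (𝓡 6) (𝓡 3) B.proj p

/-- The differential of the orbit map through `p`. -/
abbrev dorbit (p : P) (g : SU2) : EuclideanSpace ℝ (Fin 3) →L[ℝ] EuclideanSpace ℝ (Fin 6) :=
  mfderiv (𝓡 3) (𝓡 6) (B.act p) g

theorem contMDiff_orbit (p : P) : ContMDiff (𝓡 3) (𝓡 6) ∞ (B.act p) :=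
  B.contMDiff_act.comp (contMDiff_const.prodMk contMDiff_id)

theorem contMDiff_act_right (g : SU2) : ContMDiff (𝓡 6) (𝓡 6) ∞ fun q => B.act q g :=
  B.contMDiff_act.comp (contMDiff_id.prodMk contMDiff_const)

theorem dproj_dorbit (p : P) (g : SU2) (Z : EuclideanSpace ℝ (Fin 3)) :
    B.dproj (B.act p g) (B.dorbit p g Z) = 0 := by
  have h : B.proj ∘ B.act p = fun _ => B.proj p := funext fun g => B.proj_act p g
  have h1 := mfderiv_comp g (I := 𝓡 3) (I' := 𝓡 6) (I'' := 𝓡 3) (g := B.proj) (f := B.act p)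
    (B.contMDiff_proj.mdifferentiableAt (by simp)) ((B.contMDiff_orbit p).mdifferentiableAt (by simp))
  rw [h, mfderiv_const] at h1
  exact (congrArg (fun T => T Z) h1).symm

variable {E : Type*} [NormedAddCommGroup E] [NormedSpace ℝ E]

theorem dmap_act_right {f : E → P} {y : E}
    (hf : MDifferentiableAt 𝓘(ℝ, E) (𝓡 6) f y) (g : SU2) (v : E) :
    dmap (fun y => B.act (f y) g) y v =
      mfderiv (𝓡 6) (𝓡 6) (fun q => B.act q g) (f y) (dmap f y v) := by
  have := mfderiv_comp y (I := 𝓘(ℝ, E)) (I' := 𝓡 6) (I'' := 𝓡 6) (g := fun q => B.act q g)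
    (f := f) ((B.contMDiff_act_right g).mdifferentiableAt (by simp)) hf
  exact congrArg (fun T => T v) this

theorem pull_act_right {η : DiffForm 6 P ℍ[ℝ] 1} (hη : IsEquivariant B η) {f : E → P} {y : E}
    (hf : MDifferentiableAt 𝓘(ℝ, E) (𝓡 6) f y) (g : SU2) (v : E) :
    pull η (fun y => B.act (f y) g) y v = ((g⁻¹ : SU2) : ℍ[ℝ]) * pull η f y v * (g : ℍ[ℝ]) := by
  rw [pull_apply, pull_apply, B.dmap_act_right hf]
  exact hη (f y) g (dmap f y v)

theorem dmap_orbit (p : P) {f : E → SU2} {y : E}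
    (hf : MDifferentiableAt 𝓘(ℝ, E) (𝓡 3) f y) (v : E) :
    dmap (fun y => B.act p (f y)) y v = B.dorbit p (f y) (dmap f y v) := by
  have := mfderiv_comp y (I := 𝓘(ℝ, E)) (I' := 𝓡 3) (I'' := 𝓡 6) (g := B.act p)
    (f := f) ((B.contMDiff_orbit p).mdifferentiableAt (by simp)) hf
  exact congrArg (fun T => T v) this

theorem pull_orbit (η : DiffForm 6 P ℍ[ℝ] 1) (p : P) {f : E → SU2} {y : E}
    (hf : MDifferentiableAt 𝓘(ℝ, E) (𝓡 3) f y) (v : E) :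
    pull η (fun y => B.act p (f y)) y v = η (B.act p (f y)) ![B.dorbit p (f y) (dmap f y v)] := by
  rw [pull_apply, B.dmap_orbit p hf]

variable [IsManifold (𝓡 6) ∞ P]

/-- The Lie derivative along the fibres of an equivariant form. -/
theorem extD_dorbit {η : DiffForm 6 P ℍ[ℝ] 1} (hs : IsSmoothForm η) (he : B.IsEquivariant η)
    (k : ℝ) (hv : ∀ p g Z, η (B.act p g) ![B.dorbit p g Z] = k • maurerCartan g Z)
    (p : P) (Z : EuclideanSpace ℝ (Fin 3)) (X : EuclideanSpace ℝ (Fin 6)) :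
    extD η p ![B.dorbit p 1 Z, X] = η p ![X] * maurerCartan 1 Z - maurerCartan 1 Z * η p ![X] := by
  set c := (extChartAt (𝓡 6) p).symm with hc
  set y₀ := extChartAt (𝓡 6) p p with hy₀
  set κ := (extChartAt (𝓡 3) (1 : SU2)).symm with hκ
  set z₀ := extChartAt (𝓡 3) (1 : SU2) 1 with hz₀
  have hcp : c y₀ = p := (extChartAt (𝓡 6) p).left_inv (mem_extChartAt_source p)
  have hκ1 : κ z₀ = 1 := (extChartAt (𝓡 3) (1 : SU2)).left_inv (mem_extChartAt_source _)
  have hcs : ∀ᶠ y in 𝓝 y₀, ContMDiffAt 𝓘(ℝ, EuclideanSpace ℝ (Fin 6)) (𝓡 6) ∞ c y := by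
    filter_upwards [(isOpen_extChartAt_target (I := 𝓡 6) p).mem_nhds (mem_extChartAt_target p)]
      with y hy using contMDiffAt_chart_symm p hy
  have hκs : ∀ᶠ z in 𝓝 z₀, ContMDiffAt 𝓘(ℝ, EuclideanSpace ℝ (Fin 3)) (𝓡 3) ∞ κ z := by
    filter_upwards [(isOpen_extChartAt_target (I := 𝓡 3) (1 : SU2)).mem_nhds
      (mem_extChartAt_target 1)] with z hz using contMDiffAt_chart_symm (1 : SU2) hz
  -- In place of Cartan's formula, the exterior derivative is pulled back along this map, which
  -- moves the point of `P` and the group element independently. Its partial derivatives at the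
  -- centre are the orbit direction of `Z` and the vector `X`.
  let f : EuclideanSpace ℝ (Fin 3) × EuclideanSpace ℝ (Fin 6) → P := fun z => B.act (c z.2) (κ z.1)
  have hf : ∀ z y, ContMDiffAt 𝓘(ℝ, EuclideanSpace ℝ (Fin 3)) (𝓡 3) ∞ κ z →
      ContMDiffAt 𝓘(ℝ, EuclideanSpace ℝ (Fin 6)) (𝓡 6) ∞ c y →
      ContMDiffAt 𝓘(ℝ, EuclideanSpace ℝ (Fin 3) × EuclideanSpace ℝ (Fin 6)) (𝓡 6) ∞ f (z, y) := by
    intro z y hz hy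
    have h1 : ContMDiffAt 𝓘(ℝ, EuclideanSpace ℝ (Fin 3) × EuclideanSpace ℝ (Fin 6)) (𝓡 6) ∞
        (fun w : EuclideanSpace ℝ (Fin 3) × EuclideanSpace ℝ (Fin 6) => c w.2) (z, y) :=
      ContMDiffAt.comp (g := c) (z, y) hy contDiff_snd.contMDiff.contMDiffAt
    have h2 : ContMDiffAt 𝓘(ℝ, EuclideanSpace ℝ (Fin 3) × EuclideanSpace ℝ (Fin 6)) (𝓡 3) ∞
        (fun w : EuclideanSpace ℝ (Fin 3) × EuclideanSpace ℝ (Fin 6) => κ w.1) (z, y) :=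
      ContMDiffAt.comp (g := κ) (z, y) hz contDiff_fst.contMDiff.contMDiffAt
    exact ContMDiffAt.comp (g := fun z : P × SU2 => B.act z.1 z.2) (z, y)
      B.contMDiff_act.contMDiffAt (h1.prodMk h2)
  have hf0 := hf z₀ y₀ hκs.self_of_nhds hcs.self_of_nhds
  have hfp : f (z₀, y₀) = p := by simp only [f, hcp, hκ1, B.act_one]
  have hd0 := hf0.mdifferentiableAt (by simp : (∞ : WithTop ℕ∞) ≠ 0)
  have hcd := hcs.self_of_nhds.mdifferentiableAt (by simp : (∞ : WithTop ℕ∞) ≠ 0)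
  have hκd := hκs.self_of_nhds.mdifferentiableAt (by simp : (∞ : WithTop ℕ∞) ≠ 0)
  have l1 : ∀ (y : EuclideanSpace ℝ (Fin 6)) (z w : EuclideanSpace ℝ (Fin 3)),
      fderiv ℝ (fun z => (z, y)) z w = (w, (0 : EuclideanSpace ℝ (Fin 6))) := fun y z w => by
    rw [(hasFDerivAt_prodMk_left (𝕜 := ℝ) z y).fderiv]; rfl
  have l2 : ∀ (y v : EuclideanSpace ℝ (Fin 6)) (z : EuclideanSpace ℝ (Fin 3)),
      fderiv ℝ (fun y => (z, y)) y v = ((0 : EuclideanSpace ℝ (Fin 3)), v) := fun y v z => by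
    rw [(hasFDerivAt_prodMk_right (𝕜 := ℝ) z y).fderiv]; rfl
  have d1 : ∀ (y : EuclideanSpace ℝ (Fin 6)) (z : EuclideanSpace ℝ (Fin 3)),
      DifferentiableAt ℝ (fun z => (z, y)) z := fun y z =>
    (hasFDerivAt_prodMk_left z y).differentiableAt
  have d2 : ∀ (y : EuclideanSpace ℝ (Fin 6)) (z : EuclideanSpace ℝ (Fin 3)),
      DifferentiableAt ℝ (fun y => (z, y)) y := fun y z =>
    (hasFDerivAt_prodMk_right z y).differentiableAt
  have e1 : dmap f (z₀, y₀) (Z, 0) = B.dorbit p 1 Z := by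
    have h := dmap_comp (f := f) (g := fun z => (z, y₀)) (y := z₀) hd0 (d1 _ _) Z
    rw [l1] at h
    rw [← h]
    change dmap (fun z => B.act (c y₀) (κ z)) z₀ Z = _
    rw [B.dmap_orbit _ hκd, hκ1, hcp, dmap_chart_symm_self]
  have e2 : dmap f (z₀, y₀) (0, X) = X := by
    have h := dmap_comp (f := f) (g := fun y => (z₀, y)) (y := y₀) hd0 (d2 _ _) X
    rw [l2] at h
    rw [← h]
    have : (fun y => f (z₀, y)) = c := by funext y; simp only [f, hκ1, B.act_one]
    rw [this, dmap_chart_symm_self]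
  have key := extD_apply_dmap hs hf0 (Z, 0) (0, X)
  -- Tangent spaces at propositionally equal points are different types in the statement;
  -- eliminating the equation for a variable point avoids a cast.
  have tr : ∀ q, q = p → ∀ a b : EuclideanSpace ℝ (Fin 6), extD η q ![a, b] = extD η p ![a, b] := by
    rintro q rfl a b; rfl
  rw [e1, e2, tr _ hfp] at key
  rw [key]
  have hG := (contDiffAt_pull hs hf0).differentiableAt (by simp : (∞ : WithTop ℕ∞) ≠ 0)
  have hGa : ∀ a b, fderiv ℝ (pull η f) (z₀, y₀) a b =
      fderiv ℝ (fun q => pull η f q b) (z₀, y₀) a := by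
    intro a b
    rw [fderiv_clm_apply hG (differentiableAt_const b)]
    simp
  have hGb : ∀ b, DifferentiableAt ℝ (fun q => pull η f q b) (z₀, y₀) := fun b =>
    hG.clm_apply (differentiableAt_const b)
  -- On orbit directions `η` takes the value `k • maurerCartan`, which does not depend on `y`.
  have t1 : fderiv ℝ (fun q => pull η f q (Z, 0)) (z₀, y₀) (0, X) = 0 := by
    have h := fderiv_comp y₀ (g := fun q => pull η f q (Z, 0)) (f := fun y => (z₀, y)) (hGb _)
      (d2 _ _)
    have h' := congrArg (fun T => T X) h
    rw [ContinuousLinearMap.comp_apply, l2] at h'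
    rw [← h']
    have hc : ((fun q => pull η f q (Z, 0)) ∘ fun y => (z₀, y)) =ᶠ[𝓝 y₀]
        fun _ => k • maurerCartan (κ z₀) (dmap κ z₀ Z) := by
      filter_upwards [hcs] with y hy
      have hfy := (hf z₀ y hκs.self_of_nhds hy).mdifferentiableAt
        (by simp : (∞ : WithTop ℕ∞) ≠ 0)
      have h2 := pull_comp η (f := f) (g := fun z => (z, y)) (y := z₀) hfy (d1 _ _)
      have h3 := congrArg (fun T => T Z) h2
      rw [ContinuousLinearMap.comp_apply, l1] at h3
      rw [Function.comp_apply, ← h3]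
      change pull η (fun z => B.act (c y) (κ z)) z₀ Z = _
      rw [B.pull_orbit η _ hκd]
      exact hv _ _ _
    rw [hc.fderiv_eq]
    simp
  -- By equivariance the value on `X` is conjugated by `κ z`. Its derivative at the identity is a
  -- commutator, because `star` negates tangent vectors there.
  have t2 : fderiv ℝ (fun q => pull η f q (0, X)) (z₀, y₀) (Z, 0) =
      η p ![X] * maurerCartan 1 Z - maurerCartan 1 Z * η p ![X] := by
    have h := fderiv_comp z₀ (g := fun q => pull η f q (0, X)) (f := fun z => (z, y₀)) (hGb _)
      (d1 _ _)
    have h' := congrArg (fun T => T Z) h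
    rw [ContinuousLinearMap.comp_apply, l1] at h'
    rw [← h']
    set a := η p ![X] with ha
    have hc : ((fun q => pull η f q (0, X)) ∘ fun z => (z, y₀)) =ᶠ[𝓝 z₀]
        fun z => star (κ z : ℍ[ℝ]) * a * (κ z : ℍ[ℝ]) := by
      filter_upwards [hκs] with z hz
      have hfy := (hf z y₀ hz hcs.self_of_nhds).mdifferentiableAt
        (by simp : (∞ : WithTop ℕ∞) ≠ 0)
      have h2 := pull_comp η (f := f) (g := fun y => (z, y)) (y := y₀) hfy (d2 _ _)
      have h3 := congrArg (fun T => T X) h2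
      rw [ContinuousLinearMap.comp_apply, l2] at h3
      rw [Function.comp_apply, ← h3]
      change pull η (fun y => B.act (c y) (κ z)) y₀ X = _
      rw [B.pull_act_right he hcd, coe_inv_SU2, pull_apply, dmap_chart_symm_self, ha]
      have tr : ∀ q, q = p → η q ![X] = η p ![X] := by rintro q rfl; rfl
      rw [tr _ hcp]
    rw [hc.fderiv_eq]
    have hu : HasFDerivAt (fun z => (κ z : ℍ[ℝ])) (dcoe 1) z₀ := by
      have h1 := contMDiff_coe_SU2.contMDiffAt.mdifferentiableAt (x := κ z₀)
        (by simp : (∞ : WithTop ℕ∞) ≠ 0)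
      have h2 := mfderiv_comp z₀ h1 hκd
      have h3 : DifferentiableAt ℝ (fun z => (κ z : ℍ[ℝ])) z₀ :=
        mdifferentiableAt_iff_differentiableAt.1 (h1.comp z₀ hκd)
      convert h3.hasFDerivAt using 1
      rw [mfderiv_eq_fderiv] at h2
      refine ContinuousLinearMap.ext fun w => ?_
      have h4 := congrArg (fun T => T w) h2
      refine Eq.trans ?_ h4.symm
      change _ = dcoe (κ z₀) (dmap κ z₀ w)
      rw [dmap_chart_symm_self, hκ1]
    have hstar : HasFDerivAt (fun z => star (κ z : ℍ[ℝ]))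
        (starCLM.comp (dcoe 1)) z₀ :=
      starCLM.hasFDerivAt.comp z₀ hu
    have hprod := (hstar.mul_const' a).mul' hu
    refine (congrArg (fun T => T Z) hprod.fderiv).trans ?_
    have hre := re_maurerCartan 1 Z
    rw [maurerCartan_one_apply] at hre ⊢
    have hst : star (dcoe 1 Z) = -dcoe 1 Z := by
      ext <;> simp [hre]
    simp [hκ1, hst]
    abel
  rw [hGa, hGa, t1, t2, sub_zero]

end PrincipalSU2Bundle

/-! ### Local sections -/

namespace PrincipalSU2Bundle

variable {M P : Type*} [TopologicalSpace M] [ChartedSpace (EuclideanSpace ℝ (Fin 3)) M]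
  [TopologicalSpace P] [ChartedSpace (EuclideanSpace ℝ (Fin 6)) P]

/-- A local section of the bundle in a chart of the base, with the group coordinate of the
trivialisation that it defines. -/
structure LocalSection (B : PrincipalSU2Bundle M P) where
  /-- the centre of the chart -/
  center : M
  /-- the domain of the section -/
  dom : Set (EuclideanSpace ℝ (Fin 3))
  /-- the section -/
  sec : EuclideanSpace ℝ (Fin 3) → P
  /-- the group coordinate -/
  grp : P → SU2
  isOpen_dom : IsOpen dom
  dom_subset : dom ⊆ (extChartAt (𝓡 3) center).target
  smooth_sec : ∀ y ∈ dom, ContMDiffAt 𝓘(ℝ, EuclideanSpace ℝ (Fin 3)) (𝓡 6) ∞ sec y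
  proj_sec : ∀ y ∈ dom, B.proj (sec y) = (extChartAt (𝓡 3) center).symm y
  smooth_grp : ∀ p, B.proj p ∈ (extChartAt (𝓡 3) center).source →
    extChartAt (𝓡 3) center (B.proj p) ∈ dom → ContMDiffAt (𝓡 6) (𝓡 3) ∞ grp p
  act_sec_grp : ∀ p, B.proj p ∈ (extChartAt (𝓡 3) center).source →
    extChartAt (𝓡 3) center (B.proj p) ∈ dom →
    B.act (sec (extChartAt (𝓡 3) center (B.proj p))) (grp p) = p
  grp_act : ∀ y ∈ dom, ∀ g, grp (B.act (sec y) g) = g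

namespace LocalSection

variable {B : PrincipalSU2Bundle M P} (S : LocalSection B)

/-- The part of the base over which the section is defined. -/
def base : Set M := (extChartAt (𝓡 3) S.center).source ∩ extChartAt (𝓡 3) S.center ⁻¹' S.dom

/-- The chart of the base. -/
abbrev chart : PartialEquiv M (EuclideanSpace ℝ (Fin 3)) := extChartAt (𝓡 3) S.center

/-- The base coordinates of a point of the bundle. -/
def coord (p : P) : EuclideanSpace ℝ (Fin 3) := S.chart (B.proj p)

theorem isOpen_base : IsOpen S.base :=
  (continuousOn_extChartAt (I := 𝓡 3) S.center).isOpen_inter_preimage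
    (isOpen_extChartAt_source (I := 𝓡 3) S.center) S.isOpen_dom

theorem chart_symm_mem_base {y : EuclideanSpace ℝ (Fin 3)} (hy : y ∈ S.dom) :
    S.chart.symm y ∈ S.base := by
  refine ⟨S.chart.map_target (S.dom_subset hy), ?_⟩
  rw [Set.mem_preimage, S.chart.right_inv (S.dom_subset hy)]
  exact hy

theorem proj_sec_mem_base {y : EuclideanSpace ℝ (Fin 3)} (hy : y ∈ S.dom) :
    B.proj (S.sec y) ∈ S.base := by
  rw [S.proj_sec y hy]; exact S.chart_symm_mem_base hy

theorem coord_mem {p : P} (hp : B.proj p ∈ S.base) : S.coord p ∈ S.dom := hp.2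

theorem act_sec_coord {p : P} (hp : B.proj p ∈ S.base) :
    B.act (S.sec (S.coord p)) (S.grp p) = p :=
  S.act_sec_grp p hp.1 hp.2

theorem coord_sec {y : EuclideanSpace ℝ (Fin 3)} (hy : y ∈ S.dom) : S.coord (S.sec y) = y := by
  rw [coord, S.proj_sec y hy, S.chart.right_inv (S.dom_subset hy)]

theorem coord_act (p : P) (g : SU2) : S.coord (B.act p g) = S.coord p := by
  rw [coord, B.proj_act]; rfl

theorem grp_sec {y : EuclideanSpace ℝ (Fin 3)} (hy : y ∈ S.dom) : S.grp (S.sec y) = 1 := by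
  have := S.grp_act y hy 1
  rwa [B.act_one] at this

theorem chart_symm_coord {p : P} (hp : B.proj p ∈ S.base) :
    S.chart.symm (S.coord p) = B.proj p :=
  S.chart.left_inv hp.1

variable [IsManifold (𝓡 3) ∞ M]

theorem contMDiffAt_coord {p : P} (hp : B.proj p ∈ S.base) :
    ContMDiffAt (𝓡 6) 𝓘(ℝ, EuclideanSpace ℝ (Fin 3)) ∞ S.coord p :=
  ContMDiffAt.comp p (contMDiffAt_chart S.center hp.1) B.contMDiff_proj.contMDiffAt

/-- The differential of the base coordinates. -/
abbrev dcoord (p : P) : EuclideanSpace ℝ (Fin 6) →L[ℝ] EuclideanSpace ℝ (Fin 3) :=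
  mfderiv (𝓡 6) 𝓘(ℝ, EuclideanSpace ℝ (Fin 3)) S.coord p

theorem dproj_eq {p : P} (hp : B.proj p ∈ S.base) (X : EuclideanSpace ℝ (Fin 6)) :
    B.dproj p X = dmap S.chart.symm (S.coord p) (S.dcoord p X) := by
  have h1 : B.proj =ᶠ[𝓝 p] S.chart.symm ∘ S.coord := by
    have ho : IsOpen (B.proj ⁻¹' S.base) := S.isOpen_base.preimage B.contMDiff_proj.continuous
    filter_upwards [ho.mem_nhds hp] with q hq
    exact (S.chart_symm_coord hq).symm
  have h2 := mfderiv_comp p (I := 𝓡 6) (I' := 𝓘(ℝ, EuclideanSpace ℝ (Fin 3))) (I'' := 𝓡 3)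
    (g := S.chart.symm) (f := S.coord)
    ((contMDiffAt_chart_symm S.center (S.dom_subset hp.2)).mdifferentiableAt (by simp))
    ((S.contMDiffAt_coord hp).mdifferentiableAt (by simp))
  rw [← h1.mfderiv_eq] at h2
  exact congrArg (fun T => T X) h2

theorem dcoord_eq_zero {p : P} (hp : B.proj p ∈ S.base) {X : EuclideanSpace ℝ (Fin 6)}
    (hX : B.dproj p X = 0) : S.dcoord p X = 0 := by
  have h := mfderiv_comp p (I := 𝓡 6) (I' := 𝓡 3) (I'' := 𝓘(ℝ, EuclideanSpace ℝ (Fin 3)))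
    (g := S.chart) (f := B.proj)
    ((contMDiffAt_chart S.center hp.1).mdifferentiableAt (by simp))
    (B.contMDiff_proj.mdifferentiableAt (by simp))
  have h1 := congrArg (fun T => T X) h
  refine h1.trans ?_
  change mfderiv (𝓡 3) 𝓘(ℝ, EuclideanSpace ℝ (Fin 3)) S.chart (B.proj p) (B.dproj p X) = 0
  rw [hX]
  exact map_zero _

theorem dcoord_dsec {y : EuclideanSpace ℝ (Fin 3)} (hy : y ∈ S.dom)
    (u : EuclideanSpace ℝ (Fin 3)) : S.dcoord (S.sec y) (dmap S.sec y u) = u := by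
  have h := mfderiv_comp y (I := 𝓘(ℝ, EuclideanSpace ℝ (Fin 3))) (I' := 𝓡 6)
    (I'' := 𝓘(ℝ, EuclideanSpace ℝ (Fin 3))) (g := S.coord) (f := S.sec)
    ((S.contMDiffAt_coord (S.proj_sec_mem_base hy)).mdifferentiableAt (by simp))
    ((S.smooth_sec y hy).mdifferentiableAt (by simp))
  have h1 : S.coord ∘ S.sec =ᶠ[𝓝 y] id := by
    filter_upwards [S.isOpen_dom.mem_nhds hy] with z hz using S.coord_sec hz
  rw [h1.mfderiv_eq, mfderiv_id] at h
  exact (congrArg (fun T => T u) h).symm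

theorem dproj_dsec {y : EuclideanSpace ℝ (Fin 3)} (hy : y ∈ S.dom)
    (u : EuclideanSpace ℝ (Fin 3)) :
    B.dproj (S.sec y) (dmap S.sec y u) = dmap S.chart.symm y u := by
  rw [S.dproj_eq (S.proj_sec_mem_base hy), S.dcoord_dsec hy, S.coord_sec hy]

/-- Differentiate the identity `q = S(coord q) · grp q`. For `X` in the kernel of the projection the
section factor is stationary, and only motion along the orbit remains. -/
theorem vertical_eq_dorbit {y : EuclideanSpace ℝ (Fin 3)} (hy : y ∈ S.dom)
    {X : EuclideanSpace ℝ (Fin 6)} (hX : B.dproj (S.sec y) X = 0) :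
    ∃ Z, X = B.dorbit (S.sec y) 1 Z := by
  set p := S.sec y with hp
  have hpb : B.proj p ∈ S.base := S.proj_sec_mem_base hy
  have hcp : S.coord p = y := S.coord_sec hy
  have hgp : S.grp p = 1 := S.grp_sec hy
  have hg := (S.smooth_grp p hpb.1 hpb.2).mdifferentiableAt (by simp : (∞ : WithTop ℕ∞) ≠ 0)
  have hc := (S.contMDiffAt_coord hpb).mdifferentiableAt (by simp : (∞ : WithTop ℕ∞) ≠ 0)
  have hs : MDifferentiableAt 𝓘(ℝ, EuclideanSpace ℝ (Fin 3)) (𝓡 6) S.sec (S.coord p) := by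
    rw [hcp]; exact (S.smooth_sec y hy).mdifferentiableAt (by simp)
  have hsc := hs.comp p hc
  let Θ : P → P × SU2 := fun q => (S.sec (S.coord q), S.grp q)
  have hΘ : HasMFDerivAt (𝓡 6) ((𝓡 6).prod (𝓡 3)) Θ p _ :=
    hsc.hasMFDerivAt.prodMk hg.hasMFDerivAt
  have hA : MDifferentiableAt ((𝓡 6).prod (𝓡 3)) (𝓡 6) (fun z : P × SU2 => B.act z.1 z.2) (Θ p) :=
    B.contMDiff_act.mdifferentiableAt (by simp)
  have hid : (fun z : P × SU2 => B.act z.1 z.2) ∘ Θ =ᶠ[𝓝 p] id := by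
    have ho : IsOpen (B.proj ⁻¹' S.base) := S.isOpen_base.preimage B.contMDiff_proj.continuous
    filter_upwards [ho.mem_nhds hpb] with q hq using S.act_sec_coord hq
  have h1 := (hA.hasMFDerivAt.comp p hΘ).mfderiv
  rw [hid.mfderiv_eq, mfderiv_id] at h1
  refine ⟨mfderiv (𝓡 6) (𝓡 3) S.grp p X, ?_⟩
  have h2 := congrArg (fun T => T X) h1
  have h3 : mfderiv (𝓡 6) (𝓡 6) (S.sec ∘ S.coord) p X = 0 := by
    rw [mfderiv_comp p hs hc]
    change dmap S.sec (S.coord p) (S.dcoord p X) = 0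
    rw [S.dcoord_eq_zero hpb hX, map_zero]
  have h4 : X = mfderiv ((𝓡 6).prod (𝓡 3)) (𝓡 6) (fun z : P × SU2 => B.act z.1 z.2) (Θ p)
      (mfderiv (𝓡 6) (𝓡 6) (S.sec ∘ S.coord) p X, mfderiv (𝓡 6) (𝓡 3) S.grp p X) := h2
  rw [h3] at h4
  have h5 : Θ p = (p, 1) := by
    simp only [Θ, hcp, hgp, ← hp]
  have key : ∀ w : P × SU2, w = (p, 1) → ∀ Z : EuclideanSpace ℝ (Fin 3),
      (mfderiv ((𝓡 6).prod (𝓡 3)) (𝓡 6) (fun z : P × SU2 => B.act z.1 z.2) w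
        ((0 : EuclideanSpace ℝ (Fin 6)), Z) : EuclideanSpace ℝ (Fin 6)) = B.dorbit p 1 Z := by
    rintro w rfl Z
    have hi : HasMFDerivAt (𝓡 3) ((𝓡 6).prod (𝓡 3)) (fun g : SU2 => (p, g)) 1 _ :=
      (hasMFDerivAt_const (I := 𝓡 3) (I' := 𝓡 6) p (1 : SU2)).prodMk (hasMFDerivAt_id (I := 𝓡 3) (1 : SU2))
    have hA' : MDifferentiableAt ((𝓡 6).prod (𝓡 3)) (𝓡 6) (fun z : P × SU2 => B.act z.1 z.2)
        (p, 1) := B.contMDiff_act.mdifferentiableAt (by simp)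
    have h6 := (hA'.hasMFDerivAt.comp 1 hi).mfderiv
    exact (congrArg (fun T => T Z) h6).symm
  exact h4.trans (key _ h5 _)

end LocalSection

variable [IsManifold (𝓡 3) ∞ M]

theorem exists_localSection (B : PrincipalSU2Bundle M P) (p₀ : P) :
    ∃ S : LocalSection B, S.center = B.proj p₀ ∧ B.proj p₀ ∈ S.base ∧ S.sec (S.coord p₀) = p₀ := by
  obtain ⟨U, φ, hx, hU, hsrc, htgt, hφ, hφs, h⟩ := B.locally_trivial (B.proj p₀)
  set x₀ := B.proj p₀ with hx₀
  have hp₀ : p₀ ∈ φ.source := by rw [hsrc]; exact hx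
  set g₀ := (φ p₀).2 with hg₀
  have hproj : ∀ x ∈ U, ∀ g, B.proj (φ.symm (x, g)) = x := by
    intro x hxU g
    have hm : (x, g) ∈ φ.target := by rw [htgt]; exact ⟨hxU, trivial⟩
    rw [← (h _ (φ.map_target hm)).1, φ.right_inv hm]
  have hact : ∀ x ∈ U, ∀ g k, B.act (φ.symm (x, g)) k = φ.symm (x, g * k) := by
    intro x hxU g k
    have hm : (x, g) ∈ φ.target := by rw [htgt]; exact ⟨hxU, trivial⟩
    have hs := φ.map_target hm
    have h1 := (h _ hs).2 k
    rw [φ.right_inv hm] at h1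
    have h2 : B.act (φ.symm (x, g)) k ∈ φ.source := by
      rw [hsrc, Set.mem_preimage, B.proj_act, hproj x hxU]; exact hxU
    rw [← h1, φ.left_inv h2]
  let χ := extChartAt (𝓡 3) x₀
  have hmemU : ∀ p, B.proj p ∈ χ.source → χ (B.proj p) ∈ χ.target ∩ χ.symm ⁻¹' U →
      B.proj p ∈ U := by
    intro p h1 h2
    have := h2.2
    rwa [Set.mem_preimage, χ.left_inv h1] at this
  -- The constant group coordinate `g₀` makes the section pass through `p₀`; left division by `g₀`
  -- normalises the group coordinate to `1` along the section.
  let S : LocalSection B :=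
    { center := x₀
      dom := χ.target ∩ χ.symm ⁻¹' U
      sec := fun y => φ.symm (χ.symm y, g₀)
      grp := fun p => g₀⁻¹ * (φ p).2
      isOpen_dom := (continuousOn_extChartAt_symm (I := 𝓡 3) x₀).isOpen_inter_preimage
        (isOpen_extChartAt_target (I := 𝓡 3) x₀) hU
      dom_subset := Set.inter_subset_left
      smooth_sec := by
        intro y hy
        have hm : (χ.symm y, g₀) ∈ φ.target := by rw [htgt]; exact ⟨hy.2, trivial⟩
        have h1 := (hφs _ hm).contMDiffAt (φ.open_target.mem_nhds hm)
        exact ContMDiffAt.comp (g := φ.symm) y h1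
          ((contMDiffAt_chart_symm x₀ hy.1).prodMk contMDiffAt_const)
      proj_sec := fun y hy => hproj _ hy.2 _
      smooth_grp := by
        intro p h1 h2
        have hm : p ∈ φ.source := by rw [hsrc]; exact hmemU p h1 h2
        have h3 := (hφ _ hm).contMDiffAt (φ.open_source.mem_nhds hm)
        exact ContMDiffAt.comp (g := fun k => g₀⁻¹ * k) p
          (contMDiff_mul_left_SU2 g₀⁻¹).contMDiffAt
          (ContMDiffAt.comp (g := Prod.snd) p contMDiffAt_snd h3)
      act_sec_grp := by
        intro p h1 h2
        have hU := hmemU p h1 h2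
        have hm : p ∈ φ.source := by rw [hsrc]; exact hU
        rw [hact _ h2.2, mul_inv_cancel_left, show χ.symm (χ (B.proj p)) = B.proj p from
          χ.left_inv h1, ← (h p hm).1]
        exact φ.left_inv hm
      grp_act := by
        intro y hy g
        have hm : (χ.symm y, g₀ * g) ∈ φ.target := by rw [htgt]; exact ⟨hy.2, trivial⟩
        rw [hact _ hy.2, φ.right_inv hm, inv_mul_cancel_left] }
  have hb : x₀ ∈ S.base := by
    refine ⟨mem_extChartAt_source x₀, mem_extChartAt_target x₀, ?_⟩
    rw [Set.mem_preimage, show χ.symm (χ x₀) = x₀ from χ.left_inv (mem_extChartAt_source x₀)]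
    exact hx
  refine ⟨S, rfl, hb, ?_⟩
  change φ.symm (χ.symm (χ x₀), g₀) = p₀
  rw [show χ.symm (χ x₀) = x₀ from χ.left_inv (mem_extChartAt_source x₀), hg₀, hx₀,
    ← (h p₀ hp₀).1]
  exact φ.left_inv hp₀

end PrincipalSU2Bundle

/-! ### Horizontality, equivariance and local formulas -/

section Linearity

variable {n : ℕ} {M : Type*} [TopologicalSpace M] [ChartedSpace (EuclideanSpace ℝ (Fin n)) M]
  {F : Type*} [NormedAddCommGroup F] [NormedSpace ℝ F] {k : ℕ}

theorem IsSmoothForm.add {η ζ : DiffForm n M F k} (hη : IsSmoothForm η) (hζ : IsSmoothForm ζ) :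
    IsSmoothForm (η + ζ) := fun x₀ => (hη x₀).add (hζ x₀)

theorem IsSmoothForm.const_smul {η : DiffForm n M F k} (hη : IsSmoothForm η) (c : ℝ) :
    IsSmoothForm (c • η) := fun x₀ => (hη x₀).const_smul c

theorem IsSmoothForm.differentiableAt {η : DiffForm n M F k} (hη : IsSmoothForm η) (x : M) :
    DifferentiableAt ℝ (chartRep η x) (extChartAt (𝓡 n) x x) :=
  ((hη x).contDiffAt ((isOpen_extChartAt_target (I := 𝓡 n) x).mem_nhds
    (mem_extChartAt_target x))).differentiableAt (by simp)

theorem extD_add {η ζ : DiffForm n M F k} (hη : IsSmoothForm η) (hζ : IsSmoothForm ζ) (x : M) :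
    extD (η + ζ) x = extD η x + extD ζ x :=
  extDeriv_add (hη.differentiableAt x) (hζ.differentiableAt x)

theorem extD_smul (c : ℝ) (η : DiffForm n M F k) (x : M) :
    extD (c • η) x = c • extD η x := by
  change extDeriv (c • chartRep η x) _ = c • extDeriv (chartRep η x) _
  exact extDeriv_smul c _

end Linearity

/-- The real part of a quaternion as a continuous linear form. -/
def reCLM : ℍ[ℝ] →L[ℝ] ℝ :=
  LinearMap.toContinuousLinearMap
    { toFun := fun q => q.re
      map_add' := fun _ _ => rfl
      map_smul' := fun _ _ => rfl }

@[simp] theorem reCLM_apply (q : ℍ[ℝ]) : reCLM q = q.re := rfl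

theorem oneForm_apply_sub {V A : Type*} [NormedAddCommGroup V] [NormedSpace ℝ V]
    [NormedAddCommGroup A] [NormedSpace ℝ A] (e : V [⋀^Fin 1]→L[ℝ] A) (X Y : V) :
    e ![X - Y] = e ![X] - e ![Y] := by
  have h := map_sub (lin1 e.toAlternatingMap) X Y
  simp only [lin1_apply] at h
  exact h

namespace PrincipalSU2Bundle

variable {M P : Type*} [TopologicalSpace M] [ChartedSpace (EuclideanSpace ℝ (Fin 3)) M]
  [TopologicalSpace P] [ChartedSpace (EuclideanSpace ℝ (Fin 6)) P] {B : PrincipalSU2Bundle M P}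

section Pulled

variable {E : Type*} [NormedAddCommGroup E] [NormedSpace ℝ E]

theorem re_pull {η : DiffForm 6 P ℍ[ℝ] 1} (hη : IsLieValued η) (f : E → P) (y u : E) :
    (pull η f y u).re = 0 := by
  rw [pull_apply]; exact hη _ _

theorem fderiv_pull_apply [IsManifold (𝓡 6) ∞ P] {η : DiffForm 6 P ℍ[ℝ] 1} (hη : IsSmoothForm η)
    {f : E → P} {y : E} (hf : ContMDiffAt 𝓘(ℝ, E) (𝓡 6) ∞ f y) (u v : E) :
    fderiv ℝ (fun y => pull η f y v) y u = fderiv ℝ (pull η f) y u v := by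
  have hG := (contDiffAt_pull hη hf).differentiableAt (by simp : (∞ : WithTop ℕ∞) ≠ 0)
  rw [fderiv_clm_apply hG (differentiableAt_const v)]
  simp

theorem re_fderiv_pull [IsManifold (𝓡 6) ∞ P] {η : DiffForm 6 P ℍ[ℝ] 1} (hη : IsSmoothForm η)
    (hr : IsLieValued η) {f : E → P} {y : E} (hf : ContMDiffAt 𝓘(ℝ, E) (𝓡 6) ∞ f y) (u v : E) :
    (fderiv ℝ (pull η f) y u v).re = 0 := by
  rw [← fderiv_pull_apply hη hf]
  have hG := ((contDiffAt_pull hη hf).differentiableAt (by simp : (∞ : WithTop ℕ∞) ≠ 0)).clm_apply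
    (differentiableAt_const v)
  have h := (reCLM.hasFDerivAt.comp y hG.hasFDerivAt).fderiv
  have h0 : (reCLM ∘ fun y => pull η f y v) = fun _ => 0 := by
    funext z; exact re_pull hr f z v
  rw [h0, fderiv_fun_const] at h
  exact (congrArg (fun T => T u) h).symm

end Pulled

theorem chart_symm_self {n : ℕ} {M : Type*} [TopologicalSpace M]
    [ChartedSpace (EuclideanSpace ℝ (Fin n)) M] (x : M) :
    (extChartAt (𝓡 n) x).symm (extChartAt (𝓡 n) x x) = x :=
  (extChartAt (𝓡 n) x).left_inv (mem_extChartAt_source x)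

theorem extD_apply_chart [IsManifold (𝓡 6) ∞ P] {η : DiffForm 6 P ℍ[ℝ] 1} (hη : IsSmoothForm η)
    (p : P) (X Y : EuclideanSpace ℝ (Fin 6)) :
    extD η p ![X, Y] =
      fderiv ℝ (pull η (extChartAt (𝓡 6) p).symm) (extChartAt (𝓡 6) p p) X Y -
        fderiv ℝ (pull η (extChartAt (𝓡 6) p).symm) (extChartAt (𝓡 6) p p) Y X := by
  have h := extD_apply_dmap hη (contMDiffAt_chart_symm p (mem_extChartAt_target p)) X Y
  rw [dmap_chart_symm_self, dmap_chart_symm_self] at h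
  rw [← h]
  have tr : ∀ q, q = p → extD η q ![X, Y] = extD η p ![X, Y] := by
    rintro q rfl; rfl
  rw [tr _ (chart_symm_self p)]

theorem re_extD [IsManifold (𝓡 6) ∞ P] {η : DiffForm 6 P ℍ[ℝ] 1} (hη : IsSmoothForm η)
    (hr : IsLieValued η) (p : P) (X Y : EuclideanSpace ℝ (Fin 6)) :
    (extD η p ![X, Y]).re = 0 := by
  have hc := contMDiffAt_chart_symm p (mem_extChartAt_target (I := 𝓡 6) p)
  rw [extD_apply_chart hη, Quaternion.re_sub, re_fderiv_pull hη hr hc, re_fderiv_pull hη hr hc,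
    sub_zero]

theorem curvature_apply (W : DiffForm 6 P ℍ[ℝ] 1) (p : P) (X Y : EuclideanSpace ℝ (Fin 6)) :
    curvature W p ![X, Y] = extD W p ![X, Y] + (W p ![X] * W p ![Y] - W p ![Y] * W p ![X]) := by
  rw [curvature, AlternatingMap.add_apply, wedge_one_one_apply]
  rfl

theorem covD_apply (W E : DiffForm 6 P ℍ[ℝ] 1) (p : P) (X Y : EuclideanSpace ℝ (Fin 6)) :
    covD W E p ![X, Y] = extD E p ![X, Y] + (W p ![X] * E p ![Y] - W p ![Y] * E p ![X]) +
      (E p ![X] * W p ![Y] - E p ![Y] * W p ![X]) := by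
  rw [covD, AlternatingMap.add_apply, AlternatingMap.add_apply, wedge_one_one_apply,
    wedge_one_one_apply]
  rfl

theorem re_curvature [IsManifold (𝓡 6) ∞ P] {W : DiffForm 6 P ℍ[ℝ] 1} (hW : B.IsConnection W)
    (p : P) (X Y : EuclideanSpace ℝ (Fin 6)) : (curvature W p ![X, Y]).re = 0 := by
  rw [curvature_apply, Quaternion.re_add, re_extD hW.smooth hW.lieValued, Quaternion.re_sub,
    Quaternion.re_mul, Quaternion.re_mul, hW.lieValued p X, hW.lieValued p Y]
  ring

theorem vertical_eq_dorbit [IsManifold (𝓡 3) ∞ M] {p : P} {X : EuclideanSpace ℝ (Fin 6)}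
    (hX : B.dproj p X = 0) : ∃ Z, X = B.dorbit p 1 Z := by
  obtain ⟨S, -, hb, hp⟩ := B.exists_localSection p
  have h := S.vertical_eq_dorbit (S.coord_mem hb) (X := X)
  rw [hp] at h
  exact h hX

theorem IsConnection.apply_dorbit {W : DiffForm 6 P ℍ[ℝ] 1} (hW : B.IsConnection W) (p : P)
    (Z : EuclideanSpace ℝ (Fin 3)) : W p ![B.dorbit p 1 Z] = maurerCartan 1 Z := by
  have h := hW.vertical p 1 Z
  have tr : ∀ q, q = p → ∀ X : EuclideanSpace ℝ (Fin 6), W q ![X] = W p ![X] := by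
    rintro q rfl X; rfl
  exact (tr _ (B.act_one p) _).symm.trans h

theorem horizontal_dorbit {η : DiffForm 6 P ℍ[ℝ] 1} (hη : ∀ p, B.IsHorizontalAt p (η p)) (p : P)
    (g : SU2) (Z : EuclideanSpace ℝ (Fin 3)) : η (B.act p g) ![B.dorbit p g Z] = 0 :=
  hη _ _ (B.dproj_dorbit p g Z)

/-- The case `k = 1` of `extD_dorbit`: the commutator from `dW` cancels the one from `W ∧ W`. -/
theorem curvature_horizontal [IsManifold (𝓡 3) ∞ M] [IsManifold (𝓡 6) ∞ P]
    {W : DiffForm 6 P ℍ[ℝ] 1} (hW : B.IsConnection W) (p : P) (X Y : EuclideanSpace ℝ (Fin 6))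
    (hX : B.dproj p X = 0) : curvature W p ![X, Y] = 0 := by
  obtain ⟨Z, rfl⟩ := vertical_eq_dorbit hX
  rw [curvature_apply, B.extD_dorbit hW.smooth hW.equivariant 1
    (fun p g Z => by rw [one_smul]; exact hW.vertical p g Z), hW.apply_dorbit]
  abel

/-- The case `k = 0` of `extD_dorbit`: the same cancellation, now against the cross terms with `W`.
-/
theorem covD_horizontal [IsManifold (𝓡 3) ∞ M] [IsManifold (𝓡 6) ∞ P]
    {W η : DiffForm 6 P ℍ[ℝ] 1} (hW : B.IsConnection W) (hs : IsSmoothForm η)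
    (he : B.IsEquivariant η) (hη : ∀ p, B.IsHorizontalAt p (η p)) (p : P)
    (X Y : EuclideanSpace ℝ (Fin 6)) (hX : B.dproj p X = 0) : covD W η p ![X, Y] = 0 := by
  have h0 : η p ![X] = 0 := hη p X hX
  obtain ⟨Z, rfl⟩ := vertical_eq_dorbit hX
  rw [covD_apply, B.extD_dorbit hs he 0
    (fun p g Z => by rw [zero_smul]; exact horizontal_dorbit hη p g Z), hW.apply_dorbit, h0]
  simp

theorem extD_act [IsManifold (𝓡 6) ∞ P] {η : DiffForm 6 P ℍ[ℝ] 1} (hs : IsSmoothForm η)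
    (he : B.IsEquivariant η) (p : P) (g : SU2) (X Y : EuclideanSpace ℝ (Fin 6)) :
    extD η (B.act p g) ![mfderiv (𝓡 6) (𝓡 6) (fun q => B.act q g) p X,
      mfderiv (𝓡 6) (𝓡 6) (fun q => B.act q g) p Y] =
      ((g⁻¹ : SU2) : ℍ[ℝ]) * extD η p ![X, Y] * (g : ℍ[ℝ]) := by
  set c := (extChartAt (𝓡 6) p).symm
  set y₀ := extChartAt (𝓡 6) p p
  have hcp : c y₀ = p := chart_symm_self p
  have hc : ContMDiffAt 𝓘(ℝ, EuclideanSpace ℝ (Fin 6)) (𝓡 6) ∞ c y₀ :=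
    contMDiffAt_chart_symm p (mem_extChartAt_target p)
  have hf : ContMDiffAt 𝓘(ℝ, EuclideanSpace ℝ (Fin 6)) (𝓡 6) ∞ (fun y => B.act (c y) g) y₀ :=
    ContMDiffAt.comp y₀ (B.contMDiff_act_right g).contMDiffAt hc
  have hcd := hc.mdifferentiableAt (by simp : (∞ : WithTop ℕ∞) ≠ 0)
  have h := extD_apply_dmap hs hf X Y
  rw [B.dmap_act_right hcd, B.dmap_act_right hcd, dmap_chart_symm_self, dmap_chart_symm_self] at h
  have tr : ∀ q, q = p → extD η (B.act q g) ![mfderiv (𝓡 6) (𝓡 6) (fun q => B.act q g) q X,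
      mfderiv (𝓡 6) (𝓡 6) (fun q => B.act q g) q Y] =
      extD η (B.act p g) ![mfderiv (𝓡 6) (𝓡 6) (fun q => B.act q g) p X,
      mfderiv (𝓡 6) (𝓡 6) (fun q => B.act q g) p Y] := by rintro q rfl; rfl
  rw [← tr _ hcp, h, extD_apply_chart hs]
  have hev : ∀ᶠ y in 𝓝 y₀, MDifferentiableAt 𝓘(ℝ, EuclideanSpace ℝ (Fin 6)) (𝓡 6) c y := by
    filter_upwards [(isOpen_extChartAt_target (I := 𝓡 6) p).mem_nhds (mem_extChartAt_target p)]
      with y hy using (contMDiffAt_chart_symm p hy).mdifferentiableAt (by simp)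
  have key : ∀ u v, fderiv ℝ (pull η fun y => B.act (c y) g) y₀ u v =
      ((g⁻¹ : SU2) : ℍ[ℝ]) * fderiv ℝ (pull η c) y₀ u v * (g : ℍ[ℝ]) := by
    intro u v
    rw [← fderiv_pull_apply hs hf, ← fderiv_pull_apply hs hc]
    have h1 : (fun y => pull η (fun y => B.act (c y) g) y v) =ᶠ[𝓝 y₀]
        fun y => ((g⁻¹ : SU2) : ℍ[ℝ]) * pull η c y v * (g : ℍ[ℝ]) := by
      filter_upwards [hev] with y hy using B.pull_act_right he hy g v
    rw [h1.fderiv_eq]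
    have hG := (((contDiffAt_pull hs hc).differentiableAt
      (by simp : (∞ : WithTop ℕ∞) ≠ 0)).clm_apply (differentiableAt_const v)).hasFDerivAt
    refine (congrArg (fun T => T u)
      ((hG.const_mul ((g⁻¹ : SU2) : ℍ[ℝ])).mul_const' (g : ℍ[ℝ])).fderiv).trans ?_
    simp
  rw [key, key]
  noncomm_ring

theorem curvature_act [IsManifold (𝓡 6) ∞ P] {W : DiffForm 6 P ℍ[ℝ] 1} (hW : B.IsConnection W)
    (p : P) (g : SU2) (X Y : EuclideanSpace ℝ (Fin 6)) :
    curvature W (B.act p g) ![mfderiv (𝓡 6) (𝓡 6) (fun q => B.act q g) p X,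
      mfderiv (𝓡 6) (𝓡 6) (fun q => B.act q g) p Y] =
      ((g⁻¹ : SU2) : ℍ[ℝ]) * curvature W p ![X, Y] * (g : ℍ[ℝ]) := by
  refine (curvature_apply W (B.act p g) _ _).trans ?_
  rw [curvature_apply, extD_act hW.smooth hW.equivariant]
  refine (congrArg₂ (fun a b => ((g⁻¹ : SU2) : ℍ[ℝ]) * extD W p ![X, Y] * (g : ℍ[ℝ]) +
    (a * b - b * a)) (hW.equivariant p g X) (hW.equivariant p g Y)).trans ?_
  have h : ∀ a b : ℍ[ℝ], ((g⁻¹ : SU2) : ℍ[ℝ]) * a * (g : ℍ[ℝ]) * (((g⁻¹ : SU2) : ℍ[ℝ]) * b *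
      (g : ℍ[ℝ])) = ((g⁻¹ : SU2) : ℍ[ℝ]) * (a * b) * (g : ℍ[ℝ]) := by
    intro a b
    calc _ = ((g⁻¹ : SU2) : ℍ[ℝ]) * a * ((g : ℍ[ℝ]) * ((g⁻¹ : SU2) : ℍ[ℝ])) * b * (g : ℍ[ℝ]) := by
          noncomm_ring
      _ = _ := by rw [coe_mul_inv_SU2]; noncomm_ring
  rw [h, h]
  noncomm_ring

/-! Variations of a connection. -/

theorem IsVariation.smul {A : DiffForm 6 P ℍ[ℝ] 1} (hA : B.IsVariation A) (t : ℝ) :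
    B.IsVariation (t • A) where
  smooth := hA.smooth.const_smul t
  lieValued p X := by
    change (t • A p ![X]).re = 0
    rw [Quaternion.re_smul, hA.lieValued p X, smul_zero]
  equivariant p g X := by
    change t • A _ _ = _ * (t • A p ![X]) * _
    rw [hA.equivariant p g X]
    simp
  horizontal p X hX := by
    change t • A p ![X] = 0
    rw [hA.horizontal p X hX, smul_zero]

theorem IsConnection.add_variation {W A : DiffForm 6 P ℍ[ℝ] 1} (hW : B.IsConnection W)
    (hA : B.IsVariation A) : B.IsConnection (W + A) where
  smooth := hW.smooth.add hA.smooth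
  lieValued p X := by
    change (W p ![X] + A p ![X]).re = 0
    rw [Quaternion.re_add, hW.lieValued p X, hA.lieValued p X, add_zero]
  equivariant p g X := by
    change W _ _ + A _ _ = _ * (W p ![X] + A p ![X]) * _
    rw [hW.equivariant p g X, hA.equivariant p g X]
    noncomm_ring
  vertical p g X := by
    exact (congrArg₂ (· + ·) (hW.vertical p g X)
      (horizontal_dorbit hA.horizontal p g X)).trans (add_zero _)

theorem curvature_add_smul {W A : DiffForm 6 P ℍ[ℝ] 1} (hW : IsSmoothForm W) (hA : IsSmoothForm A)
    (t : ℝ) (p : P) (X Y : EuclideanSpace ℝ (Fin 6)) :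
    curvature (W + t • A) p ![X, Y] = curvature W p ![X, Y] + t • covD W A p ![X, Y] +
      t ^ 2 • (A p ![X] * A p ![Y] - A p ![Y] * A p ![X]) := by
  rw [curvature_apply, curvature_apply, covD_apply, extD_add hW (hA.const_smul t), extD_smul]
  change extD W p _ + t • extD A p _ + ((W p _ + t • A p _) * (W p _ + t • A p _) -
    (W p _ + t • A p _) * (W p _ + t • A p _)) = _
  simp only [add_mul, mul_add, smul_mul_assoc, mul_smul_comm, smul_add, smul_sub, smul_smul, sq]
  abel

/-! Local formulas. -/

namespace LocalSection

variable (S : LocalSection B)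

theorem extD_sec [IsManifold (𝓡 6) ∞ P] {η : DiffForm 6 P ℍ[ℝ] 1} (hη : IsSmoothForm η)
    {y : EuclideanSpace ℝ (Fin 3)} (hy : y ∈ S.dom) (u v : EuclideanSpace ℝ (Fin 3)) :
    extD η (S.sec y) ![dmap S.sec y u, dmap S.sec y v] =
      fderiv ℝ (pull η S.sec) y u v - fderiv ℝ (pull η S.sec) y v u :=
  extD_apply_dmap hη (S.smooth_sec y hy) u v

/-- A horizontal equivariant form is determined by its pullback under a section. -/
theorem horizontal_apply [IsManifold (𝓡 3) ∞ M] {η : DiffForm 6 P ℍ[ℝ] 1}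
    (he : B.IsEquivariant η) (hη : ∀ p, B.IsHorizontalAt p (η p)) {p : P}
    (hp : B.proj p ∈ S.base) (X : EuclideanSpace ℝ (Fin 6)) :
    η p ![X] = ((S.grp p)⁻¹ : SU2) * pull η S.sec (S.coord p) (S.dcoord p X) * (S.grp p : ℍ[ℝ]) := by
  set y := S.coord p
  have hy : y ∈ S.dom := S.coord_mem hp
  have hsd := (S.smooth_sec y hy).mdifferentiableAt (by simp : (∞ : WithTop ℕ∞) ≠ 0)
  have hsb := S.proj_sec_mem_base hy
  rw [pull_apply, ← he (S.sec y) (S.grp p) (dmap S.sec y (S.dcoord p X))]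
  -- A horizontal form sees a vector only through its projection, and the translated section vector
  -- projects to the same vector as `X`.
  have key : ∀ q, q = p → ∀ X' : EuclideanSpace ℝ (Fin 6), B.dproj q X' = B.dproj p X →
      η p ![X] = η q ![X'] := by
    rintro q rfl X' h
    have h0 : B.dproj q (X - X') = 0 := by rw [map_sub, h, sub_self]
    have h1 := hη q (X - X') h0
    exact sub_eq_zero.1 ((oneForm_apply_sub (η q) X X').symm.trans h1)
  apply key _ (S.act_sec_coord hp)
  have h3 : B.dproj (B.act (S.sec y) (S.grp p)) (mfderiv (𝓡 6) (𝓡 6)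
      (fun q => B.act q (S.grp p)) (S.sec y) (dmap S.sec y (S.dcoord p X))) =
      B.dproj (S.sec y) (dmap S.sec y (S.dcoord p X)) := by
    have h := mfderiv_comp (S.sec y) (I := 𝓡 6) (I' := 𝓡 6) (I'' := 𝓡 3) (g := B.proj)
      (f := fun q => B.act q (S.grp p)) (B.contMDiff_proj.mdifferentiableAt (by simp))
      ((B.contMDiff_act_right _).mdifferentiableAt (by simp))
    have h4 : B.proj ∘ (fun q => B.act q (S.grp p)) = B.proj := funext fun q => B.proj_act q _
    rw [h4] at h
    exact (congrArg (fun T => T (dmap S.sec y (S.dcoord p X))) h).symm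
  have tr : ∀ q, q = p → ∀ X' : EuclideanSpace ℝ (Fin 6), B.dproj q X' = B.dproj p X' := by
    rintro q rfl X'; rfl
  rw [← tr _ (S.act_sec_coord hp)]
  refine h3.trans ?_
  rw [S.dproj_dsec hy, tr _ (S.act_sec_coord hp), S.dproj_eq hp]

end LocalSection

end PrincipalSU2Bundle

/-! ### The frame of a connection -/

section ConjMatrix

/-- The matrix of `x ↦ g⁻¹ x g` on imaginary quaternions. -/
def conjMatrix (g : ℍ[ℝ]) : Matrix (Fin 3) (Fin 3) ℝ :=
  Matrix.of fun a c => im (star g * ofIm (Pi.single c 1) * g) a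

/-- Conjugation with `star g` in place of the inverse is `normSq g` times a rotation of three-space.
For unit `g` it preserves determinants of component matrices, which is how fibre independence
enters. -/
theorem det_conjMatrix (g : ℍ[ℝ]) : (conjMatrix g).det = (Quaternion.normSq g) ^ 3 := by
  rw [Matrix.det_fin_three, Quaternion.normSq_def']
  simp [conjMatrix]
  ring

theorem im_star_mul_mul (g x : ℍ[ℝ]) (hx : x.re = 0) :
    im (star g * x * g) = (conjMatrix g).mulVec (im x) := by
  ext a
  fin_cases a <;> simp [conjMatrix, Matrix.mulVec, dotProduct, Fin.sum_univ_three, hx,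
    Pi.single_apply] <;> ring

theorem det_conj (g : SU2) (x : Fin 3 → ℍ[ℝ]) (hx : ∀ c, (x c).re = 0) :
    (Matrix.of fun a c => im (((g⁻¹ : SU2) : ℍ[ℝ]) * x c * (g : ℍ[ℝ])) a).det =
      (Matrix.of fun a c => im (x c) a).det := by
  have h : (Matrix.of fun a c => im (((g⁻¹ : SU2) : ℍ[ℝ]) * x c * (g : ℍ[ℝ])) a) =
      conjMatrix g * Matrix.of fun a c => im (x c) a := by
    ext a c
    rw [Matrix.of_apply, coe_inv_SU2, im_star_mul_mul _ _ (hx c), Matrix.mul_apply]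
    rfl
  have hg : Quaternion.normSq (g : ℍ[ℝ]) = 1 := by
    rw [Quaternion.normSq_eq_norm_mul_self, mem_sphere_zero_iff_norm.1 g.2, one_mul]
  rw [h, Matrix.det_mul, det_conjMatrix, hg, one_pow, one_mul]

theorem conj_mul_conj_SU2 (g : SU2) (a b : ℍ[ℝ]) :
    ((g⁻¹ : SU2) : ℍ[ℝ]) * a * (g : ℍ[ℝ]) * (((g⁻¹ : SU2) : ℍ[ℝ]) * b * (g : ℍ[ℝ])) =
      ((g⁻¹ : SU2) : ℍ[ℝ]) * (a * b) * (g : ℍ[ℝ]) := by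
  calc _ = ((g⁻¹ : SU2) : ℍ[ℝ]) * a * ((g : ℍ[ℝ]) * ((g⁻¹ : SU2) : ℍ[ℝ])) * b * (g : ℍ[ℝ]) := by
        noncomm_ring
    _ = _ := by rw [coe_mul_inv_SU2]; noncomm_ring

/-- The components of the Maurer-Cartan form. -/
def maurerCartanMatrix (g : SU2) (Z : Fin 3 → EuclideanSpace ℝ (Fin 3)) :
    Matrix (Fin 3) (Fin 3) ℝ :=
  Matrix.of fun a i => im (maurerCartan g (Z i)) a

theorem det_maurerCartanMatrix_ne_zero (g : SU2)
    (b : Module.Basis (Fin 3) ℝ (EuclideanSpace ℝ (Fin 3))) :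
    (maurerCartanMatrix g b).det ≠ 0 := by
  intro h
  obtain ⟨c, hc, h0⟩ := Matrix.exists_mulVec_eq_zero_iff.2 h
  apply hc
  have h1 : maurerCartan g (∑ i, c i • b i) = 0 := by
    refine eq_of_im_eq (re_maurerCartan g _) rfl ?_
    rw [map_zero, ← h0]
    refine ((congrArg im (map_sum (maurerCartan g) (fun i => c i • b i) Finset.univ)).trans
      (map_sum im _ _)).trans ?_
    ext a
    rw [Finset.sum_apply, Matrix.mulVec, dotProduct]
    refine Finset.sum_congr rfl fun i _ => ?_
    have := map_smul (maurerCartan g) (c i) (b i)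
    refine (congrFun ((congrArg im this).trans (map_smul im _ _)) a).trans ?_
    rw [Pi.smul_apply, smul_eq_mul, mul_comm]
    rfl
  have h2 : ∑ i, c i • b i = 0 := maurerCartan_injective g (h1.trans (map_zero _).symm)
  funext i
  exact Fintype.linearIndependent_iff.1 b.linearIndependent c h2 i

end ConjMatrix

/-! ### Coordinate bases of charts -/

section ChartBasis

variable {n : ℕ} {M : Type*} [TopologicalSpace M] [ChartedSpace (EuclideanSpace ℝ (Fin n)) M]
  [IsManifold (𝓡 n) ∞ M]

theorem dmap_chart_symm_injective (x₀ : M) {y : EuclideanSpace ℝ (Fin n)}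
    (hy : y ∈ (extChartAt (𝓡 n) x₀).target) :
    Function.Injective (dmap (n := n) (extChartAt (𝓡 n) x₀).symm y) := by
  have h := mfderiv_comp y (I := 𝓘(ℝ, EuclideanSpace ℝ (Fin n))) (I' := 𝓡 n)
    (I'' := 𝓘(ℝ, EuclideanSpace ℝ (Fin n))) (g := extChartAt (𝓡 n) x₀)
    (f := (extChartAt (𝓡 n) x₀).symm)
    ((contMDiffAt_chart x₀ ((extChartAt (𝓡 n) x₀).map_target hy)).mdifferentiableAt (by simp))
    ((contMDiffAt_chart_symm x₀ hy).mdifferentiableAt (by simp))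
  have h1 : extChartAt (𝓡 n) x₀ ∘ (extChartAt (𝓡 n) x₀).symm =ᶠ[𝓝 y] id := by
    filter_upwards [(isOpen_extChartAt_target (I := 𝓡 n) x₀).mem_nhds hy] with z hz using
      (extChartAt (𝓡 n) x₀).right_inv hz
  rw [h1.mfderiv_eq, mfderiv_id] at h
  refine Function.LeftInverse.injective (g := mfderiv (𝓡 n) 𝓘(ℝ, EuclideanSpace ℝ (Fin n))
    (extChartAt (𝓡 n) x₀) ((extChartAt (𝓡 n) x₀).symm y)) fun u => ?_
  exact (congrArg (fun T => T u) h).symm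

/-- The coordinate basis of a chart. -/
def chartBasis (x₀ : M) {y : EuclideanSpace ℝ (Fin n)} (hy : y ∈ (extChartAt (𝓡 n) x₀).target) :
    Module.Basis (Fin n) ℝ (EuclideanSpace ℝ (Fin n)) :=
  (EuclideanSpace.basisFun (Fin n) ℝ).toBasis.map
    (LinearEquiv.ofInjectiveEndo (dmap (extChartAt (𝓡 n) x₀).symm y).toLinearMap
      (dmap_chart_symm_injective x₀ hy))

theorem chartBasis_apply (x₀ : M) {y : EuclideanSpace ℝ (Fin n)}
    (hy : y ∈ (extChartAt (𝓡 n) x₀).target) (i : Fin n) :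
    chartBasis x₀ hy i =
      dmap (extChartAt (𝓡 n) x₀).symm y (EuclideanSpace.basisFun (Fin n) ℝ i) := by
  simp [chartBasis]

end ChartBasis

/-! ### Transport of frames along the fibres, and their components in a section -/

namespace PrincipalSU2Bundle

variable {M P : Type*} [TopologicalSpace M] [ChartedSpace (EuclideanSpace ℝ (Fin 3)) M]
  [TopologicalSpace P] [ChartedSpace (EuclideanSpace ℝ (Fin 6)) P] {B : PrincipalSU2Bundle M P}

variable (B) in
/-- The differential of the right action of a group element. -/
abbrev dact (g : SU2) (p : P) : EuclideanSpace ℝ (Fin 6) →L[ℝ] EuclideanSpace ℝ (Fin 6) :=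
  mfderiv (𝓡 6) (𝓡 6) (fun q => B.act q g) p

variable (B) in
theorem dact_bijective (g : SU2) (p : P) : Function.Bijective (B.dact g p) := by
  have hi : Function.Injective (B.dact g p) := by
    have h := mfderiv_comp p (I := 𝓡 6) (I' := 𝓡 6) (I'' := 𝓡 6) (g := fun q => B.act q g⁻¹)
      (f := fun q => B.act q g) ((B.contMDiff_act_right _).mdifferentiableAt (by simp))
      ((B.contMDiff_act_right _).mdifferentiableAt (by simp))
    have h4 : (fun q => B.act q g⁻¹) ∘ (fun q => B.act q g) = id := by
      funext q
      change B.act (B.act q g) g⁻¹ = q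
      rw [← B.act_mul, mul_inv_cancel, B.act_one]
    rw [h4, mfderiv_id] at h
    refine Function.LeftInverse.injective (g := B.dact g⁻¹ (B.act p g)) fun u => ?_
    exact (congrArg (fun T => T u) h).symm
  exact ⟨hi, (LinearMap.injective_iff_surjective (f := (B.dact g p).toLinearMap)).1 hi⟩

theorem dproj_dact (g : SU2) (p : P) (X : EuclideanSpace ℝ (Fin 6)) :
    B.dproj (B.act p g) (B.dact g p X) = B.dproj p X := by
  have h := mfderiv_comp p (I := 𝓡 6) (I' := 𝓡 6) (I'' := 𝓡 3) (g := B.proj)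
    (f := fun q => B.act q g) (B.contMDiff_proj.mdifferentiableAt (by simp))
    ((B.contMDiff_act_right _).mdifferentiableAt (by simp))
  have h4 : B.proj ∘ (fun q => B.act q g) = B.proj := funext fun q => B.proj_act q _
  rw [h4] at h
  exact (congrArg (fun T => T X) h).symm

theorem trCube_conj {V V' : Type*} [AddCommGroup V] [Module ℝ V] [AddCommGroup V'] [Module ℝ V']
    (g : SU2) (e : V [⋀^Fin 1]→ₗ[ℝ] ℍ[ℝ]) (e' : V' [⋀^Fin 1]→ₗ[ℝ] ℍ[ℝ]) (T : V → V')
    (h : ∀ X, e' ![T X] = ((g⁻¹ : SU2) : ℍ[ℝ]) * e ![X] * (g : ℍ[ℝ])) (X : Fin 3 → V) :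
    trCube e' (fun i => T (X i)) = trCube e X := by
  have h3 : ∀ a b c, (e' ![T a] * (e' ![T b] * e' ![T c])).re = (e ![a] * (e ![b] * e ![c])).re := by
    intro a b c
    rw [h, h, h, conj_mul_conj_SU2, conj_mul_conj_SU2, re_conj_SU2]
  simp only [trCube, LinearMap.compAlternatingMap_apply, wedge_one_two_apply, wedge_one_one_apply,
    tr_apply, Quaternion.re_add, Quaternion.re_sub, mul_sub, Matrix.cons_val_zero, Matrix.cons_val_one, h3]

/-- Every condition is natural under right translation: `F` and `e` are both conjugated by `g`, the
trace does not see the conjugation, and translation covers the identity of the base, so the positive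
factor stays the same. -/
theorem IsFrameAt.act [IsManifold (𝓡 6) ∞ P] {vM : DiffForm 3 M ℝ 3} {W : DiffForm 6 P ℍ[ℝ] 1}
    (hW : B.IsConnection W) {p : P} {g : SU2} {e e' : EuclideanSpace ℝ (Fin 6) [⋀^Fin 1]→L[ℝ] ℍ[ℝ]}
    (h : ∀ X, e' ![B.dact g p X] = ((g⁻¹ : SU2) : ℍ[ℝ]) * e ![X] * (g : ℍ[ℝ]))
    (he : B.IsFrameAt vM W p e) : B.IsFrameAt vM W (B.act p g) e' := by
  have hs := (B.dact_bijective g p).2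
  refine ⟨fun X' => ?_, fun X' hX' => ?_, ?_, ?_⟩
  · obtain ⟨X, rfl⟩ := hs X'
    exact (congrArg (fun q : ℍ[ℝ] => q.re) (h X)).trans ((re_conj_SU2 _ _).trans (he.lieValued X))
  · obtain ⟨X, rfl⟩ := hs X'
    refine (h X).trans ?_
    rw [show e ![X] = 0 from he.horizontal X ((dproj_dact g p X).symm.trans hX')]
    simp
  · ext1 Y
    obtain ⟨X, hX⟩ := hs (Y 0)
    obtain ⟨X', hX'⟩ := hs (Y 1)
    have hY : Y = ![B.dact g p X, B.dact g p X'] := by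
      ext1 i; fin_cases i
      · exact hX.symm
      · exact hX'.symm
    rw [hY]
    refine (curvature_act hW p g X X').trans ?_
    rw [he.eq]
    refine Eq.trans ?_ (wedge_one_one_apply (V := EuclideanSpace ℝ (Fin 6)) e'.toAlternatingMap
      e'.toAlternatingMap _).symm
    change _ = e' ![B.dact g p X] * e' ![B.dact g p X'] - e' ![B.dact g p X'] * e' ![B.dact g p X]
    rw [h, h, conj_mul_conj_SU2, conj_mul_conj_SU2]
    refine (congrArg (fun q => ((g⁻¹ : SU2) : ℍ[ℝ]) * q * (g : ℍ[ℝ]))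
      (wedge_one_one_apply (V := EuclideanSpace ℝ (Fin 6)) e.toAlternatingMap
      e.toAlternatingMap _)).trans ?_
    change ((g⁻¹ : SU2) : ℍ[ℝ]) * (e ![X] * e ![X'] - e ![X'] * e ![X]) * (g : ℍ[ℝ]) = _
    noncomm_ring
  · obtain ⟨c, hc, ho⟩ := he.oriented
    refine ⟨c, hc, fun Y => ?_⟩
    choose X hX using fun i => hs (Y i)
    obtain rfl : (fun i => B.dact g p (X i)) = Y := funext hX
    refine (congrArg (-(2 / 3 : ℝ) * ·) (trCube_conj (V := EuclideanSpace ℝ (Fin 6))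
      (V' := EuclideanSpace ℝ (Fin 6)) g e.toAlternatingMap e'.toAlternatingMap (B.dact g p) h
      X)).trans ?_
    refine (ho X).trans ?_
    have tr : ∀ x, x = B.proj p → ∀ Z : Fin 3 → EuclideanSpace ℝ (Fin 3),
        vM x Z = vM (B.proj p) Z := by rintro x rfl Z; rfl
    refine congrArg (c * ·) (Eq.trans ?_ (tr _ (B.proj_act p g) _).symm)
    congr 1
    funext i
    exact (dproj_dact g p (X i)).symm

/-- The transport of a one-form at `p` to `p g`. -/
def conjForm (g : SU2) (p : P) (e : EuclideanSpace ℝ (Fin 6) [⋀^Fin 1]→L[ℝ] ℍ[ℝ]) :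
    EuclideanSpace ℝ (Fin 6) [⋀^Fin 1]→L[ℝ] ℍ[ℝ] :=
  ContinuousAlternatingMap.ofSubsingleton ℝ (EuclideanSpace ℝ (Fin 6)) ℍ[ℝ] (0 : Fin 1)
    (LinearMap.toContinuousLinearMap (LinearMap.mulRight ℝ (g : ℍ[ℝ]) ∘ₗ
      LinearMap.mulLeft ℝ ((g⁻¹ : SU2) : ℍ[ℝ]) ∘ₗ lin1 e.toAlternatingMap ∘ₗ
      (LinearEquiv.ofBijective (B.dact g p).toLinearMap (B.dact_bijective g p)).symm.toLinearMap))

theorem conjForm_dact (g : SU2) (p : P) (e : EuclideanSpace ℝ (Fin 6) [⋀^Fin 1]→L[ℝ] ℍ[ℝ])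
    (X : EuclideanSpace ℝ (Fin 6)) : conjForm (B := B) g p e ![B.dact g p X] =
      ((g⁻¹ : SU2) : ℍ[ℝ]) * e ![X] * (g : ℍ[ℝ]) := by
  have h : (LinearEquiv.ofBijective (B.dact g p).toLinearMap (B.dact_bijective g p)).symm
      (B.dact g p X) = X :=
    (LinearEquiv.ofBijective (B.dact g p).toLinearMap (B.dact_bijective g p)).symm_apply_apply X
  change ((g⁻¹ : SU2) : ℍ[ℝ]) * lin1 e.toAlternatingMap ((LinearEquiv.ofBijective
    (B.dact g p).toLinearMap (B.dact_bijective g p)).symm (B.dact g p X)) * (g : ℍ[ℝ]) = _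
  rw [h, lin1_apply]
  rfl

variable (B) in
/-- The frame at `p` is uniquely determined. -/
def HasFrame (vM : DiffForm 3 M ℝ 3) (W : DiffForm 6 P ℍ[ℝ] 1) (p : P) : Prop :=
  ∀ e, B.IsFrameAt vM W p e ↔ e = B.frame vM W p

/-- The frame is selected by choice, so a unique solution is the selected one. -/
theorem hasFrame_of_iff {vM : DiffForm 3 M ℝ 3} {W : DiffForm 6 P ℍ[ℝ] 1} {p : P}
    {e₀ : EuclideanSpace ℝ (Fin 6) [⋀^Fin 1]→L[ℝ] ℍ[ℝ]}
    (h : ∀ e, B.IsFrameAt vM W p e ↔ e = e₀) : B.HasFrame vM W p := by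
  have h0 : B.IsFrameAt vM W p (B.frame vM W p) := Classical.epsilon_spec ⟨e₀, (h e₀).2 rfl⟩
  intro e
  rw [(h _).1 h0]
  exact h e

theorem HasFrame.isFrameAt {vM : DiffForm 3 M ℝ 3} {W : DiffForm 6 P ℍ[ℝ] 1} {p : P}
    (h : B.HasFrame vM W p) : B.IsFrameAt vM W p (B.frame vM W p) := (h _).2 rfl

/-- Transport by `g⁻¹` inverts transport by `g`, so uniqueness at one point of an orbit spreads to
the whole orbit. It is enough to solve the equation on a section. -/
theorem HasFrame.act [IsManifold (𝓡 6) ∞ P] {vM : DiffForm 3 M ℝ 3} {W : DiffForm 6 P ℍ[ℝ] 1}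
    (hW : B.IsConnection W) {p : P} (h : B.HasFrame vM W p) (g : SU2) :
    B.HasFrame vM W (B.act p g) := by
  have key : ∀ q, q = p → ∀ e : EuclideanSpace ℝ (Fin 6) [⋀^Fin 1]→L[ℝ] ℍ[ℝ],
      B.IsFrameAt vM W q e → e = B.frame vM W p := by
    rintro q rfl e he
    exact (h e).1 he
  have hinv : B.act (B.act p g) g⁻¹ = p := by rw [← B.act_mul, mul_inv_cancel, B.act_one]
  refine hasFrame_of_iff (e₀ := conjForm (B := B) g p (B.frame vM W p)) fun e => ⟨fun he => ?_, ?_⟩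
  · have h1 := he.act hW (g := g⁻¹) (conjForm_dact g⁻¹ (B.act p g) e)
    have h2 := key _ hinv _ h1
    have h3 : ∀ X : EuclideanSpace ℝ (Fin 6), e ![X] = (g⁻¹ : SU2) * (B.frame vM W p ![B.dact g⁻¹ (B.act p g) X]) *
        (g : ℍ[ℝ]) := by
      intro X
      have := congrArg (fun e => e ![B.dact g⁻¹ (B.act p g) X]) h2
      refine Eq.trans ?_ (congrArg (fun q => ((g⁻¹ : SU2) : ℍ[ℝ]) * q * (g : ℍ[ℝ]))
        ((conjForm_dact g⁻¹ (B.act p g) e X).symm.trans this))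
      rw [inv_inv]
      calc e ![X] = (((g⁻¹ : SU2) : ℍ[ℝ]) * (g : ℍ[ℝ])) * e ![X] *
            (((g⁻¹ : SU2) : ℍ[ℝ]) * (g : ℍ[ℝ])) := by rw [coe_inv_mul_SU2]; simp
        _ = _ := by noncomm_ring
    ext1 Y
    obtain ⟨X, hX⟩ := (B.dact_bijective g p).2 (Y 0)
    have hY : Y = ![B.dact g p X] := by ext1 i; fin_cases i; exact hX.symm
    rw [hY]
    refine (h3 _).trans (Eq.trans ?_ (conjForm_dact (B := B) g p _ X).symm)
    have h4 : B.dact g⁻¹ (B.act p g) (B.dact g p X) = X := by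
      have h := mfderiv_comp p (I := 𝓡 6) (I' := 𝓡 6) (I'' := 𝓡 6) (g := fun q => B.act q g⁻¹)
        (f := fun q => B.act q g) ((B.contMDiff_act_right _).mdifferentiableAt (by simp))
        ((B.contMDiff_act_right _).mdifferentiableAt (by simp))
      have h4 : (fun q => B.act q g⁻¹) ∘ (fun q => B.act q g) = id := by
        funext q
        change B.act (B.act q g) g⁻¹ = q
        rw [← B.act_mul, mul_inv_cancel, B.act_one]
      rw [h4, mfderiv_id] at h
      exact (congrArg (fun T => T X) h).symm
    rw [h4]
    rfl
  · rintro rfl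
    exact h.isFrameAt.act hW (conjForm_dact g p _)

theorem HasFrame.frame_act [IsManifold (𝓡 6) ∞ P] {vM : DiffForm 3 M ℝ 3}
    {W : DiffForm 6 P ℍ[ℝ] 1} (hW : B.IsConnection W) {p : P} (h : B.HasFrame vM W p) (g : SU2)
    (X : EuclideanSpace ℝ (Fin 6)) : B.frame vM W (B.act p g) ![B.dact g p X] =
      ((g⁻¹ : SU2) : ℍ[ℝ]) * B.frame vM W p ![X] * (g : ℍ[ℝ]) := by
  rw [← ((h.act hW g) _).1 (h.isFrameAt.act hW (conjForm_dact (B := B) g p _))]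
  exact conjForm_dact g p _ X

theorem isEquivariant_frame [IsManifold (𝓡 6) ∞ P] {vM : DiffForm 3 M ℝ 3}
    {W : DiffForm 6 P ℍ[ℝ] 1} (hW : B.IsConnection W) (h : ∀ p, B.HasFrame vM W p) :
    B.IsEquivariant (B.frame vM W) :=
  fun p g X => (h p).frame_act hW g X

namespace LocalSection

variable (S : LocalSection B)

/-- The tangent vectors of the coordinate lines of a section. -/
def vec (y : EuclideanSpace ℝ (Fin 3)) (i : Fin 3) : EuclideanSpace ℝ (Fin 6) :=
  dmap S.sec y (EuclideanSpace.basisFun (Fin 3) ℝ i)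

/-- The components of the curvature in a section. -/
def curvMatrix (W : DiffForm 6 P ℍ[ℝ] 1) (y : EuclideanSpace ℝ (Fin 3)) :
    Matrix (Fin 3) (Fin 3) ℝ :=
  twoFormMatrix (V := EuclideanSpace ℝ (Fin 6)) (curvature W (S.sec y)) (S.vec y)

/-- The orientation sign of the chart of a section. -/
def orient (vM : DiffForm 3 M ℝ 3) (y : EuclideanSpace ℝ (Fin 3)) : ℝ :=
  SignType.sign (chartRep vM S.center y (EuclideanSpace.basisFun (Fin 3) ℝ))

variable [IsManifold (𝓡 3) ∞ M]

theorem dproj_vec {y : EuclideanSpace ℝ (Fin 3)} (hy : y ∈ S.dom) (i : Fin 3) :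
    chartBasis S.center (S.dom_subset hy) i = B.dproj (S.sec y) (S.vec y i) := by
  rw [chartBasis_apply, vec, S.dproj_dsec hy]

/-- The coordinate vectors of the section project to the coordinate basis of the chart, so
`frame_conditions_iff` applies to them. -/
theorem isFrameAt_iff [IsManifold (𝓡 6) ∞ P] {vM : DiffForm 3 M ℝ 3} (hvM : ∀ x, vM x ≠ 0)
    {W : DiffForm 6 P ℍ[ℝ] 1} (hW : B.IsConnection W) {y : EuclideanSpace ℝ (Fin 3)}
    (hy : y ∈ S.dom) (hm : 0 < (S.curvMatrix W y).det)
    {e : EuclideanSpace ℝ (Fin 6) [⋀^Fin 1]→L[ℝ] ℍ[ℝ]} :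
    B.IsFrameAt vM W (S.sec y) e ↔ ((∀ X, (e ![X]).re = 0) ∧ B.IsHorizontalAt (S.sec y) e) ∧
      formMatrix e.toAlternatingMap (S.vec y) =
        frameMatrix (S.orient vM y) (S.curvMatrix W y) := by
  have key : (∀ X, (e ![X]).re = 0) → B.IsHorizontalAt (S.sec y) e → _ := fun hr hh =>
    frame_conditions_iff (V := EuclideanSpace ℝ (Fin 6)) (B.dproj (S.sec y)).toLinearMap (S.vec y)
      (chartBasis S.center (S.dom_subset hy)) (S.dproj_vec hy) (F := curvature W (S.sec y))
      (fun Y Z hY => curvature_horizontal hW _ _ _ hY) (fun Y Z => re_curvature hW _ _ _) hm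
      (vM (B.proj (S.sec y))).toAlternatingMap
      (fun h => hvM (B.proj (S.sec y)) (ContinuousAlternatingMap.toAlternatingMap_injective h))
      (e := e.toAlternatingMap) hr hh
  have ho : (SignType.sign ((vM (B.proj (S.sec y))).toAlternatingMap
      (chartBasis S.center (S.dom_subset hy))) : ℝ) = S.orient vM y := by
    have tr : ∀ x, x = B.proj (S.sec y) → ∀ Z : Fin 3 → EuclideanSpace ℝ (Fin 3),
        vM x Z = vM (B.proj (S.sec y)) Z := by rintro x rfl Z; rfl
    rw [orient]
    congr 2
    refine (tr _ (S.proj_sec y hy).symm _).symm.trans ?_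
    change vM (S.chart.symm y) _ = vM (S.chart.symm y) _
    exact congrArg (vM (S.chart.symm y)) (funext fun i => chartBasis_apply S.center _ i)
  rw [← ho]
  constructor
  · rintro ⟨h1, h2, h3, h4⟩
    exact ⟨⟨h1, h2⟩, (key h1 h2).1 ⟨h3, h4⟩⟩
  · rintro ⟨⟨h1, h2⟩, h3⟩
    obtain ⟨h4, h5⟩ := (key h1 h2).2 h3
    exact ⟨h1, h2, h4, h5⟩

theorem hasFrame [IsManifold (𝓡 6) ∞ P] {vM : DiffForm 3 M ℝ 3} (hvM : ∀ x, vM x ≠ 0)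
    {W : DiffForm 6 P ℍ[ℝ] 1} (hW : B.IsConnection W) {y : EuclideanSpace ℝ (Fin 3)}
    (hy : y ∈ S.dom) (hm : 0 < (S.curvMatrix W y).det) : B.HasFrame vM W (S.sec y) := by
  set A := frameMatrix (S.orient vM y) (S.curvMatrix W y) with hA
  set β := chartBasis S.center (S.dom_subset hy)
  let L : EuclideanSpace ℝ (Fin 6) →ₗ[ℝ] EuclideanSpace ℝ (Fin 3) := (B.dproj (S.sec y)).toLinearMap
  let e₀ : EuclideanSpace ℝ (Fin 6) [⋀^Fin 1]→L[ℝ] ℍ[ℝ] :=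
    ContinuousAlternatingMap.ofSubsingleton ℝ (EuclideanSpace ℝ (Fin 6)) ℍ[ℝ] (0 : Fin 1)
      (LinearMap.toContinuousLinearMap (ofIm ∘ₗ A.mulVecLin ∘ₗ β.equivFun.toLinearMap ∘ₗ L))
  have he₀ : e₀.toAlternatingMap = horizontalForm L β A := rfl
  refine hasFrame_of_iff (e₀ := e₀) fun e => (S.isFrameAt_iff hvM hW hy hm).trans ⟨?_, ?_⟩
  · rintro ⟨⟨h1, h2⟩, h3⟩
    apply ContinuousAlternatingMap.toAlternatingMap_injective
    have h := eq_horizontalForm L (S.vec y) β (S.dproj_vec hy) (e := e.toAlternatingMap) h1 h2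
    exact h.trans (congrArg (horizontalForm L β) h3)
  · rintro rfl
    have hX : ∀ X, e₀ ![X] = ofIm (A.mulVec (β.repr (L X))) := horizontalForm_apply L β A
    refine ⟨⟨fun X => ?_, fun X hX0 => ?_⟩, ?_⟩
    · rw [hX, re_ofIm]
    · have hX1 : L X = 0 := hX0
      refine (hX X).trans ?_
      rw [hX1]; simp
    · rw [he₀, formMatrix_horizontalForm L (S.vec y) β (S.dproj_vec hy)]

end LocalSection

end PrincipalSU2Bundle

/-! ### The sign of `λ`, and existence and smoothness of the frame -/

namespace PrincipalSU2Bundle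

variable {M P : Type*} [TopologicalSpace M] [ChartedSpace (EuclideanSpace ℝ (Fin 3)) M]
  [TopologicalSpace P] [ChartedSpace (EuclideanSpace ℝ (Fin 6)) P] {B : PrincipalSU2Bundle M P}
  [IsManifold (𝓡 3) ∞ M]

theorem lambdaAt_chernSimons [IsManifold (𝓡 6) ∞ P] {W : DiffForm 6 P ℍ[ℝ] 1}
    (hW : B.IsConnection W) (v : DiffForm 6 P ℝ 6) (p : P)
    (b : Module.Basis (Fin 6) ℝ (EuclideanSpace ℝ (Fin 6)))
    (hb : ∀ a : Fin 3, B.dproj p (b (Fin.castAdd 3 a)) = 0)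
    (hw : (formMatrix (V := EuclideanSpace ℝ (Fin 6)) (W p).toAlternatingMap
      fun a => b (Fin.castAdd 3 a)).det ≠ 0) :
    lambdaAt v (chernSimons W) p = -128 * (formMatrix (V := EuclideanSpace ℝ (Fin 6))
      (W p).toAlternatingMap fun a => b (Fin.castAdd 3 a)).det ^ 2 *
      (twoFormMatrix (V := EuclideanSpace ℝ (Fin 6)) (curvature W p)
        fun i => b (Fin.natAdd 3 i)).det / (v p b) ^ 2 :=
  hitchinLambda_chernSimons b (v p).toAlternatingMap (W p).toAlternatingMap
    (extD W p).toAlternatingMap (hW.lieValued p)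
    (fun a _ => curvature_horizontal hW p _ _ (hb a)) hw

namespace LocalSection

variable (S : LocalSection B)

/-- The differential of the parametrisation `(g, y) ↦ S(y) g`. -/
def adaptedMap (y : EuclideanSpace ℝ (Fin 3)) (g : SU2) :
    EuclideanSpace ℝ (Fin 3) × EuclideanSpace ℝ (Fin 3) →ₗ[ℝ] EuclideanSpace ℝ (Fin 6) :=
  (B.dorbit (S.sec y) g).toLinearMap.coprod
    ((B.dact g (S.sec y)).toLinearMap ∘ₗ (dmap S.sec y).toLinearMap)

theorem adaptedMap_apply (y : EuclideanSpace ℝ (Fin 3)) (g : SU2)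
    (z : EuclideanSpace ℝ (Fin 3) × EuclideanSpace ℝ (Fin 3)) :
    S.adaptedMap y g z = B.dorbit (S.sec y) g z.1 + B.dact g (S.sec y) (dmap S.sec y z.2) := rfl

/-- The projection to the base detects the section component; once that vanishes, `W` detects the
group component, on which it is the injective Maurer-Cartan form. -/
theorem adaptedMap_injective [IsManifold (𝓡 6) ∞ P] {W : DiffForm 6 P ℍ[ℝ] 1}
    (hW : B.IsConnection W) {y : EuclideanSpace ℝ (Fin 3)}
    (hy : y ∈ S.dom) (g : SU2) : Function.Injective (S.adaptedMap y g) := by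
  rw [← LinearMap.ker_eq_bot, LinearMap.ker_eq_bot']
  rintro ⟨Z, u⟩ h
  rw [adaptedMap_apply] at h
  have h1 := congrArg (B.dproj (B.act (S.sec y) g)) h
  rw [map_zero, map_add, B.dproj_dorbit, zero_add] at h1
  have h2 : dmap S.chart.symm y u = 0 :=
    (S.dproj_dsec hy u).symm.trans ((dproj_dact g (S.sec y) _).symm.trans h1)
  have h3 : u = 0 := dmap_chart_symm_injective S.center (S.dom_subset hy) (h2.trans (map_zero _).symm)
  subst h3
  have h4 : B.dorbit (S.sec y) g Z = 0 := by
    simpa using h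
  have h5 := hW.vertical (S.sec y) g Z
  have h6 : maurerCartan g Z = 0 := by
    refine h5.symm.trans ((congrArg (fun X : EuclideanSpace ℝ (Fin 6) =>
      W (B.act (S.sec y) g) ![X]) h4).trans ?_)
    exact (W (B.act (S.sec y) g)).map_coord_zero 0 rfl
  have h7 : Z = 0 := maurerCartan_injective g (h6.trans (map_zero _).symm)
  rw [h7]; rfl

/-- The basis defined by a section and a basis of the tangent space of the group. -/
def adaptedBasis [IsManifold (𝓡 6) ∞ P] {W : DiffForm 6 P ℍ[ℝ] 1}
    (hW : B.IsConnection W) {y : EuclideanSpace ℝ (Fin 3)} (hy : y ∈ S.dom) (g : SU2)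
    (β : Module.Basis (Fin 3) ℝ (EuclideanSpace ℝ (Fin 3))) :
    Module.Basis (Fin 6) ℝ (EuclideanSpace ℝ (Fin 6)) :=
  ((β.prod (EuclideanSpace.basisFun (Fin 3) ℝ).toBasis).reindex
    (finSumFinEquiv (m := 3) (n := 3))).map
    (LinearEquiv.ofBijective (S.adaptedMap y g) ⟨S.adaptedMap_injective hW hy g,
      (LinearMap.injective_iff_surjective_of_finrank_eq_finrank (by simp)).1
        (S.adaptedMap_injective hW hy g)⟩)

theorem adaptedBasis_castAdd [IsManifold (𝓡 6) ∞ P] {W : DiffForm 6 P ℍ[ℝ] 1}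
    (hW : B.IsConnection W) {y : EuclideanSpace ℝ (Fin 3)} (hy : y ∈ S.dom) (g : SU2)
    (β : Module.Basis (Fin 3) ℝ (EuclideanSpace ℝ (Fin 3))) (a : Fin 3) :
    S.adaptedBasis hW hy g β (Fin.castAdd 3 a) = B.dorbit (S.sec y) g (β a) := by
  rw [adaptedBasis, Module.Basis.map_apply, Module.Basis.reindex_apply,
    finSumFinEquiv_symm_apply_castAdd]
  refine (S.adaptedMap_apply y g _).trans ?_
  simp

theorem adaptedBasis_natAdd [IsManifold (𝓡 6) ∞ P] {W : DiffForm 6 P ℍ[ℝ] 1}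
    (hW : B.IsConnection W) {y : EuclideanSpace ℝ (Fin 3)} (hy : y ∈ S.dom) (g : SU2)
    (β : Module.Basis (Fin 3) ℝ (EuclideanSpace ℝ (Fin 3))) (i : Fin 3) :
    S.adaptedBasis hW hy g β (Fin.natAdd 3 i) = B.dact g (S.sec y) (S.vec y i) := by
  rw [adaptedBasis, Module.Basis.map_apply, Module.Basis.reindex_apply,
    finSumFinEquiv_symm_apply_natAdd]
  refine (S.adaptedMap_apply y g _).trans ?_
  simp [vec]

theorem det_twoFormMatrix_act [IsManifold (𝓡 6) ∞ P] {W : DiffForm 6 P ℍ[ℝ] 1}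
    (hW : B.IsConnection W) (p : P) (g : SU2) (X : Fin 3 → EuclideanSpace ℝ (Fin 6)) :
    (twoFormMatrix (V := EuclideanSpace ℝ (Fin 6)) (curvature W (B.act p g))
      fun i => B.dact g p (X i)).det =
      (twoFormMatrix (V := EuclideanSpace ℝ (Fin 6)) (curvature W p) X).det := by
  refine Eq.trans ?_ (det_conj g (fun c => curvature W p ![X (c + 1), X (c + 2)])
    fun c => re_curvature hW p _ _)
  congr 1
  ext a c
  exact congrFun (congrArg im (curvature_act hW p g _ _)) a

/-- On the adapted basis the vertical block of `W` is the Maurer-Cartan matrix, and the curvature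
block is conjugated by `g`. The dependence on `g` and on `y` is thereby separated, apart from the
value of `v`. -/
theorem lambdaAt_act_sec [IsManifold (𝓡 6) ∞ P] {W : DiffForm 6 P ℍ[ℝ] 1}
    (hW : B.IsConnection W) (v : DiffForm 6 P ℝ 6) {y : EuclideanSpace ℝ (Fin 3)} (hy : y ∈ S.dom)
    (g : SU2) (β : Module.Basis (Fin 3) ℝ (EuclideanSpace ℝ (Fin 3))) :
    lambdaAt v (chernSimons W) (B.act (S.sec y) g) = -128 * (maurerCartanMatrix g β).det ^ 2 *
      (S.curvMatrix W y).det / (v (B.act (S.sec y) g) (S.adaptedBasis hW hy g β)) ^ 2 := by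
  have h1 : (formMatrix (V := EuclideanSpace ℝ (Fin 6)) (W (B.act (S.sec y) g)).toAlternatingMap
      fun a => S.adaptedBasis hW hy g β (Fin.castAdd 3 a)) = maurerCartanMatrix g β := by
    ext a i
    exact (congrArg (fun X : EuclideanSpace ℝ (Fin 6) => im (W (B.act (S.sec y) g) ![X]) a)
      (S.adaptedBasis_castAdd hW hy g β i)).trans
        (congrFun (congrArg im (hW.vertical (S.sec y) g (β i))) a)
  have h := lambdaAt_chernSimons hW v (B.act (S.sec y) g) (S.adaptedBasis hW hy g β)
    (fun a => by rw [adaptedBasis_castAdd]; exact B.dproj_dorbit _ _ _)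
    (by rw [h1]; exact det_maurerCartanMatrix_ne_zero g β)
  simp only [h1, adaptedBasis_natAdd] at h
  rw [det_twoFormMatrix_act hW] at h
  exact h

/-- In the formula for `λ` everything except `det m` is a square or the constant `-128`, so `det m ≤
0` would give `λ ≥ 0`. -/
theorem det_curvMatrix_pos [IsManifold (𝓡 6) ∞ P] {v : DiffForm 6 P ℝ 6} {W : DiffForm 6 P ℍ[ℝ] 1}
    (hW : B.IsNegativeDefinite v W) {y : EuclideanSpace ℝ (Fin 3)} (hy : y ∈ S.dom) :
    0 < (S.curvMatrix W y).det := by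
  by_contra! h
  have h1 := hW.2 (B.act (S.sec y) 1)
  rw [S.lambdaAt_act_sec hW.1 v hy 1 (EuclideanSpace.basisFun (Fin 3) ℝ).toBasis] at h1
  refine absurd h1 (not_lt.2 (div_nonneg ?_ (sq_nonneg _)))
  nlinarith [mul_nonneg (sq_nonneg
    (maurerCartanMatrix 1 (EuclideanSpace.basisFun (Fin 3) ℝ).toBasis).det) (neg_nonneg.2 h)]

end LocalSection

theorem hasFrame_of_isNegativeDefinite [IsManifold (𝓡 6) ∞ P] {vM : DiffForm 3 M ℝ 3}
    (hvM : ∀ x, vM x ≠ 0) {v : DiffForm 6 P ℝ 6} {W : DiffForm 6 P ℍ[ℝ] 1}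
    (hW : B.IsNegativeDefinite v W) (p : P) : B.HasFrame vM W p := by
  obtain ⟨S, -, hb, hp⟩ := B.exists_localSection p
  rw [← hp]
  exact S.hasFrame hvM hW.1 (S.coord_mem hb) (S.det_curvMatrix_pos hW (S.coord_mem hb))

namespace LocalSection

variable (S : LocalSection B)

theorem curvature_sec [IsManifold (𝓡 6) ∞ P] {W : DiffForm 6 P ℍ[ℝ] 1} (hW : IsSmoothForm W)
    {y : EuclideanSpace ℝ (Fin 3)} (hy : y ∈ S.dom) (u v : EuclideanSpace ℝ (Fin 3)) :
    curvature W (S.sec y) ![dmap S.sec y u, dmap S.sec y v] =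
      fderiv ℝ (pull W S.sec) y u v - fderiv ℝ (pull W S.sec) y v u +
        (pull W S.sec y u * pull W S.sec y v - pull W S.sec y v * pull W S.sec y u) := by
  rw [curvature_apply, S.extD_sec hW hy, pull_apply, pull_apply]

theorem covD_sec [IsManifold (𝓡 6) ∞ P] (W : DiffForm 6 P ℍ[ℝ] 1) {η : DiffForm 6 P ℍ[ℝ] 1}
    (hη : IsSmoothForm η) {y : EuclideanSpace ℝ (Fin 3)} (hy : y ∈ S.dom)
    (u v : EuclideanSpace ℝ (Fin 3)) :
    covD W η (S.sec y) ![dmap S.sec y u, dmap S.sec y v] =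
      fderiv ℝ (pull η S.sec) y u v - fderiv ℝ (pull η S.sec) y v u +
        (pull W S.sec y u * pull η S.sec y v - pull W S.sec y v * pull η S.sec y u) +
        (pull η S.sec y u * pull W S.sec y v - pull η S.sec y v * pull W S.sec y u) := by
  rw [covD_apply, S.extD_sec hη hy]
  simp only [pull_apply]

/-- The component `im_a` as a continuous linear map. -/
def imCLM (a : Fin 3) : ℍ[ℝ] →L[ℝ] ℝ := LinearMap.toContinuousLinearMap (LinearMap.proj a ∘ₗ im)

theorem contDiffAt_curvMatrix [IsManifold (𝓡 6) ∞ P] {W : DiffForm 6 P ℍ[ℝ] 1}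
    (hW : IsSmoothForm W) {y : EuclideanSpace ℝ (Fin 3)} (hy : y ∈ S.dom) (a c : Fin 3) :
    ContDiffAt ℝ ∞ (fun y => S.curvMatrix W y a c) y := by
  set u := EuclideanSpace.basisFun (Fin 3) ℝ (c + 1)
  set v := EuclideanSpace.basisFun (Fin 3) ℝ (c + 2)
  have h1 : (fun y => S.curvMatrix W y a c) =ᶠ[𝓝 y] fun y => imCLM a
      (fderiv ℝ (pull W S.sec) y u v - fderiv ℝ (pull W S.sec) y v u +
        (pull W S.sec y u * pull W S.sec y v - pull W S.sec y v * pull W S.sec y u)) := by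
    filter_upwards [S.isOpen_dom.mem_nhds hy] with z hz
    rw [← S.curvature_sec hW hz]
    rfl
  refine ContDiffAt.congr_of_eventuallyEq ?_ h1
  have h2 := contDiffAt_pull hW (S.smooth_sec y hy)
  have h3 : ContDiffAt ℝ ∞ (fderiv ℝ (pull W S.sec)) y := h2.fderiv_right (by simp)
  refine (imCLM a).contDiff.contDiffAt.comp y ?_
  fun_prop

theorem contDiffAt_det {m : EuclideanSpace ℝ (Fin 3) → Matrix (Fin 3) (Fin 3) ℝ}
    {y : EuclideanSpace ℝ (Fin 3)} (hm : ∀ a c, ContDiffAt ℝ ∞ (fun y => m y a c) y) :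
    ContDiffAt ℝ ∞ (fun y => (m y).det) y := by
  simp only [Matrix.det_fin_three]
  fun_prop

theorem contDiffAt_adjugate {m : EuclideanSpace ℝ (Fin 3) → Matrix (Fin 3) (Fin 3) ℝ}
    {y : EuclideanSpace ℝ (Fin 3)} (hm : ∀ a c, ContDiffAt ℝ ∞ (fun y => m y a c) y) (a c : Fin 3) :
    ContDiffAt ℝ ∞ (fun y => (m y).adjugate a c) y := by
  simp only [Matrix.adjugate_fin_three]
  fin_cases a <;> fin_cases c <;> simp <;> fun_prop

/-- The quaternion valued linear form with given components. -/
def matrixForm (A : Matrix (Fin 3) (Fin 3) ℝ) : EuclideanSpace ℝ (Fin 3) →L[ℝ] ℍ[ℝ] :=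
  ∑ i : Fin 3, ∑ a : Fin 3, A a i • (EuclideanSpace.proj i : EuclideanSpace ℝ (Fin 3) →L[ℝ] ℝ).smulRight
    (ofIm (Pi.single a 1))

theorem matrixForm_basisFun (A : Matrix (Fin 3) (Fin 3) ℝ) (i : Fin 3) :
    matrixForm A (EuclideanSpace.basisFun (Fin 3) ℝ i) = ofIm fun a => A a i := by
  refine eq_of_im_eq ?_ rfl ?_
  · fin_cases i <;> simp [matrixForm, Fin.sum_univ_three]
  · ext a
    fin_cases i <;> fin_cases a <;> simp [matrixForm, Fin.sum_univ_three]

/-- A continuous function without zeros has locally constant sign. Locally, then, `σ` is a constant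
in the formula for the frame. -/
theorem eventually_orient_eq {vM : DiffForm 3 M ℝ 3} (hvM : IsVolumeForm vM)
    {y : EuclideanSpace ℝ (Fin 3)} (hy : y ∈ S.dom) :
    ∀ᶠ z in 𝓝 y, S.orient vM z = S.orient vM y := by
  set f := fun z => chartRep vM S.center z (EuclideanSpace.basisFun (Fin 3) ℝ)
  have hc : ContinuousAt f y := by
    have h1 := ((hvM.1 S.center).contDiffAt ((isOpen_extChartAt_target (I := 𝓡 3)
      S.center).mem_nhds (S.dom_subset hy))).continuousAt
    exact (ContinuousAlternatingMap.apply ℝ _ ℝ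
      (EuclideanSpace.basisFun (Fin 3) ℝ)).continuous.continuousAt.comp h1
  have h0 : f y ≠ 0 := by
    intro h
    apply hvM.2 (S.chart.symm y)
    apply ContinuousAlternatingMap.toAlternatingMap_injective
    refine (AlternatingMap.eq_smul_basis_det (chartBasis S.center (S.dom_subset hy)) _).trans ?_
    have h2 : vM (S.chart.symm y) (chartBasis S.center (S.dom_subset hy)) = 0 := by
      rw [← h]
      exact congrArg (vM (S.chart.symm y)) (funext fun i => chartBasis_apply S.center _ i)
    refine (congrArg (· • _) h2).trans ?_
    rw [zero_smul]
    rfl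
  rcases lt_or_gt_of_ne h0 with h | h
  · filter_upwards [hc.eventually (gt_mem_nhds h)] with z hz
    change ((SignType.sign (f z) : SignType) : ℝ) = ((SignType.sign (f y) : SignType) : ℝ)
    rw [sign_neg h, sign_neg hz]
  · filter_upwards [hc.eventually (lt_mem_nhds h)] with z hz
    change ((SignType.sign (f z) : SignType) : ℝ) = ((SignType.sign (f y) : SignType) : ℝ)
    rw [sign_pos h, sign_pos hz]

theorem pull_frame [IsManifold (𝓡 6) ∞ P] {vM : DiffForm 3 M ℝ 3} (hvM : ∀ x, vM x ≠ 0)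
    {W : DiffForm 6 P ℍ[ℝ] 1} (hW : B.IsConnection W) {y : EuclideanSpace ℝ (Fin 3)}
    (hy : y ∈ S.dom) (hm : 0 < (S.curvMatrix W y).det) (i : Fin 3) :
    pull (B.frame vM W) S.sec y (EuclideanSpace.basisFun (Fin 3) ℝ i) =
      ofIm fun a => frameMatrix (S.orient vM y) (S.curvMatrix W y) a i := by
  obtain ⟨⟨h1, -⟩, h3⟩ := (S.isFrameAt_iff hvM hW hy hm).1 (S.hasFrame hvM hW hy hm).isFrameAt
  rw [← h3, pull_apply]
  refine eq_of_im_eq (h1 _) rfl ?_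
  rw [im_ofIm]
  rfl

/-- The components of the frame are given by `frameMatrix`: polynomials in the smooth curvature
components, divided by the square root of a positive one. -/
theorem contDiffAt_pull_frame [IsManifold (𝓡 6) ∞ P] {vM : DiffForm 3 M ℝ 3}
    (hvM : IsVolumeForm vM) {v : DiffForm 6 P ℝ 6} {W : DiffForm 6 P ℍ[ℝ] 1}
    (hW : B.IsNegativeDefinite v W) {y : EuclideanSpace ℝ (Fin 3)} (hy : y ∈ S.dom) :
    ContDiffAt ℝ ∞ (pull (B.frame vM W) S.sec) y := by
  set σ := S.orient vM y
  have h1 : pull (B.frame vM W) S.sec =ᶠ[𝓝 y] fun z => matrixForm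
      (frameMatrix σ (S.curvMatrix W z)) := by
    filter_upwards [S.isOpen_dom.mem_nhds hy, S.eventually_orient_eq hvM hy] with z hz ho
    have h2 := S.pull_frame hvM.2 hW.1 hz (S.det_curvMatrix_pos hW hz)
    refine ContinuousLinearMap.coe_injective
      ((EuclideanSpace.basisFun (Fin 3) ℝ).toBasis.ext fun i => ?_)
    rw [OrthonormalBasis.coe_toBasis]
    refine (h2 i).trans ?_
    rw [ho]
    exact (matrixForm_basisFun _ i).symm
  refine ContDiffAt.congr_of_eventuallyEq ?_ h1
  have hm := S.contDiffAt_curvMatrix hW.1.smooth hy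
  have hd := contDiffAt_det hm
  have hadj := contDiffAt_adjugate hm
  have hpos := S.det_curvMatrix_pos hW hy
  have h8 : (S.curvMatrix W y).det / 8 ≠ 0 := by positivity
  have hs : ContDiffAt ℝ ∞ (fun z => √((S.curvMatrix W z).det / 8)) y :=
    (hd.div_const 8).sqrt h8
  have hs0 : 4 * √((S.curvMatrix W y).det / 8) ≠ 0 := by positivity
  refine ContDiffAt.sum fun i _ => ContDiffAt.sum fun a _ => ContDiffAt.fun_smul ?_ contDiffAt_const
  exact (contDiffAt_const.div (contDiffAt_const.mul hs) hs0).mul (hadj i a)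

end LocalSection

/-- Over a section the form is `g⁻¹ (S^*η) g` composed with the differential of the base
coordinates, and the group coordinate `g` is smooth. -/
theorem isSmoothForm_of_sections [IsManifold (𝓡 6) ∞ P] {η : DiffForm 6 P ℍ[ℝ] 1}
    (he : B.IsEquivariant η) (hη : ∀ p, B.IsHorizontalAt p (η p))
    (h : ∀ p, ∃ S : LocalSection B, B.proj p ∈ S.base ∧
      ContDiffAt ℝ ∞ (pull η S.sec) (S.coord p)) : IsSmoothForm η := by
  rw [isSmoothForm_iff_pull]
  intro x₀ y hy
  set f := (extChartAt (𝓡 6) x₀).symm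
  have hf : ContMDiffAt 𝓘(ℝ, EuclideanSpace ℝ (Fin 6)) (𝓡 6) ∞ f y := contMDiffAt_chart_symm x₀ hy
  obtain ⟨S, hb, hs⟩ := h (f y)
  have ho : IsOpen (B.proj ⁻¹' S.base) := S.isOpen_base.preimage B.contMDiff_proj.continuous
  have hb' : ∀ᶠ z in 𝓝 y, B.proj (f z) ∈ S.base := hf.continuousAt (ho.mem_nhds hb)
  have hc : ContDiffAt ℝ ∞ (fun z => S.coord (f z)) y :=
    contMDiffAt_iff_contDiffAt.1 (ContMDiffAt.comp (g := S.coord) y (S.contMDiffAt_coord hb) hf)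
  have hg : ContDiffAt ℝ ∞ (fun z => (S.grp (f z) : ℍ[ℝ])) y :=
    contMDiffAt_iff_contDiffAt.1 (ContMDiffAt.comp (g := fun h : SU2 => (h : ℍ[ℝ])) y
      contMDiff_coe_SU2.contMDiffAt (ContMDiffAt.comp (g := S.grp) y (S.smooth_grp _ hb.1 hb.2) hf))
  have key : pull η f =ᶠ[𝓝 y] fun z => ∑ i : Fin 6,
      (EuclideanSpace.proj i : EuclideanSpace ℝ (Fin 6) →L[ℝ] ℝ).smulRight
        (starCLM (S.grp (f z) : ℍ[ℝ]) * pull η S.sec (S.coord (f z))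
          (fderiv ℝ (fun z => S.coord (f z)) z (EuclideanSpace.basisFun (Fin 6) ℝ i)) *
            (S.grp (f z) : ℍ[ℝ])) := by
    filter_upwards [hb', (isOpen_extChartAt_target (I := 𝓡 6) x₀).mem_nhds hy] with z hz hzt
    refine ContinuousLinearMap.coe_injective
      ((EuclideanSpace.basisFun (Fin 6) ℝ).toBasis.ext fun i => ?_)
    rw [OrthonormalBasis.coe_toBasis]
    have h1 : ∀ u, fderiv ℝ (fun z => S.coord (f z)) z u = S.dcoord (f z) (dmap f z u) := by
      intro u
      have h2 := mfderiv_comp z (I := 𝓘(ℝ, EuclideanSpace ℝ (Fin 6))) (I' := 𝓡 6)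
        (I'' := 𝓘(ℝ, EuclideanSpace ℝ (Fin 3))) (g := S.coord) (f := f)
        ((S.contMDiffAt_coord hz).mdifferentiableAt (by simp))
        ((contMDiffAt_chart_symm x₀ hzt).mdifferentiableAt (by simp))
      rw [mfderiv_eq_fderiv] at h2
      exact congrArg (fun T => T u) h2
    change pull η f z (EuclideanSpace.basisFun (Fin 6) ℝ i) = _
    rw [pull_apply, S.horizontal_apply he hη hz, coe_inv_SU2, ← h1]
    simp [starCLM_apply, PiLp.single_apply]
  refine ContDiffAt.congr_of_eventuallyEq ?_ key
  have h1 : ContDiffAt ℝ ∞ (fun z => pull η S.sec (S.coord (f z))) y :=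
    ContDiffAt.comp (g := pull η S.sec) (f := fun z => S.coord (f z)) y hs hc
  have h2 : ContDiffAt ℝ ∞ (fderiv ℝ fun z => S.coord (f z)) y := hc.fderiv_right (by simp)
  have h3 : ContDiffAt ℝ ∞ (fun z => starCLM (S.grp (f z) : ℍ[ℝ])) y :=
    starCLM.contDiff.contDiffAt.comp y hg
  exact ContDiffAt.sum fun i _ => ContDiffAt.smulRight contDiffAt_const
    ((h3.mul (h1.clm_apply (h2.clm_apply contDiffAt_const))).mul hg)

theorem isSmoothForm_frame [IsManifold (𝓡 6) ∞ P] {vM : DiffForm 3 M ℝ 3}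
    (hvM : IsVolumeForm vM) {v : DiffForm 6 P ℝ 6} {W : DiffForm 6 P ℍ[ℝ] 1}
    (hW : B.IsNegativeDefinite v W) : IsSmoothForm (B.frame vM W) := by
  have hf := hasFrame_of_isNegativeDefinite (v := v) hvM.2 hW
  refine isSmoothForm_of_sections (isEquivariant_frame hW.1 hf)
    (fun p => (hf p).isFrameAt.horizontal) fun p => ?_
  obtain ⟨S, -, hb, -⟩ := B.exists_localSection p
  exact ⟨S, hb, S.contDiffAt_pull_frame hvM hW (S.coord_mem hb)⟩

end PrincipalSU2Bundle

/-! ### Densities -/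

theorem measurableSet_inter_preimage {X Y : Type*} [TopologicalSpace X] [MeasurableSpace X]
    [OpensMeasurableSpace X] [TopologicalSpace Y] [MeasurableSpace Y] [BorelSpace Y] {ψ : X → Y}
    {O : Set X} (hO : IsOpen O) (hψ : ContinuousOn ψ O) {S : Set Y}
    (hS : MeasurableSet S) : MeasurableSet (O ∩ ψ ⁻¹' S) := by
  have h := (continuousOn_iff_continuous_domRestrict.1 hψ).measurable hS
  have h2 : O ∩ ψ ⁻¹' S = Subtype.val '' (O.domRestrict ψ ⁻¹' S) := by
    ext y; simp [and_comm]
  rw [h2]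
  exact hO.measurableSet.subtype_image h

section Density

variable {n : ℕ} {M : Type*} [TopologicalSpace M] [ChartedSpace (EuclideanSpace ℝ (Fin n)) M]

/-- The transformation law of a density. -/
def IsDensity (r : (Fin n → EuclideanSpace ℝ (Fin n)) → ℝ) : Prop :=
  ∀ (T : EuclideanSpace ℝ (Fin n) →L[ℝ] EuclideanSpace ℝ (Fin n)) X,
    r (fun i => T (X i)) = |T.det| * r X

theorem isDensity_of_basis {r : (Fin n → EuclideanSpace ℝ (Fin n)) → ℝ}
    (β : Module.Basis (Fin n) ℝ (EuclideanSpace ℝ (Fin n))) (c : ℝ)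
    (h : ∀ X, r X = c * |β.det X|) : IsDensity r := by
  intro T X
  rw [h, h, show (fun i => T (X i)) = T.toLinearMap ∘ X from rfl, β.det_comp, abs_mul]
  simp only [ContinuousLinearMap.det]
  ring

theorem isDensity_abs (v : EuclideanSpace ℝ (Fin n) [⋀^Fin n]→ₗ[ℝ] ℝ) :
    IsDensity fun X => |v X| := by
  let β := (EuclideanSpace.basisFun (Fin n) ℝ).toBasis
  refine isDensity_of_basis β |v β| fun X => ?_
  have h := congrArg (fun w => w X) (AlternatingMap.eq_smul_basis_det β v)
  change v X = v β * β.det X at h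
  rw [h, abs_mul]

variable [MeasurableSpace M]

/-- The measure defined by a density in a parametrisation. -/
def paramMeasure (ρ : ∀ x : M, (Fin n → TangentSpace (𝓡 n) x) → ℝ)
    (ψ : EuclideanSpace ℝ (Fin n) → M) (O : Set (EuclideanSpace ℝ (Fin n))) : Measure M :=
  Measure.map ψ ((volume.restrict O).withDensity fun y =>
    ENNReal.ofReal (ρ (ψ y) fun i => dmap ψ y (EuclideanSpace.basisFun (Fin n) ℝ i)))

theorem chartMeasure_eq (ρ : ∀ x : M, (Fin n → TangentSpace (𝓡 n) x) → ℝ) (x₀ : M) :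
    chartMeasure ρ x₀ = paramMeasure ρ (extChartAt (𝓡 n) x₀).symm (extChartAt (𝓡 n) x₀).target :=
  rfl

variable [BorelSpace M]

/-- Nothing is known about `ψ` off `O`. It is almost everywhere measurable for the volume restricted
to `O`, absolute continuity passes this to the weighted measure, and the complement of `O` is null.
-/
theorem paramMeasure_apply (ρ : ∀ x : M, (Fin n → TangentSpace (𝓡 n) x) → ℝ)
    {ψ : EuclideanSpace ℝ (Fin n) → M} {O : Set (EuclideanSpace ℝ (Fin n))} (hO : IsOpen O)
    (hψ : ContinuousOn ψ O) {S : Set M} (hS : MeasurableSet S) :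
    paramMeasure ρ ψ O S = ∫⁻ y in O ∩ ψ ⁻¹' S, ENNReal.ofReal
      (ρ (ψ y) fun i => dmap ψ y (EuclideanSpace.basisFun (Fin n) ℝ i)) := by
  have hm : AEMeasurable ψ (volume.restrict O) := hψ.aemeasurable hO.measurableSet
  have hac := withDensity_absolutelyContinuous (volume.restrict O) fun y =>
    ENNReal.ofReal (ρ (ψ y) fun i => dmap ψ y (EuclideanSpace.basisFun (Fin n) ℝ i))
  have hm' := hm.mono_ac hac
  rw [paramMeasure, Measure.map_apply_of_aemeasurable hm' hS]
  have hnull : ∀ A : Set (EuclideanSpace ℝ (Fin n)), ((volume.restrict O).withDensity fun y =>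
      ENNReal.ofReal (ρ (ψ y) fun i => dmap ψ y (EuclideanSpace.basisFun (Fin n) ℝ i))) A =
      ((volume.restrict O).withDensity fun y => ENNReal.ofReal (ρ (ψ y) fun i =>
        dmap ψ y (EuclideanSpace.basisFun (Fin n) ℝ i))) (O ∩ A) := by
    intro A
    refine le_antisymm ?_ (measure_mono Set.inter_subset_right)
    calc _ ≤ ((volume.restrict O).withDensity fun y => ENNReal.ofReal (ρ (ψ y) fun i =>
          dmap ψ y (EuclideanSpace.basisFun (Fin n) ℝ i))) ((O ∩ A) ∪ Oᶜ) :=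
          measure_mono fun y hy => by
            by_cases h : y ∈ O
            · exact Or.inl ⟨h, hy⟩
            · exact Or.inr h
      _ ≤ _ := (measure_union_le _ _).trans (by
            rw [hac (show volume.restrict O Oᶜ = 0 by rw [Measure.restrict_apply hO.measurableSet.compl, Set.compl_inter_self, measure_empty]), add_zero])
  rw [hnull, withDensity_apply _ (measurableSet_inter_preimage hO hψ hS),
    Measure.restrict_restrict (measurableSet_inter_preimage hO hψ hS),
    Set.inter_assoc, Set.inter_comm (ψ ⁻¹' S), ← Set.inter_assoc, Set.inter_self]

variable [IsManifold (𝓡 n) ∞ M]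

/-- Change of variables along the transition map from the parameters to the chart: its Jacobian is
exactly the factor in the transformation law of a density. -/
theorem setLIntegral_image_chart (ρ : ∀ x : M, (Fin n → TangentSpace (𝓡 n) x) → ℝ)
    {ψ : EuclideanSpace ℝ (Fin n) → M} {T : Set (EuclideanSpace ℝ (Fin n))} (hT : MeasurableSet T)
    (hψ : ∀ y ∈ T, ContMDiffAt 𝓘(ℝ, EuclideanSpace ℝ (Fin n)) (𝓡 n) ∞ ψ y) (hi : Set.InjOn ψ T)
    (x₀ : M) (hx : ∀ y ∈ T, ψ y ∈ (extChartAt (𝓡 n) x₀).source)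
    (hρ : ∀ y ∈ T, IsDensity (ρ (ψ y))) :
    ∫⁻ z in (fun y => extChartAt (𝓡 n) x₀ (ψ y)) '' T,
      ENNReal.ofReal (ρ ((extChartAt (𝓡 n) x₀).symm z) fun i =>
        dmap (n := n) (extChartAt (𝓡 n) x₀).symm z (EuclideanSpace.basisFun (Fin n) ℝ i)) =
    ∫⁻ y in T, ENNReal.ofReal
      (ρ (ψ y) fun i => dmap ψ y (EuclideanSpace.basisFun (Fin n) ℝ i)) := by
  set f := fun y => extChartAt (𝓡 n) x₀ (ψ y) with hf
  have hfs : ∀ y ∈ T, ContDiffAt ℝ ∞ f y := fun y hy => contDiffAt_chart_comp x₀ (hx y hy) (hψ y hy)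
  rw [lintegral_image_eq_lintegral_abs_det_fderiv_mul volume hT
    (fun y hy => ((hfs y hy).differentiableAt
      (by simp : (∞ : WithTop ℕ∞) ≠ 0)).hasFDerivAt.hasFDerivWithinAt)
    (fun y hy z hz h => hi hy hz ((extChartAt (𝓡 n) x₀).injOn (hx y hy) (hx z hz) h))]
  refine setLIntegral_congr_fun hT fun y hy => ?_
  have hd := (hfs y hy).differentiableAt (by simp : (∞ : WithTop ℕ∞) ≠ 0)
  have hxy : (extChartAt (𝓡 n) x₀).symm (f y) = ψ y := (extChartAt (𝓡 n) x₀).left_inv (hx y hy)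
  have h1 : ∀ u, dmap ψ y u = dmap (n := n) (extChartAt (𝓡 n) x₀).symm (f y) (fderiv ℝ f y u) := by
    intro u
    rw [← dmap_comp (n := n) (M := M) (f := (extChartAt (𝓡 n) x₀).symm) (g := f) (y := y)
      ((contMDiffAt_chart_symm x₀ ((extChartAt (𝓡 n) x₀).map_source
        (hx y hy))).mdifferentiableAt (by simp)) hd u]
    have he : ψ =ᶠ[𝓝 y] fun z => (extChartAt (𝓡 n) x₀).symm (f z) := by
      filter_upwards [(hψ y hy).continuousAt ((isOpen_extChartAt_source (I := 𝓡 n) x₀).mem_nhds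
        (hx y hy))] with z hz
      exact ((extChartAt (𝓡 n) x₀).left_inv hz).symm
    have h9 : dmap (n := n) ψ y =
        dmap (n := n) (fun z => (extChartAt (𝓡 n) x₀).symm (f z)) y := he.mfderiv_eq
    exact congrArg (fun T : EuclideanSpace ℝ (Fin n) →L[ℝ] EuclideanSpace ℝ (Fin n) => T u) h9
  have tr : ∀ x, x = ψ y → ∀ X : Fin n → EuclideanSpace ℝ (Fin n), ρ x X = ρ (ψ y) X := by
    rintro x rfl X; rfl
  have h2 : (∀ X : Fin n → EuclideanSpace ℝ (Fin n), ∀ T : EuclideanSpace ℝ (Fin n) →L[ℝ]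
      EuclideanSpace ℝ (Fin n), ρ (ψ y) (fun i => T (X i)) = |T.det| * ρ (ψ y) X) :=
    fun X T => hρ y hy T X
  set D := dmap (n := n) (extChartAt (𝓡 n) x₀).symm (f y)
  have h3 : ρ (ψ y) (fun i => dmap ψ y (EuclideanSpace.basisFun (Fin n) ℝ i)) =
      |(fderiv ℝ f y).det| * ρ ((extChartAt (𝓡 n) x₀).symm (f y)) fun i =>
        D (EuclideanSpace.basisFun (Fin n) ℝ i) := by
    refine (congrArg (ρ (ψ y)) (funext fun i => h1 _)).trans ?_
    refine (h2 (fun i => EuclideanSpace.basisFun (Fin n) ℝ i) (D.comp (fderiv ℝ f y))).trans ?_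
    refine Eq.trans ?_ (congrArg (|(fderiv ℝ f y).det| * ·) ((tr _ hxy _).trans (h2 _ D)).symm)
    have : (D.comp (fderiv ℝ f y)).det = D.det * (fderiv ℝ f y).det := by
      simp [ContinuousLinearMap.det]
    rw [this, abs_mul]
    ring
  change ENNReal.ofReal |(fderiv ℝ f y).det| * _ = ENNReal.ofReal _
  rw [← ENNReal.ofReal_mul (abs_nonneg _)]
  exact congrArg ENNReal.ofReal h3.symm

theorem paramMeasure_eq_chartMeasure (ρ : ∀ x : M, (Fin n → TangentSpace (𝓡 n) x) → ℝ)
    {ψ : EuclideanSpace ℝ (Fin n) → M} {O : Set (EuclideanSpace ℝ (Fin n))} (hO : IsOpen O)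
    (hψ : ∀ y ∈ O, ContMDiffAt 𝓘(ℝ, EuclideanSpace ℝ (Fin n)) (𝓡 n) ∞ ψ y) (hi : Set.InjOn ψ O)
    (x₀ : M) {S : Set M} (hS : MeasurableSet S) (hSO : S ⊆ ψ '' O)
    (hx : S ⊆ (extChartAt (𝓡 n) x₀).source) (hρ : ∀ x ∈ S, IsDensity (ρ x)) :
    paramMeasure ρ ψ O S = chartMeasure ρ x₀ S := by
  have hc : ContinuousOn ψ O := fun y hy => (hψ y hy).continuousAt.continuousWithinAt
  rw [paramMeasure_apply ρ hO hc hS, chartMeasure_eq, paramMeasure_apply ρ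
    (isOpen_extChartAt_target x₀) (continuousOn_extChartAt_symm x₀) hS,
    ← setLIntegral_image_chart ρ (measurableSet_inter_preimage hO hc hS) (fun y hy => hψ y hy.1)
      (hi.mono Set.inter_subset_left) x₀ (fun y hy => hx hy.2) (fun y hy => hρ _ hy.2)]
  congr 2
  ext z
  constructor
  · rintro ⟨y, ⟨hy, hyS⟩, rfl⟩
    have hs := hx hyS
    refine ⟨(extChartAt (𝓡 n) x₀).map_source hs, ?_⟩
    rw [Set.mem_preimage]
    change (extChartAt (𝓡 n) x₀).symm (extChartAt (𝓡 n) x₀ (ψ y)) ∈ S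
    rwa [(extChartAt (𝓡 n) x₀).left_inv hs]
  · rintro ⟨hz, hzS⟩
    obtain ⟨y, hy, hyz⟩ := hSO hzS
    refine ⟨y, ⟨hy, ?_⟩, ?_⟩
    · rw [Set.mem_preimage, hyz]; exact hzS
    · change extChartAt (𝓡 n) x₀ (ψ y) = z
      rw [hyz, (extChartAt (𝓡 n) x₀).right_inv hz]

theorem densityMeasure_eq_chartMeasure (ρ : ∀ x : M, (Fin n → TangentSpace (𝓡 n) x) → ℝ)
    (x₀ : M) {S : Set M} (hS : MeasurableSet S)
    (hx : S ⊆ (extChartAt (𝓡 n) x₀).source) (hρ : ∀ x ∈ S, IsDensity (ρ x)) :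
    densityMeasure ρ S = chartMeasure ρ x₀ S := by
  refine le_antisymm ?_ (le_iSup (fun x => chartMeasure ρ x) x₀ S)
  -- The supremum is bounded by one measure that dominates every chart measure. The law of a density
  -- is assumed only on `S`, so off `S` the bound is the trivial one, `⊤`.
  have h1 : densityMeasure ρ ≤ (chartMeasure ρ x₀).restrict S + (⊤ : Measure M).restrict Sᶜ := by
    refine iSup_le fun x₁ => ?_
    rw [← Measure.restrict_add_restrict_compl (μ := chartMeasure ρ x₁) hS]
    refine add_le_add ?_ (Measure.restrict_mono le_rfl le_top)
    refine Measure.le_iff.2 fun T hT => ?_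
    rw [Measure.restrict_apply hT, Measure.restrict_apply hT]
    have hs₁ := (isOpen_extChartAt_source (I := 𝓡 n) x₁).measurableSet
    -- A chart measure is carried by the source of its chart, so the comparison may be confined to
    -- the overlap.
    have h2 : chartMeasure ρ x₁ (T ∩ S) = chartMeasure ρ x₁ (T ∩ S ∩ (extChartAt (𝓡 n) x₁).source) := by
      have hs := (extChartAt (𝓡 n) x₁).mapsTo_symm
      rw [chartMeasure_eq, paramMeasure_apply ρ (isOpen_extChartAt_target x₁)
        (continuousOn_extChartAt_symm x₁) (hT.inter hS), paramMeasure_apply ρ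
        (isOpen_extChartAt_target x₁) (continuousOn_extChartAt_symm x₁) ((hT.inter hS).inter hs₁)]
      congr 2
      ext z
      exact ⟨fun h => ⟨h.1, h.2, hs h.1⟩, fun h => ⟨h.1, h.2.1⟩⟩
    rw [h2, ← paramMeasure_eq_chartMeasure ρ (isOpen_extChartAt_target x₀)
      (fun y hy => contMDiffAt_chart_symm x₀ hy) (extChartAt (𝓡 n) x₀).symm.injOn x₁
      ((hT.inter hS).inter hs₁) ?_ Set.inter_subset_right (fun x hx => hρ x hx.1.2)]
    · exact measure_mono Set.inter_subset_left
    · rw [PartialEquiv.symm_image_target_eq_source]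
      exact fun x h => hx h.1.2
  refine (h1 S).trans ?_
  rw [Measure.add_apply, Measure.restrict_apply_self, Measure.restrict_apply hS,
    Set.inter_compl_self, measure_empty, add_zero]

/-- The measure of a density in a parametrisation. -/
theorem densityMeasure_eq_paramMeasure [SecondCountableTopology M]
    (ρ : ∀ x : M, (Fin n → TangentSpace (𝓡 n) x) → ℝ)
    {ψ : EuclideanSpace ℝ (Fin n) → M} {O : Set (EuclideanSpace ℝ (Fin n))} (hO : IsOpen O)
    (hψ : ∀ y ∈ O, ContMDiffAt 𝓘(ℝ, EuclideanSpace ℝ (Fin n)) (𝓡 n) ∞ ψ y) (hi : Set.InjOn ψ O)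
    {S : Set M} (hS : MeasurableSet S) (hSO : S ⊆ ψ '' O) (hρ : ∀ x ∈ S, IsDensity (ρ x)) :
    densityMeasure ρ S = paramMeasure ρ ψ O S := by
  -- Countably many chart sources cover, so equality of the restricted measures on each of them
  -- gives equality on `S`.
  obtain ⟨s, hs, hcov⟩ := TopologicalSpace.countable_cover_nhds fun x : M =>
    extChartAt_source_mem_nhds (I := 𝓡 n) x
  have := hs.to_subtype
  have key : (densityMeasure ρ).restrict (⋃ x : s, S ∩ (extChartAt (𝓡 n) (x : M)).source) =
      (paramMeasure ρ ψ O).restrict (⋃ x : s, S ∩ (extChartAt (𝓡 n) (x : M)).source) := by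
    rw [Measure.restrict_iUnion_congr]
    intro x
    ext T hT
    have hm := (hT.inter (hS.inter (isOpen_extChartAt_source (I := 𝓡 n) (x : M)).measurableSet))
    rw [Measure.restrict_apply hT, Measure.restrict_apply hT,
      densityMeasure_eq_chartMeasure ρ x hm (fun y hy => hy.2.2) (fun y hy => hρ y hy.2.1),
      paramMeasure_eq_chartMeasure ρ hO hψ hi x hm (fun y hy => hSO hy.2.1) (fun y hy => hy.2.2)
        (fun y hy => hρ y hy.2.1)]
  have hU : (⋃ x : s, S ∩ (extChartAt (𝓡 n) (x : M)).source) = S := by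
    rw [← Set.inter_iUnion, Set.iUnion_coe_set, hcov, Set.inter_univ]
  rw [hU] at key
  have h := congrArg (fun μ => μ S) key
  simpa [Measure.restrict_apply_self] using h

end Density

/-! ### The volume of the base and of the fibre -/

section ProdEquiv

/-- The decomposition of six-dimensional Euclidean space. -/
def prodEquiv : EuclideanSpace ℝ (Fin 6) ≃L[ℝ]
    EuclideanSpace ℝ (Fin 3) × EuclideanSpace ℝ (Fin 3) :=
  EuclideanSpace.finAddEquivProd (n := 3) (m := 3)

theorem measurePreserving_prodEquiv : MeasurePreserving prodEquiv volume volume := by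
  have h1 := (LinearIsometryEquiv.piLpCongrLeft 2 ℝ ℝ
    (finSumFinEquiv (m := 3) (n := 3)).symm).measurePreserving
  have h2 := (PiLp.sumPiLpEquivProdLpPiLp (𝕜 := ℝ) (ι := Fin 3) (κ := Fin 3) 2
    fun _ => ℝ).measurePreserving
  have h3 := WithLp.volume_preserving_ofLp (EuclideanSpace ℝ (Fin 3)) (EuclideanSpace ℝ (Fin 3))
  exact h3.comp (h2.comp h1)

theorem prodEquiv_castAdd (a : Fin 3) :
    prodEquiv (EuclideanSpace.basisFun (Fin 6) ℝ (Fin.castAdd 3 a)) =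
      (EuclideanSpace.basisFun (Fin 3) ℝ a, 0) := by
  refine Prod.ext ?_ ?_
  · ext i
    change EuclideanSpace.basisFun (Fin 6) ℝ (Fin.castAdd 3 a) (Fin.castAdd 3 i) = _
    simp [PiLp.single_apply, Fin.ext_iff]
  · ext i
    change EuclideanSpace.basisFun (Fin 6) ℝ (Fin.castAdd 3 a) (Fin.natAdd 3 i) = _
    fin_cases a <;> fin_cases i <;> simp

theorem prodEquiv_natAdd (a : Fin 3) :
    prodEquiv (EuclideanSpace.basisFun (Fin 6) ℝ (Fin.natAdd 3 a)) =
      (0, EuclideanSpace.basisFun (Fin 3) ℝ a) := by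
  refine Prod.ext ?_ ?_
  · ext i
    change EuclideanSpace.basisFun (Fin 6) ℝ (Fin.natAdd 3 a) (Fin.castAdd 3 i) = _
    fin_cases a <;> fin_cases i <;> simp
  · ext i
    change EuclideanSpace.basisFun (Fin 6) ℝ (Fin.natAdd 3 a) (Fin.natAdd 3 i) = _
    simp [PiLp.single_apply, Fin.ext_iff]

end ProdEquiv

namespace PrincipalSU2Bundle

variable {M P : Type*} [TopologicalSpace M] [ChartedSpace (EuclideanSpace ℝ (Fin 3)) M]
  [TopologicalSpace P] [ChartedSpace (EuclideanSpace ℝ (Fin 6)) P] {B : PrincipalSU2Bundle M P}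
  [IsManifold (𝓡 3) ∞ M]

theorem dproj_surjective (p : P) : Function.Surjective (B.dproj p) := by
  obtain ⟨S, -, hb, hp⟩ := B.exists_localSection p
  have key : ∀ q, q = p → Function.Surjective (B.dproj q) → Function.Surjective (B.dproj p) := by
    rintro q rfl h; exact h
  refine key _ hp fun u => ?_
  have hi := dmap_chart_symm_injective S.center (S.dom_subset (S.coord_mem hb))
  obtain ⟨w, hw⟩ := (LinearMap.injective_iff_surjective
    (f := (dmap (n := 3) S.chart.symm (S.coord p)).toLinearMap)).1 hi u
  exact ⟨dmap S.sec (S.coord p) w, (S.dproj_dsec (S.coord_mem hb) w).trans hw⟩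

theorem exists_act_eq {p q : P} (h : B.proj p = B.proj q) : ∃ g, B.act p g = q := by
  obtain ⟨S, -, hb, -⟩ := B.exists_localSection p
  have hb' : B.proj q ∈ S.base := h ▸ hb
  refine ⟨(S.grp p)⁻¹ * S.grp q, ?_⟩
  have h1 : B.act p (S.grp p)⁻¹ = S.sec (S.coord p) := by
    conv_lhs => rw [← S.act_sec_coord hb]
    rw [← B.act_mul]
    have h2 : S.grp (B.act (S.sec (S.coord p)) (S.grp p)) = S.grp p := by
      rw [S.act_sec_coord hb]
    rw [h2, mul_inv_cancel, B.act_one]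
  rw [B.act_mul, h1, show S.coord p = S.coord q from congrArg S.chart h, S.act_sec_coord hb']

theorem horizontal_congr {p : P} {e : EuclideanSpace ℝ (Fin 6) [⋀^Fin 1]→L[ℝ] ℍ[ℝ]}
    (he : B.IsHorizontalAt p e) {X Y : EuclideanSpace ℝ (Fin 6)} (h : B.dproj p X = B.dproj p Y) :
    e ![X] = e ![Y] :=
  sub_eq_zero.1 ((oneForm_apply_sub e X Y).symm.trans (he (X - Y)
    ((map_sub (B.dproj p) X Y).trans (sub_eq_zero.2 h))))

/-- On imaginary quaternions `-2 Tr (xy)` is four times the inner product, so the Gram matrix is `4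
Aᵀ A` with determinant `64 (det A)²`. The metric is defined through chosen lifts: horizontality
removes the choice of vectors, and another point of the fibre changes `A` by a rotation. -/
theorem sqrt_det_baseMetric [IsManifold (𝓡 6) ∞ P] {vM : DiffForm 3 M ℝ 3}
    {W : DiffForm 6 P ℍ[ℝ] 1} (hW : B.IsConnection W) {q : P} (hf : B.HasFrame vM W q)
    (X : Fin 3 → EuclideanSpace ℝ (Fin 3)) (Y : Fin 3 → EuclideanSpace ℝ (Fin 6))
    (hY : ∀ i, B.dproj q (Y i) = X i) :
    √(Matrix.of fun i j => B.baseMetric (B.frame vM W) (B.proj q) (X i) (X j)).det =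
      8 * |(formMatrix (V := EuclideanSpace ℝ (Fin 6)) (B.frame vM W q).toAlternatingMap Y).det| := by
  set p := B.liftPoint (B.proj q) with hp
  have hpq : B.proj p = B.proj q := Function.surjInv_eq B.proj_surjective _
  have hl : ∀ i, B.dproj p (B.liftVector p (X i)) = X i := fun i =>
    Function.invFun_eq (dproj_surjective p (X i))
  obtain ⟨g, hg⟩ := exists_act_eq hpq
  obtain ⟨g', hg'⟩ := exists_act_eq hpq.symm
  have hfp : B.HasFrame vM W p := hg' ▸ hf.act hW g'
  set x : Fin 3 → ℍ[ℝ] := fun i => B.frame vM W p ![B.liftVector p (X i)] with hx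
  have hxr : ∀ i, (x i).re = 0 := fun i => hfp.isFrameAt.lieValued _
  have h1 : (formMatrix (V := EuclideanSpace ℝ (Fin 6)) (B.frame vM W q).toAlternatingMap Y).det =
      (Matrix.of fun a i => im (x i) a).det := by
    rw [← det_conj g x hxr]
    congr 1
    ext a i
    rw [Matrix.of_apply, hx]
    have key : ∀ q', q' = q → ∀ Z : EuclideanSpace ℝ (Fin 6), B.dproj q' Z = X i →
        B.frame vM W q ![Y i] = B.frame vM W q' ![Z] := by
      rintro q' rfl Z hZ
      exact horizontal_congr hf.isFrameAt.horizontal ((hY i).trans hZ.symm)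
    refine congrFun (congrArg im ((key _ hg (B.dact g p (B.liftVector p (X i))) ?_).trans
      (hfp.frame_act hW g _))) a
    exact (dproj_dact g p _).trans (hl i)
  rw [h1]
  have h2 : (Matrix.of fun i j => B.baseMetric (B.frame vM W) (B.proj q) (X i) (X j)) =
      (4 : ℝ) • ((Matrix.of fun a i => im (x i) a).transpose * Matrix.of fun a i => im (x i) a) := by
    ext i j
    change -2 * tr (x i * x j) = _
    rw [Matrix.smul_apply, Matrix.mul_apply, Fin.sum_univ_three]
    simp [hxr]
    ring
  rw [h2, Matrix.det_smul, Matrix.det_mul, Matrix.det_transpose, Fintype.card_fin,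
    show (4 : ℝ) ^ 3 * ((Matrix.of fun a i => im (x i) a).det * (Matrix.of fun a i => im (x i) a).det)
      = (8 * |(Matrix.of fun a i => im (x i) a).det|) ^ 2 by rw [mul_pow, sq_abs]; ring,
    Real.sqrt_sq (by positivity)]

/-- The volume density of the base. -/
def baseDensity (B : PrincipalSU2Bundle M P) (vM : DiffForm 3 M ℝ 3) (W : DiffForm 6 P ℍ[ℝ] 1)
    (x : M) (X : Fin 3 → EuclideanSpace ℝ (Fin 3)) : ℝ :=
  √(Matrix.of fun i j => B.baseMetric (B.frame vM W) x (X i) (X j)).det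

theorem isDensity_baseDensity [IsManifold (𝓡 6) ∞ P] {vM : DiffForm 3 M ℝ 3}
    {W : DiffForm 6 P ℍ[ℝ] 1} (hW : B.IsConnection W) {q : P} (hf : B.HasFrame vM W q) :
    IsDensity (B.baseDensity vM W (B.proj q)) := by
  let β := (EuclideanSpace.basisFun (Fin 3) ℝ).toBasis
  choose Z hZ using fun i => dproj_surjective (B := B) q (β i)
  refine isDensity_of_basis β (8 * |(formMatrix (V := EuclideanSpace ℝ (Fin 6))
    (B.frame vM W q).toAlternatingMap Z).det|) fun X => ?_
  choose Y hY using fun i => dproj_surjective (B := B) q (X i)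
  have h := formMatrix_of_horizontal (V := EuclideanSpace ℝ (Fin 6)) (B.dproj q).toLinearMap Z β
    (fun i => (hZ i).symm) (e := (B.frame vM W q).toAlternatingMap) hf.isFrameAt.horizontal Y
  have hYX : (fun j => (B.dproj q).toLinearMap (Y j)) = X := funext hY
  rw [hYX] at h
  refine (sqrt_det_baseMetric hW hf X Y hY).trans
    ((congrArg (fun A : Matrix (Fin 3) (Fin 3) ℝ => 8 * |A.det|) h).trans ?_)
  rw [Matrix.det_mul, abs_mul, Module.Basis.det_apply, mul_assoc]
  rfl

namespace LocalSection

variable (S : LocalSection B)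

/-- The volume density of the base in a section. -/
def baseFun (W : DiffForm 6 P ℍ[ℝ] 1) (y : EuclideanSpace ℝ (Fin 3)) : ℝ :=
  8 * √((S.curvMatrix W y).det / 8)

theorem orient_sq {vM : DiffForm 3 M ℝ 3} (hvM : ∀ x, vM x ≠ 0) {y : EuclideanSpace ℝ (Fin 3)}
    (hy : y ∈ S.dom) : S.orient vM y ^ 2 = 1 := by
  have h : chartRep vM S.center y (EuclideanSpace.basisFun (Fin 3) ℝ) ≠ 0 := by
    intro h
    apply hvM (S.chart.symm y)
    apply ContinuousAlternatingMap.toAlternatingMap_injective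
    refine (AlternatingMap.eq_smul_basis_det (chartBasis S.center (S.dom_subset hy)) _).trans ?_
    have h2 : vM (S.chart.symm y) (chartBasis S.center (S.dom_subset hy)) = 0 := by
      rw [← h]
      exact congrArg (vM (S.chart.symm y)) (funext fun i => chartBasis_apply S.center _ i)
    refine (congrArg (· • _) h2).trans ?_
    rw [zero_smul]
    rfl
  rw [orient]
  rcases lt_or_gt_of_ne h with h | h <;> simp [h]

theorem baseDensity_eq [IsManifold (𝓡 6) ∞ P] {vM : DiffForm 3 M ℝ 3} (hvM : ∀ x, vM x ≠ 0)
    {W : DiffForm 6 P ℍ[ℝ] 1} (hW : B.IsConnection W) {y : EuclideanSpace ℝ (Fin 3)}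
    (hy : y ∈ S.dom) (hm : 0 < (S.curvMatrix W y).det) :
    (B.baseDensity vM W (S.chart.symm y) fun i =>
      dmap S.chart.symm y (EuclideanSpace.basisFun (Fin 3) ℝ i)) = S.baseFun W y := by
  have hf := S.hasFrame hvM hW hy hm
  have h := (sqrt_det_baseMetric hW hf _ (S.vec y) (fun i => rfl)).trans
    (congrArg (fun A : Matrix (Fin 3) (Fin 3) ℝ => 8 * |A.det|)
      ((S.isFrameAt_iff hvM hW hy hm).1 hf.isFrameAt).2)
  have tr : ∀ x, x = B.proj (S.sec y) → ∀ X : Fin 3 → EuclideanSpace ℝ (Fin 3),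
      B.baseDensity vM W x X = B.baseDensity vM W (B.proj (S.sec y)) X := by rintro x rfl X; rfl
  refine (tr _ (S.proj_sec y hy).symm _).trans (Eq.trans ?_ (h.trans ?_))
  · refine congrArg (B.baseDensity vM W (B.proj (S.sec y))) (funext fun i => ?_)
    rw [← chartBasis_apply S.center (S.dom_subset hy), S.dproj_vec hy]
  · have h1 := (frameMatrix_iff (S.orient_sq hvM hy) hm).2 rfl
    have h2 := det_of_eq_two_cof h1.1
    rw [baseFun, h2, mul_div_cancel_left₀ _ (by norm_num), Real.sqrt_sq_eq_abs]

/-- Positivity is asked only over `U`, so that the formula also applies to `W + tA`, which is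
controlled only over a compact set. -/
theorem baseVolume_eq [IsManifold (𝓡 6) ∞ P] [SecondCountableTopology M] [MeasurableSpace M]
    [BorelSpace M] {vM : DiffForm 3 M ℝ 3} (hvM : ∀ x, vM x ≠ 0)
    {W : DiffForm 6 P ℍ[ℝ] 1} (hW : B.IsConnection W) {U : Set M} (hU : MeasurableSet U)
    (hUS : U ⊆ S.base) (hm : ∀ y ∈ S.dom ∩ S.chart.symm ⁻¹' U, 0 < (S.curvMatrix W y).det) :
    B.baseVolume vM W U =
      ∫⁻ y in S.dom ∩ S.chart.symm ⁻¹' U, ENNReal.ofReal (S.baseFun W y) := by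
  have hs : ∀ y ∈ S.dom, ContMDiffAt 𝓘(ℝ, EuclideanSpace ℝ (Fin 3)) (𝓡 3) ∞ S.chart.symm y :=
    fun y hy => contMDiffAt_chart_symm S.center (S.dom_subset hy)
  have hc : ContinuousOn S.chart.symm S.dom := fun y hy =>
    (hs y hy).continuousAt.continuousWithinAt
  have hsurj : ∀ x ∈ U, S.chart x ∈ S.dom ∩ S.chart.symm ⁻¹' U ∧ S.chart.symm (S.chart x) = x := by
    intro x hx
    have h := S.chart.left_inv (hUS hx).1
    exact ⟨⟨(hUS hx).2, by rw [Set.mem_preimage, h]; exact hx⟩, h⟩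
  refine (densityMeasure_eq_paramMeasure (B.baseDensity vM W) S.isOpen_dom hs
    (S.chart.symm.injOn.mono S.dom_subset) hU
    (fun x hx => ⟨_, (hsurj x hx).1.1, (hsurj x hx).2⟩) fun x hx => ?_).trans ?_
  · obtain ⟨h1, h2⟩ := hsurj x hx
    have h3 := isDensity_baseDensity hW (S.hasFrame hvM hW h1.1 (hm _ h1))
    have tr : ∀ x', x' = x → IsDensity (B.baseDensity vM W x') → IsDensity (B.baseDensity vM W x) := by
      rintro x' rfl h; exact h
    exact tr _ ((S.proj_sec _ h1.1).trans h2) h3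
  · refine (paramMeasure_apply (n := 3) (B.baseDensity vM W) S.isOpen_dom hc hU).trans ?_
    refine setLIntegral_congr_fun (measurableSet_inter_preimage S.isOpen_dom hc hU) fun y hy => ?_
    exact congrArg ENNReal.ofReal (S.baseDensity_eq hvM hW hy.1 (hm y hy))

end LocalSection

end PrincipalSU2Bundle

/-! The fibre. -/

/-- The density of the fibre. -/
def fibreDensity (g : SU2) (X : Fin 3 → EuclideanSpace ℝ (Fin 3)) : ℝ :=
  |(1 / 3 : ℝ) * trCube (AlternatingMap.ofSubsingleton ℝ (TangentSpace (𝓡 3) g) ℍ[ℝ] (0 : Fin 1)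
      (maurerCartan g)) X|

theorem fibreDensity_eq (g : SU2) (X : Fin 3 → EuclideanSpace ℝ (Fin 3)) :
    fibreDensity g X = 4 * |(maurerCartanMatrix g X).det| := by
  have h := trCube_apply (V := EuclideanSpace ℝ (Fin 3)) (AlternatingMap.ofSubsingleton ℝ
    (EuclideanSpace ℝ (Fin 3)) ℍ[ℝ] (0 : Fin 1) (maurerCartan g)) X
    fun i => re_maurerCartan g (X i)
  have h2 : fibreDensity g X = |(1 / 3 : ℝ) * (-12 * (maurerCartanMatrix g X).det)| :=
    congrArg (fun r => |(1 / 3 : ℝ) * r|) h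
  rw [h2, ← mul_assoc, abs_mul]
  norm_num

theorem isDensity_fibreDensity (g : SU2) : IsDensity (fibreDensity g) :=
  isDensity_abs ((1 / 3 : ℝ) • trCube (AlternatingMap.ofSubsingleton ℝ
    (EuclideanSpace ℝ (Fin 3)) ℍ[ℝ] (0 : Fin 1) (maurerCartan g)))

/-- The volume density of the fibre in a chart. -/
def fibreFun (g₀ : SU2) (z : EuclideanSpace ℝ (Fin 3)) : ℝ :=
  4 * |(maurerCartanMatrix ((extChartAt (𝓡 3) g₀).symm z) fun i =>
    dmap (n := 3) (extChartAt (𝓡 3) g₀).symm z (EuclideanSpace.basisFun (Fin 3) ℝ i)).det|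

/-- The invariant measure of the fibre. -/
def fibreMeasure : Measure SU2 := densityMeasure (n := 3) (M := SU2) fibreDensity

theorem fibreVolume_eq : fibreVolume = fibreMeasure Set.univ := rfl

theorem fibreMeasure_eq (g₀ : SU2) {G : Set SU2} (hG : MeasurableSet G)
    (hGs : G ⊆ (extChartAt (𝓡 3) g₀).source) :
    fibreMeasure G = ∫⁻ z in (extChartAt (𝓡 3) g₀).target ∩ (extChartAt (𝓡 3) g₀).symm ⁻¹' G,
      ENNReal.ofReal (fibreFun g₀ z) := by
  have h := densityMeasure_eq_chartMeasure (n := 3) (M := SU2) fibreDensity g₀ hG hGs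
    fun x _ => isDensity_fibreDensity x
  refine h.trans ((paramMeasure_apply (n := 3) fibreDensity (isOpen_extChartAt_target g₀)
    (continuousOn_extChartAt_symm g₀) hG).trans ?_)
  exact lintegral_congr fun z => congrArg ENNReal.ofReal (fibreDensity_eq _ _)

theorem fibreFun_pos (g₀ : SU2) {z : EuclideanSpace ℝ (Fin 3)}
    (hz : z ∈ (extChartAt (𝓡 3) g₀).target) : 0 < fibreFun g₀ z := by
  have h := det_maurerCartanMatrix_ne_zero ((extChartAt (𝓡 3) g₀).symm z) (chartBasis g₀ hz)
  have h2 : (chartBasis g₀ hz : Fin 3 → EuclideanSpace ℝ (Fin 3)) = fun i =>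
      dmap (n := 3) (extChartAt (𝓡 3) g₀).symm z (EuclideanSpace.basisFun (Fin 3) ℝ i) :=
    funext fun i => chartBasis_apply g₀ hz i
  rw [h2] at h
  rw [fibreFun]
  positivity

theorem continuousOn_fibreFun (g₀ : SU2) :
    ContinuousOn (fibreFun g₀) (extChartAt (𝓡 3) g₀).target := by
  set κ := (extChartAt (𝓡 3) g₀).symm
  intro z hz
  refine ContinuousAt.continuousWithinAt ?_
  have hκ : ∀ z ∈ (extChartAt (𝓡 3) g₀).target,
      ContMDiffAt 𝓘(ℝ, EuclideanSpace ℝ (Fin 3)) (𝓡 3) ∞ κ z :=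
    fun z hz => contMDiffAt_chart_symm g₀ hz
  have hu : ContDiffAt ℝ ∞ (fun z => (κ z : ℍ[ℝ])) z :=
    contMDiffAt_iff_contDiffAt.1 (ContMDiffAt.comp (g := fun h : SU2 => (h : ℍ[ℝ])) z
      contMDiff_coe_SU2.contMDiffAt (hκ z hz))
  have hu' : ContDiffAt ℝ ∞ (fderiv ℝ fun z => (κ z : ℍ[ℝ])) z := hu.fderiv_right (by simp)
  have key : fibreFun g₀ =ᶠ[𝓝 z] fun z => 4 * |(Matrix.of fun a i : Fin 3 =>
      PrincipalSU2Bundle.LocalSection.imCLM a (starCLM (κ z : ℍ[ℝ]) * fderiv ℝ (fun z => (κ z : ℍ[ℝ])) z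
        (EuclideanSpace.basisFun (Fin 3) ℝ i))).det| := by
    filter_upwards [(isOpen_extChartAt_target (I := 𝓡 3) g₀).mem_nhds hz] with w hw
    rw [fibreFun]
    congr 3
    ext a i
    have h2 := mfderiv_comp w (I := 𝓘(ℝ, EuclideanSpace ℝ (Fin 3))) (I' := 𝓡 3)
      (I'' := 𝓘(ℝ, ℍ[ℝ])) (g := fun h : SU2 => (h : ℍ[ℝ])) (f := κ)
      (contMDiff_coe_SU2.mdifferentiableAt (by simp)) ((hκ w hw).mdifferentiableAt (by simp))
    rw [mfderiv_eq_fderiv] at h2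
    have h3 : fderiv ℝ (fun z => (κ z : ℍ[ℝ])) w (EuclideanSpace.basisFun (Fin 3) ℝ i) =
        dcoe (κ w) (dmap (n := 3) κ w (EuclideanSpace.basisFun (Fin 3) ℝ i)) :=
      congrArg (fun T => T (EuclideanSpace.basisFun (Fin 3) ℝ i)) h2
    rw [Matrix.of_apply, h3, starCLM_apply, ← coe_inv_SU2]
    rfl
  refine ContinuousAt.congr ?_ key.symm
  have hc : ∀ a i : Fin 3, ContinuousAt (fun z => PrincipalSU2Bundle.LocalSection.imCLM a
      (starCLM (κ z : ℍ[ℝ]) * fderiv ℝ (fun z => (κ z : ℍ[ℝ])) z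
        (EuclideanSpace.basisFun (Fin 3) ℝ i))) z := fun a i =>
    (PrincipalSU2Bundle.LocalSection.imCLM a).continuous.continuousAt.comp
      ((starCLM.continuous.continuousAt.comp hu.continuousAt).mul
        (hu'.continuousAt.clm_apply continuousAt_const))
  simp only [Matrix.det_fin_three, Matrix.of_apply]
  fun_prop

/-- The density is positive throughout the nonempty open target of one chart. -/
theorem fibreVolume_pos : 0 < fibreVolume := by
  rw [fibreVolume_eq]
  set χ := extChartAt (𝓡 3) (1 : SU2)
  have ho := isOpen_extChartAt_target (I := 𝓡 3) (1 : SU2)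
  have hs := isOpen_extChartAt_source (I := 𝓡 3) (1 : SU2)
  refine lt_of_lt_of_le ?_ (measure_mono (Set.subset_univ χ.source))
  rw [fibreMeasure_eq 1 hs.measurableSet le_rfl, pos_iff_ne_zero]
  have hT : χ.target ∩ χ.symm ⁻¹' χ.source = χ.target :=
    Set.inter_eq_left.2 fun z hz => χ.map_target hz
  intro h
  change ∫⁻ z in χ.target ∩ χ.symm ⁻¹' χ.source, ENNReal.ofReal (fibreFun 1 z) = 0 at h
  rw [hT, lintegral_eq_zero_iff' ((continuousOn_fibreFun 1).aemeasurable
    ho.measurableSet).ennreal_ofReal] at h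
  have h1 : ∀ᵐ z ∂volume.restrict χ.target, False := by
    filter_upwards [h, ae_restrict_mem ho.measurableSet] with z hz hzt
    have := fibreFun_pos 1 hzt
    simp at hz
    linarith
  rw [Filter.eventually_false_iff_eq_bot, ae_eq_bot, Measure.restrict_eq_zero] at h1
  exact (ho.measure_pos volume ⟨_, mem_extChartAt_target (I := 𝓡 3) (1 : SU2)⟩).ne' h1

/-- The density is continuous, hence integrable over a small closed ball in each chart, and the
group is compact. -/
theorem fibreVolume_lt_top : fibreVolume < ⊤ := by
  rw [fibreVolume_eq]
  refine isCompact_univ.measure_lt_top_of_nhdsWithin fun g _ => ?_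
  rw [nhdsWithin_univ]
  set χ := extChartAt (𝓡 3) g
  have ho := isOpen_extChartAt_target (I := 𝓡 3) g
  obtain ⟨r, hr, hrt⟩ := Metric.nhds_basis_closedBall.mem_iff.1
    (ho.mem_nhds (mem_extChartAt_target (I := 𝓡 3) g))
  have hN : IsOpen (χ.source ∩ χ ⁻¹' Metric.ball (χ g) r) :=
    (continuousOn_extChartAt (I := 𝓡 3) g).isOpen_inter_preimage
      (isOpen_extChartAt_source (I := 𝓡 3) g) Metric.isOpen_ball
  refine ⟨_, hN.mem_nhds ⟨mem_extChartAt_source (I := 𝓡 3) g, Metric.mem_ball_self hr⟩, ?_⟩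
  rw [fibreMeasure_eq g hN.measurableSet Set.inter_subset_left]
  have hsub : χ.target ∩ χ.symm ⁻¹' (χ.source ∩ χ ⁻¹' Metric.ball (χ g) r) ⊆
      Metric.closedBall (χ g) r := by
    rintro z ⟨hz, -, hz2⟩
    rw [Set.mem_preimage, χ.right_inv hz] at hz2
    exact Metric.ball_subset_closedBall hz2
  refine (lintegral_mono_set hsub).trans_lt ?_
  exact (((continuousOn_fibreFun g).mono hrt).integrableOn_compact
    (isCompact_closedBall _ _)).lintegral_lt_top

/-! ### Integration along the fibres -/

namespace PrincipalSU2Bundle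

variable {M P : Type*} [TopologicalSpace M] [ChartedSpace (EuclideanSpace ℝ (Fin 3)) M]
  [TopologicalSpace P] [ChartedSpace (EuclideanSpace ℝ (Fin 6)) P] {B : PrincipalSU2Bundle M P}
  [IsManifold (𝓡 3) ∞ M]

namespace LocalSection

variable (S : LocalSection B) (g₀ : SU2)

/-- The parametrisation `(z, y) ↦ S(y) g(z)` of the bundle. -/
def prodParam (w : EuclideanSpace ℝ (Fin 3) × EuclideanSpace ℝ (Fin 3)) : P :=
  B.act (S.sec w.2) ((extChartAt (𝓡 3) g₀).symm w.1)

theorem contMDiffAt_prodParam {z y : EuclideanSpace ℝ (Fin 3)}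
    (hz : z ∈ (extChartAt (𝓡 3) g₀).target) (hy : y ∈ S.dom) :
    ContMDiffAt 𝓘(ℝ, EuclideanSpace ℝ (Fin 3) × EuclideanSpace ℝ (Fin 3)) (𝓡 6) ∞
      (S.prodParam g₀) (z, y) := by
  have h1 : ContMDiffAt 𝓘(ℝ, EuclideanSpace ℝ (Fin 3) × EuclideanSpace ℝ (Fin 3)) (𝓡 6) ∞
      (fun w : EuclideanSpace ℝ (Fin 3) × EuclideanSpace ℝ (Fin 3) => S.sec w.2) (z, y) :=
    ContMDiffAt.comp (g := S.sec) (z, y) (S.smooth_sec y hy) contDiff_snd.contMDiff.contMDiffAt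
  have h2 : ContMDiffAt 𝓘(ℝ, EuclideanSpace ℝ (Fin 3) × EuclideanSpace ℝ (Fin 3)) (𝓡 3) ∞
      (fun w : EuclideanSpace ℝ (Fin 3) × EuclideanSpace ℝ (Fin 3) =>
        (extChartAt (𝓡 3) g₀).symm w.1) (z, y) :=
    ContMDiffAt.comp (g := (extChartAt (𝓡 3) g₀).symm) (z, y) (contMDiffAt_chart_symm g₀ hz)
      contDiff_fst.contMDiff.contMDiffAt
  exact ContMDiffAt.comp (g := fun z : P × SU2 => B.act z.1 z.2) (z, y)
    B.contMDiff_act.contMDiffAt (h1.prodMk h2)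

theorem dmap_prodParam {z y : EuclideanSpace ℝ (Fin 3)}
    (hz : z ∈ (extChartAt (𝓡 3) g₀).target) (hy : y ∈ S.dom)
    (w : EuclideanSpace ℝ (Fin 3) × EuclideanSpace ℝ (Fin 3)) :
    dmap (S.prodParam g₀) (z, y) w = S.adaptedMap y ((extChartAt (𝓡 3) g₀).symm z)
      (dmap (n := 3) (extChartAt (𝓡 3) g₀).symm z w.1, w.2) := by
  set κ := (extChartAt (𝓡 3) g₀).symm
  have hd := (S.contMDiffAt_prodParam g₀ hz hy).mdifferentiableAt (by simp : (∞ : WithTop ℕ∞) ≠ 0)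
  have hκ := (contMDiffAt_chart_symm g₀ hz).mdifferentiableAt (by simp : (∞ : WithTop ℕ∞) ≠ 0)
  have hs := (S.smooth_sec y hy).mdifferentiableAt (by simp : (∞ : WithTop ℕ∞) ≠ 0)
  have h1 : dmap (S.prodParam g₀) (z, y) (w.1, 0) = B.dorbit (S.sec y) (κ z) (dmap (n := 3) κ z w.1) := by
    rw [← B.dmap_orbit (S.sec y) hκ]
    have h := dmap_comp (n := 6) (f := S.prodParam g₀) (g := fun z => (z, y)) (y := z) hd
      (by fun_prop) w.1
    have hl : fderiv ℝ (fun z => (z, y)) z w.1 = (w.1, (0 : EuclideanSpace ℝ (Fin 3))) := by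
      rw [(hasFDerivAt_prodMk_left (𝕜 := ℝ) z y).fderiv]; rfl
    rw [hl] at h
    exact h.symm
  have h2 : dmap (S.prodParam g₀) (z, y) (0, w.2) = B.dact (κ z) (S.sec y) (dmap S.sec y w.2) := by
    have h3 := B.dmap_act_right hs (κ z) w.2
    have h := dmap_comp (n := 6) (f := S.prodParam g₀) (g := fun y => (z, y)) (y := y) hd
      (by fun_prop) w.2
    have hl : fderiv ℝ (fun y => (z, y)) y w.2 = ((0 : EuclideanSpace ℝ (Fin 3)), w.2) := by
      rw [(hasFDerivAt_prodMk_right (𝕜 := ℝ) z y).fderiv]; rfl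
    rw [hl] at h
    exact h.symm.trans h3
  rw [adaptedMap_apply, ← h1, ← h2, ← map_add, Prod.mk_add_mk, add_zero, zero_add]

/-- The domain of the parametrisation of the bundle. -/
def paramDom : Set (EuclideanSpace ℝ (Fin 6)) :=
  prodEquiv ⁻¹' ((extChartAt (𝓡 3) g₀).target ×ˢ S.dom)

theorem isOpen_paramDom : IsOpen (S.paramDom g₀) :=
  ((isOpen_extChartAt_target (I := 𝓡 3) g₀).prod S.isOpen_dom).preimage prodEquiv.continuous

/-- The parametrisation of the bundle on six-dimensional space. -/
def param (x : EuclideanSpace ℝ (Fin 6)) : P := S.prodParam g₀ (prodEquiv x)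

theorem contMDiffAt_param {x : EuclideanSpace ℝ (Fin 6)} (hx : x ∈ S.paramDom g₀) :
    ContMDiffAt 𝓘(ℝ, EuclideanSpace ℝ (Fin 6)) (𝓡 6) ∞ (S.param g₀) x :=
  ContMDiffAt.comp (g := S.prodParam g₀) x (S.contMDiffAt_prodParam g₀ hx.1 hx.2)
    prodEquiv.contDiff.contMDiff.contMDiffAt

theorem dmap_param_basisFun [IsManifold (𝓡 6) ∞ P] {W : DiffForm 6 P ℍ[ℝ] 1}
    (hW : B.IsConnection W) {x : EuclideanSpace ℝ (Fin 6)} (hx : x ∈ S.paramDom g₀) (i : Fin 6) :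
    dmap (S.param g₀) x (EuclideanSpace.basisFun (Fin 6) ℝ i) =
      S.adaptedBasis hW hx.2 ((extChartAt (𝓡 3) g₀).symm (prodEquiv x).1)
        (chartBasis g₀ hx.1) i := by
  have hd := (S.contMDiffAt_prodParam g₀ hx.1 hx.2).mdifferentiableAt
    (by simp : (∞ : WithTop ℕ∞) ≠ 0)
  have h := dmap_comp (n := 6) (f := S.prodParam g₀) (g := prodEquiv) (y := x) hd
    prodEquiv.differentiable.differentiableAt (EuclideanSpace.basisFun (Fin 6) ℝ i)
  rw [ContinuousLinearEquiv.fderiv] at h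
  refine h.trans ((S.dmap_prodParam g₀ hx.1 hx.2 _).trans ?_)
  refine Fin.addCases (m := 3) (n := 3) (motive := fun i : Fin (3 + 3) =>
    S.adaptedMap (prodEquiv x).2 ((extChartAt (𝓡 3) g₀).symm (prodEquiv x).1)
      (dmap (n := 3) (extChartAt (𝓡 3) g₀).symm (prodEquiv x).1
        (prodEquiv (EuclideanSpace.basisFun (Fin 6) ℝ i)).1,
        (prodEquiv (EuclideanSpace.basisFun (Fin 6) ℝ i)).2) =
      S.adaptedBasis hW hx.2 ((extChartAt (𝓡 3) g₀).symm (prodEquiv x).1)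
        (chartBasis g₀ hx.1) i) (fun a => ?_) (fun a => ?_) i
  · rw [adaptedBasis_castAdd, adaptedMap_apply, prodEquiv_castAdd, chartBasis_apply, map_zero,
      map_zero, add_zero]
  · rw [adaptedBasis_natAdd, adaptedMap_apply, prodEquiv_natAdd, map_zero, map_zero, zero_add, vec]

theorem param_proj {x : EuclideanSpace ℝ (Fin 6)} (hx : x ∈ S.paramDom g₀) :
    B.proj (S.param g₀ x) = S.chart.symm (prodEquiv x).2 :=
  (B.proj_act _ _).trans (S.proj_sec _ hx.2)

theorem param_grp {x : EuclideanSpace ℝ (Fin 6)} (hx : x ∈ S.paramDom g₀) :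
    S.grp (S.param g₀ x) = (extChartAt (𝓡 3) g₀).symm (prodEquiv x).1 :=
  S.grp_act _ hx.2 _

theorem injOn_param : Set.InjOn (S.param g₀) (S.paramDom g₀) := by
  intro x hx x' hx' h
  apply prodEquiv.injective
  have h1 := congrArg B.proj h
  have h2 := congrArg S.grp h
  rw [S.param_proj g₀ hx, S.param_proj g₀ hx'] at h1
  rw [S.param_grp g₀ hx, S.param_grp g₀ hx'] at h2
  exact Prod.ext ((extChartAt (𝓡 3) g₀).symm.injOn hx.1 hx'.1 h2)
    (S.chart.symm.injOn (S.dom_subset hx.2) (S.dom_subset hx'.2) h1)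

theorem exists_param_eq {p : P} (hp : B.proj p ∈ S.base)
    (hg : S.grp p ∈ (extChartAt (𝓡 3) g₀).source) : ∃ x ∈ S.paramDom g₀, S.param g₀ x = p := by
  refine ⟨prodEquiv.symm (extChartAt (𝓡 3) g₀ (S.grp p), S.coord p), ?_, ?_⟩
  · rw [paramDom, Set.mem_preimage, ContinuousLinearEquiv.apply_symm_apply]
    exact ⟨(extChartAt (𝓡 3) g₀).map_source hg, S.coord_mem hp⟩
  · rw [param, ContinuousLinearEquiv.apply_symm_apply]
    change B.act (S.sec (S.coord p)) ((extChartAt (𝓡 3) g₀).symm (extChartAt (𝓡 3) g₀ (S.grp p))) = p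
    rw [(extChartAt (𝓡 3) g₀).left_inv hg, S.act_sec_coord hp]

end LocalSection

/-- The density of the Hitchin volume form of the Chern-Simons form. -/
def totalDensity (v : DiffForm 6 P ℝ 6) (W : DiffForm 6 P ℍ[ℝ] 1) (p : P)
    (X : Fin 6 → EuclideanSpace ℝ (Fin 6)) : ℝ :=
  |hitchinVolumeForm v (chernSimons W) p X|

theorem isDensity_totalDensity (v : DiffForm 6 P ℝ 6) (W : DiffForm 6 P ℍ[ℝ] 1) (p : P) :
    IsDensity (totalDensity v W p) :=
  isDensity_abs (n := 6) (hitchinVolumeForm v (chernSimons W) p).toAlternatingMap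

namespace LocalSection

variable (S : LocalSection B) (g₀ : SU2)

/-- The value of `v` on the basis cancels between `√(-λ)` and `v`. The constants agree because `4² ·
8² / 8 = 128`. -/
theorem totalDensity_param [IsManifold (𝓡 6) ∞ P] {v : DiffForm 6 P ℝ 6} (hv : ∀ p, v p ≠ 0)
    {W : DiffForm 6 P ℍ[ℝ] 1} (hW : B.IsNegativeDefinite v W) {x : EuclideanSpace ℝ (Fin 6)}
    (hx : x ∈ S.paramDom g₀) :
    (totalDensity v W (S.param g₀ x) fun i =>
      dmap (S.param g₀) x (EuclideanSpace.basisFun (Fin 6) ℝ i)) =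
      fibreFun g₀ (prodEquiv x).1 * S.baseFun W (prodEquiv x).2 := by
  set z := (prodEquiv x).1
  set y := (prodEquiv x).2
  have hy : y ∈ S.dom := hx.2
  set g := (extChartAt (𝓡 3) g₀).symm z
  set b := S.adaptedBasis hW.1 hx.2 g (chartBasis g₀ hx.1)
  refine (congrArg (totalDensity v W (S.param g₀ x))
    (funext fun i => S.dmap_param_basisFun g₀ hW.1 hx i)).trans ?_
  have hl := S.lambdaAt_act_sec hW.1 v hx.2 g (chartBasis g₀ hx.1)
  have hc : v (B.act (S.sec y) g) b ≠ 0 := by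
    intro h
    apply hv (B.act (S.sec y) g)
    apply ContinuousAlternatingMap.toAlternatingMap_injective
    refine (AlternatingMap.eq_smul_basis_det b _).trans ?_
    refine (congrArg (· • _) h).trans ?_
    rw [zero_smul]
    rfl
  have hm := S.det_curvMatrix_pos hW hy
  have hd : (maurerCartanMatrix g (chartBasis g₀ hx.1)).det =
      (maurerCartanMatrix g fun i =>
        dmap (n := 3) (extChartAt (𝓡 3) g₀).symm z (EuclideanSpace.basisFun (Fin 3) ℝ i)).det :=
    congrArg (fun Z => (maurerCartanMatrix g Z).det) (funext fun i => chartBasis_apply g₀ hx.1 i)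
  set d := (maurerCartanMatrix g (chartBasis g₀ hx.1)).det
  have hf : fibreFun g₀ z = 4 * |d| := by rw [hd]; rfl
  set c := v (B.act (S.sec y) g) b with hcdef
  have hs : √((S.curvMatrix W y).det / 8) ^ 2 = (S.curvMatrix W y).det / 8 :=
    Real.sq_sqrt (by positivity)
  have h1 : -lambdaAt v (chernSimons W) (B.act (S.sec y) g) =
      (4 * |d| * (8 * √((S.curvMatrix W y).det / 8)) / |c|) ^ 2 := by
    rw [hl, div_pow, mul_pow, mul_pow, mul_pow, hs, sq_abs, sq_abs]
    ring
  change |√(-lambdaAt v (chernSimons W) (B.act (S.sec y) g)) * c| = _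
  rw [h1, Real.sqrt_sq (by positivity), hf, baseFun, abs_mul, abs_of_nonneg (by positivity)]
  have := abs_pos.2 hc
  field_simp

variable [MeasurableSpace M] [BorelSpace M]

theorem measurableSet_piece [MeasurableSpace P] [BorelSpace P] {U : Set M} (hU : MeasurableSet U)
    (hUS : U ⊆ S.base) {G : Set SU2} (hG : MeasurableSet G) :
    MeasurableSet (S.grp ⁻¹' G ∩ B.proj ⁻¹' U) := by
  have ho : IsOpen (B.proj ⁻¹' S.base) := S.isOpen_base.preimage B.contMDiff_proj.continuous
  have hc : ContinuousOn S.grp (B.proj ⁻¹' S.base) := fun p hp =>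
    (S.smooth_grp p hp.1 hp.2).continuousAt.continuousWithinAt
  have h := (measurableSet_inter_preimage ho hc hG).inter
    (B.contMDiff_proj.continuous.measurable hU)
  convert h using 1
  ext p
  exact ⟨fun h => ⟨⟨hUS h.2, h.1⟩, h.2⟩, fun h => ⟨h.1.2, h.2⟩⟩

/-- Tonelli's theorem: in the parametrisation the piece is a product set and the density is a
product of functions of separate variables. -/
theorem totalMeasure_piece [IsManifold (𝓡 6) ∞ P] [SecondCountableTopology M]
    [SecondCountableTopology P] [MeasurableSpace P]
    [BorelSpace P] {vM : DiffForm 3 M ℝ 3} (hvM : ∀ x, vM x ≠ 0) {v : DiffForm 6 P ℝ 6}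
    (hv : ∀ p, v p ≠ 0) {W : DiffForm 6 P ℍ[ℝ] 1} (hW : B.IsNegativeDefinite v W)
    {U : Set M} (hU : MeasurableSet U) (hUS : U ⊆ S.base) {G : Set SU2} (hG : MeasurableSet G)
    (hGs : G ⊆ (extChartAt (𝓡 3) g₀).source) :
    densityMeasure (n := 6) (totalDensity v W) (S.grp ⁻¹' G ∩ B.proj ⁻¹' U) =
      fibreMeasure G * B.baseVolume vM W U := by
  set A := S.grp ⁻¹' G ∩ B.proj ⁻¹' U
  have hA : MeasurableSet A := S.measurableSet_piece hU hUS hG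
  have hpc : ContinuousOn (S.param g₀) (S.paramDom g₀) := fun x hx =>
    (S.contMDiffAt_param g₀ hx).continuousAt.continuousWithinAt
  set TG := (extChartAt (𝓡 3) g₀).target ∩ (extChartAt (𝓡 3) g₀).symm ⁻¹' G
  set TU := S.dom ∩ S.chart.symm ⁻¹' U
  have hcs : ContinuousOn S.chart.symm S.dom := fun y hy =>
    (contMDiffAt_chart_symm S.center (S.dom_subset hy)).continuousAt.continuousWithinAt
  have hTG : MeasurableSet TG := measurableSet_inter_preimage (isOpen_extChartAt_target g₀)
    (continuousOn_extChartAt_symm g₀) hG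
  have hTU : MeasurableSet TU := measurableSet_inter_preimage S.isOpen_dom hcs hU
  have hset : S.paramDom g₀ ∩ S.param g₀ ⁻¹' A = prodEquiv ⁻¹' (TG ×ˢ TU) := by
    ext x
    constructor
    · rintro ⟨hx, h1, h2⟩
      rw [Set.mem_preimage, S.param_grp g₀ hx] at h1
      rw [Set.mem_preimage, S.param_proj g₀ hx] at h2
      exact ⟨⟨hx.1, h1⟩, ⟨hx.2, h2⟩⟩
    · rintro ⟨⟨h1, h2⟩, h3, h4⟩
      have hx : x ∈ S.paramDom g₀ := ⟨h1, h3⟩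
      refine ⟨hx, ?_, ?_⟩
      · rw [Set.mem_preimage, S.param_grp g₀ hx]; exact h2
      · rw [Set.mem_preimage, S.param_proj g₀ hx]; exact h4
  have hfm : AEMeasurable (fun z => ENNReal.ofReal (fibreFun g₀ z)) (volume.restrict TG) :=
    (((continuousOn_fibreFun g₀).mono Set.inter_subset_left).aemeasurable hTG).ennreal_ofReal
  have hbm : AEMeasurable (fun y => ENNReal.ofReal (S.baseFun W y)) (volume.restrict TU) := by
    refine (ContinuousOn.aemeasurable (fun y hy => ?_) hTU).ennreal_ofReal
    refine ContinuousAt.continuousWithinAt ?_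
    exact continuousAt_const.mul (((contDiffAt_det (S.contDiffAt_curvMatrix hW.1.smooth
      hy.1)).continuousAt.div_const 8).sqrt)
  calc densityMeasure (n := 6) (totalDensity v W) A
      = paramMeasure (n := 6) (totalDensity v W) (S.param g₀) (S.paramDom g₀) A :=
        densityMeasure_eq_paramMeasure (n := 6) (totalDensity v W) (S.isOpen_paramDom g₀)
          (fun x hx => S.contMDiffAt_param g₀ hx) (S.injOn_param g₀) hA
          (fun p hp => S.exists_param_eq g₀ (hUS hp.2) (hGs hp.1))
          fun p _ => isDensity_totalDensity v W p
    _ = ∫⁻ x in S.paramDom g₀ ∩ S.param g₀ ⁻¹' A, ENNReal.ofReal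
          (totalDensity v W (S.param g₀ x) fun i =>
            dmap (S.param g₀) x (EuclideanSpace.basisFun (Fin 6) ℝ i)) :=
        paramMeasure_apply (n := 6) (totalDensity v W) (S.isOpen_paramDom g₀) hpc hA
    _ = ∫⁻ x in prodEquiv ⁻¹' (TG ×ˢ TU), (fun w : EuclideanSpace ℝ (Fin 3) ×
          EuclideanSpace ℝ (Fin 3) => ENNReal.ofReal (fibreFun g₀ w.1) *
            ENNReal.ofReal (S.baseFun W w.2)) (prodEquiv x) := by
        rw [hset]
        refine setLIntegral_congr_fun ((hTG.prod hTU).preimage prodEquiv.continuous.measurable)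
          fun x hx => ?_
        have hx' : x ∈ S.paramDom g₀ := ⟨hx.1.1, hx.2.1⟩
        refine (congrArg ENNReal.ofReal (S.totalDensity_param g₀ hv hW hx')).trans ?_
        exact ENNReal.ofReal_mul (fibreFun_pos g₀ hx'.1).le
    _ = ∫⁻ w in TG ×ˢ TU, ENNReal.ofReal (fibreFun g₀ w.1) * ENNReal.ofReal (S.baseFun W w.2) :=
        measurePreserving_prodEquiv.setLIntegral_comp_preimage_emb
          prodEquiv.toHomeomorph.measurableEmbedding
          (fun w => ENNReal.ofReal (fibreFun g₀ w.1) * ENNReal.ofReal (S.baseFun W w.2)) (TG ×ˢ TU)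
    _ = fibreMeasure G * B.baseVolume vM W U := by
        rw [Measure.volume_eq_prod, ← Measure.prod_restrict, lintegral_prod_mul hfm hbm,
          fibreMeasure_eq g₀ hG hGs, S.baseVolume_eq hvM hW.1 hU hUS
            fun y hy => S.det_curvMatrix_pos hW hy.1]

/-- For fixed `U` both sides are total masses of measures on the group. These agree on Borel subsets
of each chart, and countably many charts cover. -/
theorem totalMeasure_base [IsManifold (𝓡 6) ∞ P] [SecondCountableTopology M]
    [SecondCountableTopology P] [MeasurableSpace P]
    [BorelSpace P] {vM : DiffForm 3 M ℝ 3} (hvM : ∀ x, vM x ≠ 0) {v : DiffForm 6 P ℝ 6}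
    (hv : ∀ p, v p ≠ 0) {W : DiffForm 6 P ℍ[ℝ] 1} (hW : B.IsNegativeDefinite v W)
    {U : Set M} (hU : MeasurableSet U) (hUS : U ⊆ S.base) :
    densityMeasure (n := 6) (totalDensity v W) (B.proj ⁻¹' U) =
      fibreVolume * B.baseVolume vM W U := by
  set μ := densityMeasure (n := 6) (totalDensity v W)
  have hU' : MeasurableSet (B.proj ⁻¹' U) := B.contMDiff_proj.continuous.measurable hU
  have hc : AEMeasurable S.grp (μ.restrict (B.proj ⁻¹' U)) :=
    ContinuousOn.aemeasurable (fun p hp => (S.smooth_grp p (hUS hp).1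
      (hUS hp).2).continuousAt.continuousWithinAt) hU'
  obtain ⟨s, hs, hcov⟩ := TopologicalSpace.countable_cover_nhds fun g : SU2 =>
    extChartAt_source_mem_nhds (I := 𝓡 3) g
  have := hs.to_subtype
  have hUn : (⋃ g : s, (extChartAt (𝓡 3) (g : SU2)).source) = Set.univ := by
    rw [Set.iUnion_coe_set, hcov]
  have key : (Measure.map S.grp (μ.restrict (B.proj ⁻¹' U))).restrict
      (⋃ g : s, (extChartAt (𝓡 3) (g : SU2)).source) =
      (B.baseVolume vM W U • fibreMeasure).restrict
        (⋃ g : s, (extChartAt (𝓡 3) (g : SU2)).source) := by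
    rw [Measure.restrict_iUnion_congr]
    intro g
    ext G hG
    have hG' := hG.inter (isOpen_extChartAt_source (I := 𝓡 3) (g : SU2)).measurableSet
    rw [Measure.restrict_apply hG, Measure.restrict_apply hG,
      Measure.map_apply_of_aemeasurable hc hG', Measure.restrict_apply' hU',
      S.totalMeasure_piece g hvM hv hW hU hUS hG' Set.inter_subset_right, Measure.smul_apply,
      smul_eq_mul, mul_comm]
  rw [hUn, Measure.restrict_univ, Measure.restrict_univ] at key
  have h := congrArg (fun ν => ν Set.univ) key
  rw [Measure.map_apply_of_aemeasurable hc MeasurableSet.univ, Set.preimage_univ,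
    Measure.restrict_apply_univ, Measure.smul_apply, smul_eq_mul, mul_comm, ← fibreVolume_eq] at h
  exact h

end LocalSection

variable (B) in
theorem exists_countable_sections [SecondCountableTopology M] :
    ∃ s : Set (LocalSection B), s.Countable ∧ ⋃ S ∈ s, S.base = Set.univ := by
  have h : ∀ x : M, ∃ S : LocalSection B, x ∈ S.base := by
    intro x
    obtain ⟨p, rfl⟩ := B.proj_surjective x
    obtain ⟨S, -, hb, -⟩ := B.exists_localSection p
    exact ⟨S, hb⟩
  choose S hS using h
  obtain ⟨t, ht, hcov⟩ := TopologicalSpace.countable_cover_nhds fun x : M =>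
    (S x).isOpen_base.mem_nhds (hS x)
  refine ⟨S '' t, ht.image S, ?_⟩
  rw [Set.biUnion_image, hcov]

/-- The same gluing on the base: the pushforward of the total measure and the scaled base volume
agree over each of countably many sections. No finiteness is needed, so the identity holds in `[0,
∞]`. -/
theorem hitchinFunctional_chernSimons [IsManifold (𝓡 6) ∞ P] [SecondCountableTopology M]
    [MeasurableSpace M] [BorelSpace M] [SecondCountableTopology P] [MeasurableSpace P]
    [BorelSpace P] {vM : DiffForm 3 M ℝ 3} (hvM : ∀ x, vM x ≠ 0) {v : DiffForm 6 P ℝ 6}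
    (hv : ∀ p, v p ≠ 0) {W : DiffForm 6 P ℍ[ℝ] 1} (hW : B.IsNegativeDefinite v W) :
    hitchinFunctional v (chernSimons W) = fibreVolume * B.baseVolume vM W Set.univ := by
  set μ := densityMeasure (n := 6) (totalDensity v W)
  obtain ⟨s, hs, hcov⟩ := B.exists_countable_sections
  have := hs.to_subtype
  have hUn : (⋃ S : s, (S : LocalSection B).base) = Set.univ := by
    rw [Set.iUnion_coe_set, hcov]
  have hp := B.contMDiff_proj.continuous.measurable
  have key : (Measure.map B.proj μ).restrict (⋃ S : s, (S : LocalSection B).base) =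
      (fibreVolume • B.baseVolume vM W).restrict (⋃ S : s, (S : LocalSection B).base) := by
    rw [Measure.restrict_iUnion_congr]
    intro S
    ext U hU
    have hU' := hU.inter (S : LocalSection B).isOpen_base.measurableSet
    rw [Measure.restrict_apply hU, Measure.restrict_apply hU, Measure.map_apply hp hU',
      (S : LocalSection B).totalMeasure_base hvM hv hW hU' Set.inter_subset_right,
      Measure.smul_apply, smul_eq_mul]
  rw [hUn, Measure.restrict_univ, Measure.restrict_univ] at key
  have h := congrArg (fun ν => ν Set.univ) key
  rw [Measure.map_apply hp MeasurableSet.univ, Set.preimage_univ, Measure.smul_apply,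
    smul_eq_mul] at h
  exact h

end PrincipalSU2Bundle

/-! ### First variation of the volume in a section -/

section DetDerivative

/-- Jacobi's formula, by expanding the 3 × 3 determinant. -/
theorem hasDerivAt_det {m : ℝ → Matrix (Fin 3) (Fin 3) ℝ} {m' : Matrix (Fin 3) (Fin 3) ℝ} {t : ℝ}
    (h : ∀ a c, HasDerivAt (fun t => m t a c) (m' a c) t) :
    HasDerivAt (fun t => (m t).det) ((m t).adjugate * m').trace t := by
  simp only [Matrix.det_fin_three]
  have h1 : ∀ a b c d e f : Fin 3, HasDerivAt (fun t => m t a b * m t c d * m t e f)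
      ((m' a b * m t c d + m t a b * m' c d) * m t e f + m t a b * m t c d * m' e f) t :=
    fun a b c d e f => ((h a b).fun_mul (h c d)).fun_mul (h e f)
  refine ((((((h1 0 0 1 1 2 2).fun_sub (h1 0 0 1 2 2 1)).fun_sub (h1 0 1 1 0 2 2)).fun_add
    (h1 0 1 1 2 2 0)).fun_add (h1 0 2 1 0 2 1)).fun_sub (h1 0 2 1 1 2 0)).congr_deriv ?_
  rw [Matrix.adjugate_fin_three]
  simp only [Matrix.trace, Matrix.diag_apply, Matrix.mul_apply, Fin.sum_univ_three]
  simp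
  ring

theorem hasDerivAt_sqrt_det {m : ℝ → Matrix (Fin 3) (Fin 3) ℝ} {m' : Matrix (Fin 3) (Fin 3) ℝ}
    {t : ℝ} (h : ∀ a c, HasDerivAt (fun t => m t a c) (m' a c) t) (hm : 0 < (m t).det) :
    HasDerivAt (fun t => 8 * √((m t).det / 8))
      (((m t).adjugate * m').trace / (2 * √((m t).det / 8))) t := by
  have h1 := (((hasDerivAt_det h).div_const 8).sqrt (by positivity)).const_mul 8
  refine h1.congr_deriv ?_
  have : 0 < √((m t).det / 8) := by positivity
  field_simp

end DetDerivative

namespace PrincipalSU2Bundle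

variable {M P : Type*} [TopologicalSpace M] [ChartedSpace (EuclideanSpace ℝ (Fin 3)) M]
  [TopologicalSpace P] [ChartedSpace (EuclideanSpace ℝ (Fin 6)) P] {B : PrincipalSU2Bundle M P}
  [IsManifold (𝓡 3) ∞ M] [IsManifold (𝓡 6) ∞ P]

theorem re_covD {W A : DiffForm 6 P ℍ[ℝ] 1} (hA : IsSmoothForm A)
    (hr : IsLieValued A) (p : P) (X Y : EuclideanSpace ℝ (Fin 6)) :
    (covD W A p ![X, Y]).re = 0 := by
  have h : ∀ a b : ℍ[ℝ], (a * b).re = (b * a).re := by intro a b; simp; ring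
  rw [covD_apply, Quaternion.re_add, Quaternion.re_add, re_extD hA hr, Quaternion.re_sub,
    Quaternion.re_sub, h (A p ![X]), h (A p ![Y])]
  ring

theorem covD_add {W A A' : DiffForm 6 P ℍ[ℝ] 1} (hA : IsSmoothForm A) (hA' : IsSmoothForm A')
    (p : P) : covD W (A + A') p = covD W A p + covD W A' p := by
  have h : ((A + A') p).toAlternatingMap = (A p).toAlternatingMap + (A' p).toAlternatingMap := rfl
  rw [covD, covD, covD, extD_add hA hA', h, wedge_add_left, wedge_add_right]
  change (extD A p).toAlternatingMap + (extD A' p).toAlternatingMap + _ + _ = _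
  abel

/-- Locality of the covariant derivative; it discards the part of a compact set away from the
support of a variation. -/
theorem covD_eq_zero_of_eventually {W A : DiffForm 6 P ℍ[ℝ] 1} {p : P}
    (h : ∀ᶠ q in 𝓝 p, A q = 0) : covD W A p = 0 := by
  have h1 : extD A p = 0 := by
    have h2 : chartRep A p =ᶠ[𝓝 (extChartAt (𝓡 6) p p)] fun _ => 0 := by
      have hc := (contMDiffAt_chart_symm p (mem_extChartAt_target (I := 𝓡 6) p)).continuousAt
      have h' : ∀ᶠ q in 𝓝 ((extChartAt (𝓡 6) p).symm (extChartAt (𝓡 6) p p)), A q = 0 := by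
        rwa [chart_symm_self]
      filter_upwards [hc.eventually h'] with y hy
      rw [chartRep, hy]
      rfl
    have h3 := h2.extDeriv_eq
    have h4 : extDeriv (fun _ : EuclideanSpace ℝ (Fin 6) =>
        (0 : EuclideanSpace ℝ (Fin 6) [⋀^Fin 1]→L[ℝ] ℍ[ℝ])) (extChartAt (𝓡 6) p p) = 0 := by
      have := extDeriv_smul (𝕜 := ℝ) (0 : ℝ) (fun _ : EuclideanSpace ℝ (Fin 6) =>
        (0 : EuclideanSpace ℝ (Fin 6) [⋀^Fin 1]→L[ℝ] ℍ[ℝ])) (x := extChartAt (𝓡 6) p p)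
      rw [zero_smul, zero_smul] at this
      exact this
    exact h3.trans h4
  have h5 : (A p).toAlternatingMap = (0 : ℝ) • (A p).toAlternatingMap := by
    rw [h.self_of_nhds, zero_smul]; rfl
  rw [covD, h1, h5, wedge_smul_right, wedge_smul_left, zero_smul, zero_smul]
  rw [add_zero, add_zero]
  rfl

namespace LocalSection

variable (S : LocalSection B)

/-- The components of the covariant derivative in a section. -/
def covMatrix (W A : DiffForm 6 P ℍ[ℝ] 1) (y : EuclideanSpace ℝ (Fin 3)) :
    Matrix (Fin 3) (Fin 3) ℝ :=
  twoFormMatrix (V := EuclideanSpace ℝ (Fin 6)) (covD W A (S.sec y)) (S.vec y)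

/-- The components of `A ∧ A` in a section. -/
def sqMatrix (A : DiffForm 6 P ℍ[ℝ] 1) (y : EuclideanSpace ℝ (Fin 3)) :
    Matrix (Fin 3) (Fin 3) ℝ :=
  Matrix.of fun a c => im (A (S.sec y) ![S.vec y (c + 1)] * A (S.sec y) ![S.vec y (c + 2)] -
    A (S.sec y) ![S.vec y (c + 2)] * A (S.sec y) ![S.vec y (c + 1)]) a

theorem curvMatrix_add_smul {W A : DiffForm 6 P ℍ[ℝ] 1} (hW : IsSmoothForm W)
    (hA : IsSmoothForm A) (t : ℝ) (y : EuclideanSpace ℝ (Fin 3)) (a c : Fin 3) :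
    S.curvMatrix (W + t • A) y a c =
      S.curvMatrix W y a c + t * S.covMatrix W A y a c + t ^ 2 * S.sqMatrix A y a c := by
  have h := congrArg (fun q => im q a)
    (curvature_add_smul hW hA t (S.sec y) (S.vec y (c + 1)) (S.vec y (c + 2)))
  simp only [map_add, map_smul, Pi.add_apply, Pi.smul_apply, smul_eq_mul] at h
  exact h

theorem contDiffAt_covMatrix {W A : DiffForm 6 P ℍ[ℝ] 1} (hW : IsSmoothForm W)
    (hA : IsSmoothForm A) {y : EuclideanSpace ℝ (Fin 3)} (hy : y ∈ S.dom) (a c : Fin 3) :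
    ContDiffAt ℝ ∞ (fun y => S.covMatrix W A y a c) y := by
  set u := EuclideanSpace.basisFun (Fin 3) ℝ (c + 1)
  set v := EuclideanSpace.basisFun (Fin 3) ℝ (c + 2)
  have h1 : (fun y => S.covMatrix W A y a c) =ᶠ[𝓝 y] fun y => imCLM a
      (fderiv ℝ (pull A S.sec) y u v - fderiv ℝ (pull A S.sec) y v u +
        (pull W S.sec y u * pull A S.sec y v - pull W S.sec y v * pull A S.sec y u) +
        (pull A S.sec y u * pull W S.sec y v - pull A S.sec y v * pull W S.sec y u)) := by
    filter_upwards [S.isOpen_dom.mem_nhds hy] with z hz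
    rw [← S.covD_sec W hA hz]
    rfl
  refine ContDiffAt.congr_of_eventuallyEq ?_ h1
  have h2 := contDiffAt_pull hW (S.smooth_sec y hy)
  have h3 := contDiffAt_pull hA (S.smooth_sec y hy)
  have h4 : ContDiffAt ℝ ∞ (fderiv ℝ (pull A S.sec)) y := h3.fderiv_right (by simp)
  refine (imCLM a).contDiff.contDiffAt.comp y ?_
  fun_prop

theorem contDiffAt_sqMatrix {A : DiffForm 6 P ℍ[ℝ] 1}
    (hA : IsSmoothForm A) {y : EuclideanSpace ℝ (Fin 3)} (hy : y ∈ S.dom) (a c : Fin 3) :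
    ContDiffAt ℝ ∞ (fun y => S.sqMatrix A y a c) y := by
  set u := EuclideanSpace.basisFun (Fin 3) ℝ (c + 1)
  set v := EuclideanSpace.basisFun (Fin 3) ℝ (c + 2)
  have h1 : (fun y => S.sqMatrix A y a c) = fun y => imCLM a
      (pull A S.sec y u * pull A S.sec y v - pull A S.sec y v * pull A S.sec y u) := by
    funext z
    rw [pull_apply, pull_apply]
    rfl
  rw [h1]
  have h3 := contDiffAt_pull hA (S.smooth_sec y hy)
  refine (imCLM a).contDiff.contDiffAt.comp y ?_
  fun_prop

/-- The first variation of the volume density. -/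
def variationFun (W A : DiffForm 6 P ℍ[ℝ] 1) (y : EuclideanSpace ℝ (Fin 3)) : ℝ :=
  ((S.curvMatrix W y).adjugate * S.covMatrix W A y).trace / (2 * √((S.curvMatrix W y).det / 8))

theorem continuousAt_variationFun {v : DiffForm 6 P ℝ 6} {W A : DiffForm 6 P ℍ[ℝ] 1}
    (hW : B.IsNegativeDefinite v W) (hA : IsSmoothForm A) {y : EuclideanSpace ℝ (Fin 3)}
    (hy : y ∈ S.dom) : ContinuousAt (S.variationFun W A) y := by
  have h1 := S.contDiffAt_curvMatrix hW.1.smooth hy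
  have h2 := fun a c => (S.contDiffAt_covMatrix hW.1.smooth hA hy a c).continuousAt
  have h3 := fun a c => (contDiffAt_adjugate h1 a c).continuousAt
  have h4 := S.det_curvMatrix_pos hW hy
  refine ContinuousAt.div ?_ (continuousAt_const.mul
    ((contDiffAt_det h1).continuousAt.div_const 8).sqrt) (by positivity)
  simp only [Matrix.trace, Matrix.diag_apply, Matrix.mul_apply, Fin.sum_univ_three]
  fun_prop

theorem variationFun_add {W A A' : DiffForm 6 P ℍ[ℝ] 1} (hA : IsSmoothForm A)
    (hA' : IsSmoothForm A') (y : EuclideanSpace ℝ (Fin 3)) :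
    S.variationFun W (A + A') y = S.variationFun W A y + S.variationFun W A' y := by
  have h : S.covMatrix W (A + A') y = S.covMatrix W A y + S.covMatrix W A' y := by
    ext a c
    exact congrFun ((congrArg (fun D : EuclideanSpace ℝ (Fin 6) [⋀^Fin 2]→ₗ[ℝ] ℍ[ℝ] =>
      im (D ![S.vec y (c + 1), S.vec y (c + 2)])) (covD_add hA hA' (S.sec y))).trans
      (map_add im _ _)) a
  rw [variationFun, h, mul_add, Matrix.trace_add, add_div]
  rfl

theorem variationFun_eq_zero {W A : DiffForm 6 P ℍ[ℝ] 1} {y : EuclideanSpace ℝ (Fin 3)}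
    (h : covD W A (S.sec y) = 0) : S.variationFun W A y = 0 := by
  have h1 : S.covMatrix W A y = 0 := by
    ext a c
    change im (covD W A (S.sec y) _) a = 0
    rw [h]
    exact congrFun (map_zero im) a
  rw [variationFun, h1, mul_zero, Matrix.trace_zero, zero_div]

/-- The coordinate domain of a subset of the base. -/
def coordSet (U : Set M) : Set (EuclideanSpace ℝ (Fin 3)) := S.dom ∩ S.chart.symm ⁻¹' U

theorem continuousOn_chart_symm : ContinuousOn S.chart.symm S.dom := fun _ hy =>
  (contMDiffAt_chart_symm S.center (S.dom_subset hy)).continuousAt.continuousWithinAt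

theorem coordSet_eq_image {U : Set M} (hU : U ⊆ S.base) : S.coordSet U = S.chart '' U := by
  ext y
  constructor
  · rintro ⟨hy, h⟩
    exact ⟨_, h, S.chart.right_inv (S.dom_subset hy)⟩
  · rintro ⟨x, hx, rfl⟩
    refine ⟨(hU hx).2, ?_⟩
    rw [Set.mem_preimage, S.chart.left_inv (hU hx).1]
    exact hx

theorem isCompact_coordSet {C : Set M} (hC : IsCompact C) (hCS : C ⊆ S.base) :
    IsCompact (S.coordSet C) := by
  rw [S.coordSet_eq_image hCS]
  exact hC.image_of_continuousOn ((continuousOn_extChartAt S.center).mono fun x hx => (hCS hx).1)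

theorem measurableSet_coordSet [MeasurableSpace M] [BorelSpace M] {U : Set M}
    (hU : MeasurableSet U) : MeasurableSet (S.coordSet U) :=
  measurableSet_inter_preimage S.isOpen_dom S.continuousOn_chart_symm hU

theorem integrableOn_variationFun {v : DiffForm 6 P ℝ 6} {W A : DiffForm 6 P ℍ[ℝ] 1}
    (hW : B.IsNegativeDefinite v W) (hA : IsSmoothForm A) {C U : Set M} (hC : IsCompact C)
    (hCS : C ⊆ S.base) (hUC : U ⊆ C) : IntegrableOn (S.variationFun W A) (S.coordSet U) := by
  refine IntegrableOn.mono_set ?_ (show S.coordSet U ⊆ S.coordSet C from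
    fun y hy => ⟨hy.1, hUC hy.2⟩)
  exact ContinuousOn.integrableOn_compact (S.isCompact_coordSet hC hCS) fun y hy =>
    (S.continuousAt_variationFun hW hA hy.1).continuousWithinAt

/-- The first variation of the volume of a set in the domain of a section. -/
theorem hasDerivAt_baseVolume [SecondCountableTopology M] [MeasurableSpace M] [BorelSpace M]
    {vM : DiffForm 3 M ℝ 3} (hvM : ∀ x, vM x ≠ 0) {v : DiffForm 6 P ℝ 6}
    {W A : DiffForm 6 P ℍ[ℝ] 1} (hW : B.IsNegativeDefinite v W) (hA : B.IsVariation A) {C U : Set M}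
    (hC : IsCompact C) (hCS : C ⊆ S.base) (hUC : U ⊆ C) (hU : MeasurableSet U) :
    (∀ᶠ t in 𝓝 (0 : ℝ), B.baseVolume vM (W + t • A) U < ⊤) ∧
    HasDerivAt (fun t : ℝ => (B.baseVolume vM (W + t • A) U).toReal)
      (∫ y in S.coordSet U, S.variationFun W A y) 0 := by
  set Q := S.coordSet C with hQ
  have hQc : IsCompact Q := S.isCompact_coordSet hC hCS
  set T := S.coordSet U with hTdef
  have hT : MeasurableSet T := S.measurableSet_coordSet hU
  have hTQ : T ⊆ Q := fun y hy => ⟨hy.1, hUC hy.2⟩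
  let m : ℝ → EuclideanSpace ℝ (Fin 3) → Matrix (Fin 3) (Fin 3) ℝ := fun t y =>
    S.curvMatrix (W + t • A) y
  -- The derivative is kept at every `t`, not only at `0`, because differentiation under the
  -- integral needs a bound on a whole neighbourhood.
  let m' : ℝ → EuclideanSpace ℝ (Fin 3) → Matrix (Fin 3) (Fin 3) ℝ := fun t y =>
    S.covMatrix W A y + (2 * t) • S.sqMatrix A y
  have hme : ∀ t y a c, m t y a c = S.curvMatrix W y a c + t * S.covMatrix W A y a c +
      t ^ 2 * S.sqMatrix A y a c := fun t y a c =>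
    S.curvMatrix_add_smul hW.1.smooth hA.smooth t y a c
  have hm0 : ∀ y, m 0 y = S.curvMatrix W y := fun y => by
    ext a c
    rw [hme]
    ring
  have hmd : ∀ t y a c, HasDerivAt (fun t => m t y a c) (m' t y a c) t := by
    intro t y a c
    simp only [hme]
    refine ((((hasDerivAt_id t).mul_const _).const_add _).fun_add
      ((hasDerivAt_pow 2 t).mul_const (S.sqMatrix A y a c))).congr_deriv ?_
    simp [m']
  have c0 : ∀ y ∈ S.dom, ∀ a c, ContinuousAt (fun y => S.curvMatrix W y a c) y := fun y hy a c =>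
    (S.contDiffAt_curvMatrix hW.1.smooth hy a c).continuousAt
  have c1 : ∀ y ∈ S.dom, ∀ a c, ContinuousAt (fun y => S.covMatrix W A y a c) y := fun y hy a c =>
    (S.contDiffAt_covMatrix hW.1.smooth hA.smooth hy a c).continuousAt
  have c2 : ∀ y ∈ S.dom, ∀ a c, ContinuousAt (fun y => S.sqMatrix A y a c) y := fun y hy a c =>
    (S.contDiffAt_sqMatrix hA.smooth hy a c).continuousAt
  have cs : ∀ {f : EuclideanSpace ℝ (Fin 3) → ℝ} {t : ℝ} {y : EuclideanSpace ℝ (Fin 3)},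
      ContinuousAt f y → ContinuousAt (fun z : ℝ × EuclideanSpace ℝ (Fin 3) => f z.2) (t, y) :=
    fun {f t y} hf => ContinuousAt.comp (g := f) (x := (t, y)) hf continuousAt_snd
  have cm : ∀ t, ∀ y ∈ S.dom, ∀ a c, ContinuousAt
      (fun z : ℝ × EuclideanSpace ℝ (Fin 3) => m z.1 z.2 a c) (t, y) := by
    intro t y hy a c
    simp only [hme]
    exact ((cs (c0 y hy a c)).add (continuousAt_fst.mul (cs (c1 y hy a c)))).add
      ((continuousAt_fst.pow 2).mul (cs (c2 y hy a c)))
  have cm' : ∀ t, ∀ y ∈ S.dom, ∀ a c, ContinuousAt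
      (fun z : ℝ × EuclideanSpace ℝ (Fin 3) => m' z.1 z.2 a c) (t, y) := by
    intro t y hy a c
    exact (cs (c1 y hy a c)).add ((continuousAt_const.mul continuousAt_fst).mul (cs (c2 y hy a c)))
  have cdet : ∀ t, ∀ y ∈ S.dom, ContinuousAt
      (fun z : ℝ × EuclideanSpace ℝ (Fin 3) => (m z.1 z.2).det) (t, y) := by
    intro t y hy
    have := cm t y hy
    simp only [Matrix.det_fin_three]
    fun_prop
  have cadj : ∀ t, ∀ y ∈ S.dom, ∀ a c, ContinuousAt
      (fun z : ℝ × EuclideanSpace ℝ (Fin 3) => (m z.1 z.2).adjugate a c) (t, y) := by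
    intro t y hy a c
    have := cm t y hy
    simp only [Matrix.adjugate_fin_three]
    fin_cases a <;> fin_cases c <;> simp <;> fun_prop
  have ctr : ∀ t, ∀ y ∈ S.dom, ContinuousAt
      (fun z : ℝ × EuclideanSpace ℝ (Fin 3) => ((m z.1 z.2).adjugate * m' z.1 z.2).trace) (t, y) := by
    intro t y hy
    have h1 := cadj t y hy
    have h2 := cm' t y hy
    simp only [Matrix.trace, Matrix.diag_apply, Matrix.mul_apply, Fin.sum_univ_three]
    fun_prop
  -- Positivity at `t = 0` is an open condition in `(t, y)`, and compactness of `Q` makes the range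
  -- of `t` uniform. Only over `Q` is `W + tA` known to have a frame.
  have hpos : ∀ᶠ t in 𝓝 (0 : ℝ), ∀ y ∈ Q, 0 < (m t y).det := by
    refine hQc.eventually_forall_of_forall_eventually fun y hy => ?_
    refine (cdet 0 y hy.1).eventually (lt_mem_nhds ?_)
    change 0 < (m 0 y).det
    rw [hm0]
    exact S.det_curvMatrix_pos hW hy.1
  obtain ⟨δ, hδ, hball⟩ := Metric.nhds_basis_closedBall.eventually_iff.1 hpos
  let F : ℝ → EuclideanSpace ℝ (Fin 3) → ℝ := fun t y => 8 * √((m t y).det / 8)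
  let F' : ℝ → EuclideanSpace ℝ (Fin 3) → ℝ := fun t y =>
    ((m t y).adjugate * m' t y).trace / (2 * √((m t y).det / 8))
  have cF : ∀ t, ContinuousOn (F t) Q := fun t y hy => by
    refine ContinuousAt.continuousWithinAt ?_
    have h : ContinuousAt (fun y => (m t y).det) y :=
      ContinuousAt.comp (f := fun y : EuclideanSpace ℝ (Fin 3) => (t, y))
        (g := fun z : ℝ × EuclideanSpace ℝ (Fin 3) => (m z.1 z.2).det) (cdet t y hy.1)
        (by fun_prop)
    exact continuousAt_const.mul (h.div_const 8).sqrt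
  have cF' : ContinuousOn (fun z : ℝ × EuclideanSpace ℝ (Fin 3) => F' z.1 z.2)
      (Metric.closedBall 0 δ ×ˢ Q) := by
    rintro ⟨t, y⟩ ⟨ht, hy⟩
    refine ContinuousAt.continuousWithinAt ?_
    have h1 := hball ht y hy
    exact (ctr t y hy.1).div (continuousAt_const.mul ((cdet t y hy.1).div_const 8).sqrt)
      (by dsimp only; positivity)
  -- A continuous function on a compact product is bounded; the constant `K` is integrable over `T`,
  -- which has finite volume.
  obtain ⟨K, hK⟩ := ((isCompact_closedBall (0 : ℝ) δ).prod hQc).exists_bound_of_continuousOn cF'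
  have hFi : ∀ t, IntegrableOn (F t) T := fun t =>
    ((cF t).integrableOn_compact hQc).mono_set hTQ
  have hTfin : volume T < ⊤ := (measure_mono hTQ).trans_lt hQc.measure_lt_top
  have hvol : ∀ t ∈ Metric.closedBall (0 : ℝ) δ, B.baseVolume vM (W + t • A) U =
      ∫⁻ y in T, ENNReal.ofReal (F t y) := fun t ht =>
    S.baseVolume_eq hvM (hW.1.add_variation (hA.smul t)) hU (hUC.trans hCS)
      fun y hy => hball ht y (hTQ hy)
  have hmem : Metric.closedBall (0 : ℝ) δ ∈ 𝓝 (0 : ℝ) := Metric.closedBall_mem_nhds 0 hδ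
  have hF0 : ∀ t y, 0 ≤ F t y := fun t y => by positivity
  constructor
  · filter_upwards [hmem] with t ht
    rw [hvol t ht]
    exact (hFi t).lintegral_lt_top
  · have hF'0 : ∀ y, F' 0 y = S.variationFun W A y := by
      intro y
      simp only [F', m', hm0, mul_zero, zero_smul, add_zero]
      rfl
    have h := (hasDerivAt_integral_of_dominated_loc_of_deriv_le (μ := volume.restrict T)
      (F := F) (F' := F') (x₀ := 0) (bound := fun _ => K) hmem
      (Filter.Eventually.of_forall fun t => (hFi t).aestronglyMeasurable) (hFi 0)
      (by
        simp only [funext hF'0]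
        exact (S.integrableOn_variationFun hW hA.smooth hC hCS hUC).aestronglyMeasurable)
      (by
        filter_upwards [ae_restrict_mem hT] with y hy t ht
        exact hK (t, y) ⟨ht, hTQ hy⟩)
      (by
        have : IsFiniteMeasure (volume.restrict T) := ⟨by rwa [Measure.restrict_apply_univ]⟩
        exact integrable_const K)
      (by
        filter_upwards [ae_restrict_mem hT] with y hy t ht
        exact hasDerivAt_sqrt_det (fun a c => hmd t y a c) (hball ht y (hTQ hy)))).2
    simp only [hF'0] at h
    refine h.congr_of_eventuallyEq ?_
    filter_upwards [hmem] with t ht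
    rw [hvol t ht, integral_eq_lintegral_of_nonneg_ae (Filter.Eventually.of_forall (hF0 t))
      (hFi t).aestronglyMeasurable]

end LocalSection

end PrincipalSU2Bundle

/-! ### Integration by parts in a section -/

section StokesAlgebra

/-- The Leibniz rule for `Tr (E ∧ A)` in components. The terms with `w` match by cyclicity of the
real part, and the last sum consists of derivatives of products. -/
theorem re_mul_covariant (e a w : Fin 3 → ℍ[ℝ]) (de da : Fin 3 → Fin 3 → ℍ[ℝ]) :
    ∑ c, (e c * (da (c + 1) (c + 2) - da (c + 2) (c + 1) +
        (w (c + 1) * a (c + 2) - w (c + 2) * a (c + 1)) +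
        (a (c + 1) * w (c + 2) - a (c + 2) * w (c + 1)))).re =
      ∑ k, (a k * (de (k + 1) (k + 2) - de (k + 2) (k + 1) +
        (w (k + 1) * e (k + 2) - w (k + 2) * e (k + 1)) +
        (e (k + 1) * w (k + 2) - e (k + 2) * w (k + 1)))).re +
      ∑ c, ((de (c + 1) c * a (c + 2) + e c * da (c + 1) (c + 2)).re -
        (de (c + 2) c * a (c + 1) + e c * da (c + 2) (c + 1)).re) := by
  have h1 : (1 : Fin 3) + 1 = 2 := rfl
  have h2 : (1 : Fin 3) + 2 = 0 := rfl
  have h3 : (2 : Fin 3) + 1 = 0 := rfl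
  have h4 : (2 : Fin 3) + 2 = 1 := rfl
  have hc : ∀ x y : ℍ[ℝ], (x * y).re = (y * x).re := by intro x y; simp; ring
  have hc3 : ∀ x y z : ℍ[ℝ], (x * (y * z)).re = (y * (z * x)).re := by
    intro x y z; rw [hc, mul_assoc]
  simp only [Fin.sum_univ_three, zero_add, h1, h2, h3, h4, mul_add, mul_sub, Quaternion.re_add,
    Quaternion.re_sub]
  rw [hc3 (a 0) (w 1) (e 2), hc3 (w 1) (e 2), hc3 (a 0) (w 2) (e 1), hc3 (w 2) (e 1),
    hc3 (a 0) (e 1) (w 2), hc3 (a 0) (e 2) (w 1),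
    hc3 (a 1) (w 2) (e 0), hc3 (w 2) (e 0), hc3 (a 1) (w 0) (e 2), hc3 (w 0) (e 2),
    hc3 (a 1) (e 2) (w 0), hc3 (a 1) (e 0) (w 2),
    hc3 (a 2) (w 0) (e 1), hc3 (w 0) (e 1), hc3 (a 2) (w 1) (e 0), hc3 (w 1) (e 0),
    hc3 (a 2) (e 0) (w 1), hc3 (a 2) (e 1) (w 0),
    hc (a 0) (de 1 2), hc (a 0) (de 2 1), hc (a 1) (de 2 0), hc (a 1) (de 0 2),
    hc (a 2) (de 0 1), hc (a 2) (de 1 0)]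
  ring

/-- With `s = √(det m / 8)`, the cofactor matrix of `m` is `4 σ s` times the frame matrix. The
derivative from Jacobi's formula thus becomes a pairing with the frame. -/
theorem trace_adjugate_mul_div {σ : ℝ} (hσ : σ ^ 2 = 1) {m : Matrix (Fin 3) (Fin 3) ℝ}
    (hm : 0 < m.det) (d : Matrix (Fin 3) (Fin 3) ℝ) :
    (m.adjugate * d).trace / (2 * √(m.det / 8)) =
      2 * σ * ∑ c, ∑ a, frameMatrix σ m a c * d a c := by
  have hs : 0 < √(m.det / 8) := by positivity
  have h : ∑ c, ∑ a, frameMatrix σ m a c * d a c =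
      σ / (4 * √(m.det / 8)) * (m.adjugate * d).trace := by
    simp only [frameMatrix, Matrix.trace, Matrix.diag_apply, Matrix.mul_apply, Matrix.smul_apply,
      Matrix.transpose_apply, smul_eq_mul, Finset.mul_sum, mul_assoc]
  rw [h]
  calc _ = 1 * ((m.adjugate * d).trace / (2 * √(m.det / 8))) := (one_mul _).symm
    _ = _ := by rw [← hσ]; field_simp; ring

/-- Integration by parts against the constant function `1`. -/
theorem integral_fderiv_eq_zero {E : Type*} [NormedAddCommGroup E] [NormedSpace ℝ E]
    [FiniteDimensional ℝ E] [MeasurableSpace E] [BorelSpace E] {μ : Measure E}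
    [μ.IsAddHaarMeasure] {h : E → ℝ} (hd : ContDiff ℝ ∞ h) (hc : HasCompactSupport h) (v : E) :
    ∫ y, fderiv ℝ h y v ∂μ = 0 := by
  have h1 : Integrable (fun y => fderiv ℝ h y v) μ :=
    ((hd.continuous_fderiv (by simp)).clm_apply continuous_const).integrable_of_hasCompactSupport
      (hc.fderiv_apply ℝ v)
  have h2 := integral_mul_fderiv_eq_neg_fderiv_mul_of_integrable (μ := μ) (f := fun _ : E => (1 : ℝ))
    (g := h) (v := v) (by simp) (by simpa using h1)
    (by simpa using hd.continuous.integrable_of_hasCompactSupport hc) (fun _ _ => by fun_prop)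
    (fun y _ => hd.differentiable (by simp) y)
  simpa using h2

end StokesAlgebra

namespace PrincipalSU2Bundle

variable {M P : Type*} [TopologicalSpace M] [ChartedSpace (EuclideanSpace ℝ (Fin 3)) M]
  [TopologicalSpace P] [ChartedSpace (EuclideanSpace ℝ (Fin 6)) P] {B : PrincipalSU2Bundle M P}
  [IsManifold (𝓡 3) ∞ M] [IsManifold (𝓡 6) ∞ P]

namespace LocalSection

variable (S : LocalSection B)

/-- The component of the pullback of a one-form under a section. -/
def comp (A : DiffForm 6 P ℍ[ℝ] 1) (i : Fin 3) (y : EuclideanSpace ℝ (Fin 3)) : ℍ[ℝ] :=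
  pull A S.sec y (EuclideanSpace.basisFun (Fin 3) ℝ i)

/-- The components of the torsion `∇_W E` of the frame in a section. -/
def torsion (vM : DiffForm 3 M ℝ 3) (W : DiffForm 6 P ℍ[ℝ] 1) (k : Fin 3)
    (y : EuclideanSpace ℝ (Fin 3)) : ℍ[ℝ] :=
  covD W (B.frame vM W) (S.sec y) ![S.vec y (k + 1), S.vec y (k + 2)]

/-- The first variation of the volume density, up to a divergence. -/
def torsionFun (vM : DiffForm 3 M ℝ 3) (W A : DiffForm 6 P ℍ[ℝ] 1)
    (y : EuclideanSpace ℝ (Fin 3)) : ℝ :=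
  -2 * S.orient vM y * ∑ k, (S.comp A k y * S.torsion vM W k y).re

theorem contDiffAt_comp {A : DiffForm 6 P ℍ[ℝ] 1} {y : EuclideanSpace ℝ (Fin 3)}
    (hA : ContDiffAt ℝ ∞ (pull A S.sec) y) (i : Fin 3) : ContDiffAt ℝ ∞ (S.comp A i) y :=
  hA.clm_apply contDiffAt_const

/-- The real part of a product of imaginary quaternions is minus the inner product of their
components, which accounts for the sign. -/
theorem variationFun_eq {vM : DiffForm 3 M ℝ 3} (hvM : ∀ x, vM x ≠ 0) {v : DiffForm 6 P ℝ 6}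
    {W A : DiffForm 6 P ℍ[ℝ] 1} (hW : B.IsNegativeDefinite v W) {y : EuclideanSpace ℝ (Fin 3)}
    (hy : y ∈ S.dom) : S.variationFun W A y = -2 * S.orient vM y *
      ∑ c, (S.comp (B.frame vM W) c y *
        covD W A (S.sec y) ![S.vec y (c + 1), S.vec y (c + 2)]).re := by
  have hm := S.det_curvMatrix_pos hW hy
  rw [variationFun, trace_adjugate_mul_div (S.orient_sq hvM hy) hm, neg_mul, neg_mul, ← mul_neg,
    ← Finset.sum_neg_distrib]
  congr 1
  refine Finset.sum_congr rfl fun c _ => ?_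
  rw [comp, S.pull_frame hvM hW.1 hy hm c, Fin.sum_univ_three, Quaternion.re_mul]
  simp only [re_ofIm, imI_ofIm, imJ_ofIm, imK_ofIm]
  change _ * im (covD W A (S.sec y) ![S.vec y (c + 1), S.vec y (c + 2)]) 0 +
    _ * im (covD W A (S.sec y) ![S.vec y (c + 1), S.vec y (c + 2)]) 1 +
    _ * im (covD W A (S.sec y) ![S.vec y (c + 1), S.vec y (c + 2)]) 2 = _
  rw [im_apply_zero, im_apply_one, im_apply_two]
  ring

/-- Integration by parts at the level of integrands: `re_mul_covariant` trades `∇_W A` for the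
torsion. The orientation sign is locally constant, so it may stand under the derivatives. -/
theorem variationFun_eq_torsionFun_add {vM : DiffForm 3 M ℝ 3} (hvM : IsVolumeForm vM)
    {v : DiffForm 6 P ℝ 6} {W A : DiffForm 6 P ℍ[ℝ] 1} (hW : B.IsNegativeDefinite v W)
    (hA : IsSmoothForm A) {y : EuclideanSpace ℝ (Fin 3)} (hy : y ∈ S.dom) :
    S.variationFun W A y = S.torsionFun vM W A y - 2 * ∑ c : Fin 3,
      (fderiv ℝ (fun z => S.orient vM z * (S.comp (B.frame vM W) c z * S.comp A (c + 2) z).re) y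
          (EuclideanSpace.basisFun (Fin 3) ℝ (c + 1)) -
        fderiv ℝ (fun z => S.orient vM z * (S.comp (B.frame vM W) c z * S.comp A (c + 1) z).re) y
          (EuclideanSpace.basisFun (Fin 3) ℝ (c + 2))) := by
  have hE := isSmoothForm_frame hvM hW
  have hs := S.smooth_sec y hy
  have h0 : (∞ : WithTop ℕ∞) ≠ 0 := by simp
  have key : ∀ c i j, fderiv ℝ (fun z => S.orient vM z *
      (S.comp (B.frame vM W) c z * S.comp A j z).re) y (EuclideanSpace.basisFun (Fin 3) ℝ i) =
      S.orient vM y * (fderiv ℝ (pull (B.frame vM W) S.sec) y (EuclideanSpace.basisFun (Fin 3) ℝ i)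
        (EuclideanSpace.basisFun (Fin 3) ℝ c) * S.comp A j y + S.comp (B.frame vM W) c y *
        fderiv ℝ (pull A S.sec) y (EuclideanSpace.basisFun (Fin 3) ℝ i)
        (EuclideanSpace.basisFun (Fin 3) ℝ j)).re := by
    intro c i j
    have h1 := (S.contDiffAt_comp (contDiffAt_pull hE hs) c).differentiableAt h0
    have h2 := (S.contDiffAt_comp (contDiffAt_pull hA hs) j).differentiableAt h0
    have h3 : (fun z => S.orient vM z * (S.comp (B.frame vM W) c z * S.comp A j z).re) =ᶠ[𝓝 y]
        fun z => S.orient vM y * reCLM (S.comp (B.frame vM W) c z * S.comp A j z) := by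
      filter_upwards [S.eventually_orient_eq hvM hy] with z hz
      rw [hz, reCLM_apply]
    have h4 := ((reCLM.hasFDerivAt.comp y
      (h1.hasFDerivAt.mul' h2.hasFDerivAt)).const_mul (S.orient vM y)).fderiv
    change fderiv ℝ (fun z => S.orient vM y * reCLM (S.comp (B.frame vM W) c z * S.comp A j z)) y
      = _ at h4
    rw [h3.fderiv_eq, h4]
    simp only [smul_apply, ContinuousLinearMap.comp_apply, smul_eq_mul,
      add_apply, reCLM_apply]
    rw [← fderiv_pull_apply hE hs, ← fderiv_pull_apply hA hs]
    rw [add_comm (S.comp _ c y * _)]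
    rfl
  simp only [key, S.variationFun_eq hvM.2 hW hy, torsionFun, torsion, vec, S.covD_sec W hA hy,
    S.covD_sec W hE hy]
  have h := re_mul_covariant (fun i => S.comp (B.frame vM W) i y) (fun i => S.comp A i y)
    (fun i => S.comp W i y)
    (fun i j => fderiv ℝ (pull (B.frame vM W) S.sec) y (EuclideanSpace.basisFun (Fin 3) ℝ i)
        (EuclideanSpace.basisFun (Fin 3) ℝ j))
    (fun i j => fderiv ℝ (pull A S.sec) y (EuclideanSpace.basisFun (Fin 3) ℝ i)
        (EuclideanSpace.basisFun (Fin 3) ℝ j))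
  refine (congrArg (-2 * S.orient vM y * ·) h).trans ?_
  simp only [← mul_sub, ← Finset.mul_sum]
  rw [mul_add, mul_comm (-2) (S.orient vM y)]
  simp only [comp]
  ring

theorem comp_eq_zero {A : DiffForm 6 P ℍ[ℝ] 1} {C : Set M} (hAC : ∀ p, B.proj p ∉ C → A p = 0)
    {y : EuclideanSpace ℝ (Fin 3)} (hy : y ∈ S.dom) (hyC : y ∉ S.coordSet C) (i : Fin 3) :
    S.comp A i y = 0 := by
  have h : A (S.sec y) = 0 := hAC _ fun h => hyC ⟨hy, by
    rw [Set.mem_preimage, ← S.proj_sec y hy]; exact h⟩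
  rw [comp, pull_apply, h]
  rfl

/-- For variations supported in the domain of a section, the first variation of the volume is the
pairing with the torsion. -/
theorem integral_variationFun {vM : DiffForm 3 M ℝ 3} (hvM : IsVolumeForm vM)
    {v : DiffForm 6 P ℝ 6} {W A : DiffForm 6 P ℍ[ℝ] 1} (hW : B.IsNegativeDefinite v W)
    (hA : IsSmoothForm A) {C : Set M} (hC : IsCompact C) (hCS : C ⊆ S.base)
    (hAC : ∀ p, B.proj p ∉ C → A p = 0) :
    ∫ y in S.coordSet C, S.variationFun W A y = ∫ y in S.coordSet C, S.torsionFun vM W A y := by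
  have hE := isSmoothForm_frame hvM hW
  set Q := S.coordSet C with hQdef
  have hQ : IsCompact Q := S.isCompact_coordSet hC hCS
  -- Extension by zero from the domain of the section is smooth, because `A` vanishes outside `C`
  -- and the coordinate image `Q` of `C` is a compact subset of that domain.
  let h : Fin 3 → Fin 3 → EuclideanSpace ℝ (Fin 3) → ℝ := fun c j => S.dom.indicator fun z =>
    S.orient vM z * (S.comp (B.frame vM W) c z * S.comp A j z).re
  have hin : ∀ c j, ∀ y ∈ S.dom, h c j =ᶠ[𝓝 y] fun z =>
      S.orient vM z * (S.comp (B.frame vM W) c z * S.comp A j z).re := by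
    intro c j y hy
    filter_upwards [S.isOpen_dom.mem_nhds hy] with z hz using Set.indicator_of_mem hz _
  have hzero : ∀ c j, ∀ y ∉ Q, h c j y = 0 := by
    intro c j y hy
    by_cases hyd : y ∈ S.dom
    · refine (Set.indicator_of_mem hyd _).trans ?_
      rw [S.comp_eq_zero hAC hyd hy, mul_zero]
      simp
    · exact Set.indicator_of_notMem hyd _
  have hout : ∀ c j, ∀ y ∉ Q, h c j =ᶠ[𝓝 y] fun _ => 0 := by
    intro c j y hy
    filter_upwards [hQ.isClosed.isOpen_compl.mem_nhds hy] with z hz using hzero c j z hz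
  have hsmooth : ∀ c j, ContDiff ℝ ∞ (h c j) := by
    intro c j
    refine contDiff_iff_contDiffAt.2 fun y => ?_
    by_cases hy : y ∈ Q
    · refine ContDiffAt.congr_of_eventuallyEq ?_ (hin c j y hy.1)
      have h1 := S.contDiffAt_comp (contDiffAt_pull hE (S.smooth_sec y hy.1)) c
      have h2 := S.contDiffAt_comp (contDiffAt_pull hA (S.smooth_sec y hy.1)) j
      have h3 : (fun z => S.orient vM z * (S.comp (B.frame vM W) c z * S.comp A j z).re) =ᶠ[𝓝 y]
          fun z => S.orient vM y * reCLM (S.comp (B.frame vM W) c z * S.comp A j z) := by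
        filter_upwards [S.eventually_orient_eq hvM hy.1] with z hz
        rw [hz, reCLM_apply]
      refine ContDiffAt.congr_of_eventuallyEq ?_ h3
      exact contDiffAt_const.mul (reCLM.contDiff.contDiffAt.comp y (h1.mul h2))
    · exact contDiffAt_const.congr_of_eventuallyEq (hout c j y hy)
  have hcs : ∀ c j, HasCompactSupport (h c j) := fun c j =>
    HasCompactSupport.intro hQ (hzero c j)
  have hint : ∀ c j u, Integrable fun y => fderiv ℝ (h c j) y u := fun c j u =>
    (((hsmooth c j).continuous_fderiv (by simp)).clm_apply
      continuous_const).integrable_of_hasCompactSupport ((hcs c j).fderiv_apply ℝ u)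
  let g : Fin 3 → EuclideanSpace ℝ (Fin 3) → ℝ := fun c y =>
    fderiv ℝ (h c (c + 2)) y (EuclideanSpace.basisFun (Fin 3) ℝ (c + 1)) -
      fderiv ℝ (h c (c + 1)) y (EuclideanSpace.basisFun (Fin 3) ℝ (c + 2))
  have hg : ∀ c, Integrable (g c) := fun c => (hint _ _ _).sub (hint _ _ _)
  let G : EuclideanSpace ℝ (Fin 3) → ℝ := fun y => ∑ c, g c y
  have hGi : Integrable G := integrable_finsetSum _ fun c _ => hg c
  have hG0 : ∫ y, G y = 0 := by
    refine (integral_finsetSum _ fun c _ => hg c).trans (Finset.sum_eq_zero fun c _ => ?_)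
    rw [integral_sub (hint _ _ _) (hint _ _ _), integral_fderiv_eq_zero (hsmooth _ _) (hcs _ _),
      integral_fderiv_eq_zero (hsmooth _ _) (hcs _ _), sub_zero]
  have hGQ : ∫ y in Q, G y = 0 := by
    rw [setIntegral_eq_integral_of_forall_compl_eq_zero, hG0]
    intro y hy
    refine Finset.sum_eq_zero fun c _ => ?_
    simp only [g]
    rw [(hout _ _ y hy).fderiv_eq, (hout _ _ y hy).fderiv_eq]
    simp
  have hv : ∀ y ∈ Q, S.torsionFun vM W A y = S.variationFun W A y + 2 * G y := by
    intro y hy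
    rw [S.variationFun_eq_torsionFun_add hvM hW hA hy.1]
    have : G y = ∑ c : Fin 3,
      (fderiv ℝ (fun z => S.orient vM z * (S.comp (B.frame vM W) c z * S.comp A (c + 2) z).re) y
          (EuclideanSpace.basisFun (Fin 3) ℝ (c + 1)) -
        fderiv ℝ (fun z => S.orient vM z * (S.comp (B.frame vM W) c z * S.comp A (c + 1) z).re) y
          (EuclideanSpace.basisFun (Fin 3) ℝ (c + 2))) :=
      Finset.sum_congr rfl fun c _ => by
        simp only [g]
        rw [(hin c (c + 2) y hy.1).fderiv_eq, (hin c (c + 1) y hy.1).fderiv_eq]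
    rw [this]
    ring
  rw [setIntegral_congr_fun hQ.measurableSet hv, integral_add
    (S.integrableOn_variationFun hW hA hC hCS le_rfl) (hGi.integrableOn.const_mul 2),
    integral_const_mul, hGQ, mul_zero, add_zero]

end LocalSection

end PrincipalSU2Bundle

/-! ### First variation of the volume of compact sets -/

namespace PrincipalSU2Bundle

variable {M P : Type*} [TopologicalSpace M] [ChartedSpace (EuclideanSpace ℝ (Fin 3)) M]
  [TopologicalSpace P] [ChartedSpace (EuclideanSpace ℝ (Fin 6)) P] {B : PrincipalSU2Bundle M P}

theorem IsVariation.add {A A' : DiffForm 6 P ℍ[ℝ] 1} (hA : B.IsVariation A)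
    (hA' : B.IsVariation A') : B.IsVariation (A + A') where
  smooth := hA.smooth.add hA'.smooth
  lieValued p X := by
    change (A p ![X] + A' p ![X]).re = 0
    rw [Quaternion.re_add, hA.lieValued p X, hA'.lieValued p X, add_zero]
  equivariant p g X := by
    change A _ _ + A' _ _ = _ * (A p ![X] + A' p ![X]) * _
    rw [hA.equivariant p g X, hA'.equivariant p g X]
    noncomm_ring
  horizontal p X hX := by
    change A p ![X] + A' p ![X] = 0
    rw [hA.horizontal p X hX, hA'.horizontal p X hX, add_zero]

theorem isVariation_zero : B.IsVariation (0 : DiffForm 6 P ℍ[ℝ] 1) where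
  smooth x₀ := by
    have h : chartRep (0 : DiffForm 6 P ℍ[ℝ] 1) x₀ = fun _ => 0 := rfl
    rw [h]
    exact contDiffOn_const
  lieValued _ _ := rfl
  equivariant p g X := by
    change (0 : ℍ[ℝ]) = _ * 0 * _
    simp
  horizontal _ _ _ := rfl

theorem IsVariation.sum {ι : Type*} {A : ι → DiffForm 6 P ℍ[ℝ] 1} (hA : ∀ i, B.IsVariation (A i))
    (s : Finset ι) : B.IsVariation (∑ i ∈ s, A i) := by
  classical
  induction s using Finset.induction_on with
  | empty => simpa using isVariation_zero
  | insert i s hi ih => rw [Finset.sum_insert hi]; exact (hA i).add ih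

theorem smul_oneForm_eq_zero {A : DiffForm 6 P ℍ[ℝ] 1} {p : P} {c : ℝ} (h : c = 0 ∨ A p = 0) :
    c • A p = 0 := by
  ext1 X
  change c • A p X = (0 : ℍ[ℝ])
  rcases h with rfl | h
  · exact zero_smul _ _
  · rw [h]
    exact smul_zero _

theorem IsVariation.fun_smul [IsManifold (𝓡 6) ∞ P] {A : DiffForm 6 P ℍ[ℝ] 1}
    (hA : B.IsVariation A) {f : M → ℝ} (hf : ContMDiff (𝓡 3) 𝓘(ℝ, ℝ) ∞ f) :
    B.IsVariation fun p => f (B.proj p) • A p where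
  smooth x₀ := by
    have h : ContDiffOn ℝ ∞ (fun y => f (B.proj ((extChartAt (𝓡 6) x₀).symm y)))
        (extChartAt (𝓡 6) x₀).target := fun y hy =>
      (contMDiffAt_iff_contDiffAt.1 (ContMDiffAt.comp (g := fun p => f (B.proj p)) y
        (hf.comp B.contMDiff_proj).contMDiffAt
        (contMDiffAt_chart_symm x₀ hy))).contDiffWithinAt
    exact h.fun_smul (hA.smooth x₀)
  lieValued p X := by
    change (f (B.proj p) • A p ![X]).re = 0
    rw [Quaternion.re_smul, hA.lieValued p X, smul_zero]
  equivariant p g X := by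
    change f (B.proj (B.act p g)) • A _ _ = _ * (f (B.proj p) • A p ![X]) * _
    rw [hA.equivariant p g X, B.proj_act]
    simp
  horizontal p X hX := by
    change f (B.proj p) • A p ![X] = 0
    rw [hA.horizontal p X hX, smul_zero]

/-- The volume of `U` has the first variation `D`. -/
structure HasVolumeVariation [MeasurableSpace M] (B : PrincipalSU2Bundle M P) (vM : DiffForm 3 M ℝ 3)
    (W : DiffForm 6 P ℍ[ℝ] 1) (U : Set M) (D : DiffForm 6 P ℍ[ℝ] 1 → ℝ) : Prop where
  add : ∀ A A', B.IsVariation A → B.IsVariation A' → D (A + A') = D A + D A'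
  zero : ∀ A, B.IsVariation A → (∀ p, B.proj p ∈ U → covD W A p = 0) → D A = 0
  lt_top : ∀ A, B.IsVariation A → ∀ᶠ t in 𝓝 (0 : ℝ), B.baseVolume vM (W + t • A) U < ⊤
  hasDerivAt : ∀ A, B.IsVariation A →
    HasDerivAt (fun t : ℝ => (B.baseVolume vM (W + t • A) U).toReal) (D A) 0

namespace HasVolumeVariation

variable [MeasurableSpace M] {vM : DiffForm 3 M ℝ 3} {W : DiffForm 6 P ℍ[ℝ] 1} {U U' : Set M}
  {D D' : DiffForm 6 P ℍ[ℝ] 1 → ℝ}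

theorem empty : B.HasVolumeVariation vM W ∅ 0 where
  add _ _ _ _ := (add_zero _).symm
  zero _ _ _ := rfl
  lt_top A _ := by simp
  hasDerivAt A _ := by simpa using hasDerivAt_const (0 : ℝ) (0 : ℝ)

theorem union (h : B.HasVolumeVariation vM W U D) (h' : B.HasVolumeVariation vM W U' D')
    (hd : Disjoint U U') (hU' : MeasurableSet U') :
    B.HasVolumeVariation vM W (U ∪ U') (D + D') where
  add A A' hA hA' := by
    change D _ + D' _ = D A + D' A + (D A' + D' A')
    rw [h.add A A' hA hA', h'.add A A' hA hA']
    ring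
  zero A hA h0 := by
    change D A + D' A = 0
    rw [h.zero A hA fun p hp => h0 p (Or.inl hp), h'.zero A hA fun p hp => h0 p (Or.inr hp),
      add_zero]
  lt_top A hA := by
    filter_upwards [h.lt_top A hA, h'.lt_top A hA] with t ht ht'
    rw [measure_union hd hU']
    exact ENNReal.add_lt_top.2 ⟨ht, ht'⟩
  hasDerivAt A hA := by
    refine ((h.hasDerivAt A hA).fun_add (h'.hasDerivAt A hA)).congr_of_eventuallyEq ?_
    filter_upwards [h.lt_top A hA, h'.lt_top A hA] with t ht ht'
    rw [measure_union hd hU', ENNReal.toReal_add ht.ne ht'.ne]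

theorem sum (h : B.HasVolumeVariation vM W U D) [IsManifold (𝓡 6) ∞ P] {ι : Type*}
    {A : ι → DiffForm 6 P ℍ[ℝ] 1} (hA : ∀ i, B.IsVariation (A i)) (s : Finset ι) :
    D (∑ i ∈ s, A i) = ∑ i ∈ s, D (A i) := by
  classical
  induction s using Finset.induction_on with
  | empty =>
    rw [Finset.sum_empty, Finset.sum_empty]
    exact h.zero 0 isVariation_zero fun p _ =>
      covD_eq_zero_of_eventually (Filter.Eventually.of_forall fun _ => rfl)
  | insert i s hi ih =>
    rw [Finset.sum_insert hi, Finset.sum_insert hi, h.add _ _ (hA i) (IsVariation.sum hA s), ih]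

end HasVolumeVariation

variable [IsManifold (𝓡 3) ∞ M] [IsManifold (𝓡 6) ∞ P] [SecondCountableTopology M]
  [MeasurableSpace M] [BorelSpace M] {vM : DiffForm 3 M ℝ 3} {v : DiffForm 6 P ℝ 6}
  {W A : DiffForm 6 P ℍ[ℝ] 1}

theorem LocalSection.hasVolumeVariation (S : LocalSection B) (hvM : ∀ x, vM x ≠ 0)
    (hW : B.IsNegativeDefinite v W) {C U : Set M} (hC : IsCompact C) (hCS : C ⊆ S.base)
    (hUC : U ⊆ C) (hU : MeasurableSet U) :
    B.HasVolumeVariation vM W U fun A => ∫ y in S.coordSet U, S.variationFun W A y where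
  add A A' hA hA' := by
    rw [← integral_add (S.integrableOn_variationFun hW hA.smooth hC hCS hUC)
      (S.integrableOn_variationFun hW hA'.smooth hC hCS hUC)]
    exact integral_congr_ae (Filter.Eventually.of_forall fun y =>
      S.variationFun_add hA.smooth hA'.smooth y)
  zero A hA h0 := by
    refine setIntegral_eq_zero_of_forall_eq_zero fun y hy => S.variationFun_eq_zero (h0 _ ?_)
    rw [S.proj_sec y hy.1]
    exact hy.2
  lt_top A hA := (S.hasDerivAt_baseVolume hvM hW hA hC hCS hUC hU).1
  hasDerivAt A hA := (S.hasDerivAt_baseVolume hvM hW hA hC hCS hUC hU).2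

/-- Compact sets are covered by finitely many compact pieces inside sections, where the volume can
be differentiated; additivity over disjoint sets assembles the pieces. -/
theorem exists_hasVolumeVariation [T2Space M] (hvM : ∀ x, vM x ≠ 0)
    (hW : B.IsNegativeDefinite v W) {K U : Set M} (hK : IsCompact K) (hUK : U ⊆ K)
    (hU : MeasurableSet U) : ∃ D, B.HasVolumeVariation vM W U D := by
  have : LocallyCompactSpace M := ChartedSpace.locallyCompactSpace (EuclideanSpace ℝ (Fin 3)) M
  -- The claim concerns all measurable subsets of `C`, so that in the union step overlapping pieces
  -- can be cut into disjoint ones.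
  suffices h : ∃ C, K ⊆ C ∧ MeasurableSet C ∧
      ∀ U ⊆ C, MeasurableSet U → ∃ D, B.HasVolumeVariation vM W U D by
    obtain ⟨C, hKC, -, h⟩ := h
    exact h U (hUK.trans hKC) hU
  refine hK.induction_on (p := fun s => ∃ C, s ⊆ C ∧ MeasurableSet C ∧
      ∀ U ⊆ C, MeasurableSet U → ∃ D, B.HasVolumeVariation vM W U D) ?_ ?_ ?_ ?_
  · refine ⟨∅, le_rfl, MeasurableSet.empty, fun U hU _ => ⟨0, ?_⟩⟩
    rw [Set.subset_empty_iff.1 hU]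
    exact HasVolumeVariation.empty
  · rintro s t hst ⟨C, h1, h2, h3⟩
    exact ⟨C, hst.trans h1, h2, h3⟩
  · rintro s t ⟨C, h1, h2, h3⟩ ⟨C', h1', h2', h3'⟩
    refine ⟨C ∪ C', Set.union_subset_union h1 h1', h2.union h2', fun U hUC hU => ?_⟩
    obtain ⟨D, hD⟩ := h3 (U ∩ C) Set.inter_subset_right (hU.inter h2)
    obtain ⟨D', hD'⟩ := h3' (U \ C) (fun x hx => (hUC hx.1).resolve_left hx.2) (hU.diff h2)
    refine ⟨D + D', ?_⟩
    have := hD.union hD' (Set.disjoint_sdiff_right.mono_left Set.inter_subset_right) (hU.diff h2)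
    rwa [Set.inter_union_sdiff] at this
  · intro x _
    obtain ⟨p, rfl⟩ := B.proj_surjective x
    obtain ⟨S, -, hb, -⟩ := B.exists_localSection p
    obtain ⟨C, hCx, hCS, hC⟩ := local_compact_nhds (S.isOpen_base.mem_nhds hb)
    exact ⟨C, mem_nhdsWithin_of_mem_nhds hCx, C, le_rfl, hC.measurableSet, fun U hUC hU =>
      ⟨_, S.hasVolumeVariation hvM hW hC hCS hUC hU⟩⟩

/-- The first variation of the volume for variations supported in the domain of a section. -/
theorem LocalSection.hasDerivAt_baseVolume_of_support [T2Space M] (S : LocalSection B)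
    (hvM : IsVolumeForm vM) (hW : B.IsNegativeDefinite v W) (hA : B.IsVariation A) {C K : Set M}
    (hC : IsCompact C) (hCS : C ⊆ S.base) (hCK : C ⊆ K) (hK : IsCompact K)
    (hAC : ∀ p, B.proj p ∉ C → A p = 0) :
    HasDerivAt (fun t : ℝ => (B.baseVolume vM (W + t • A) K).toReal)
      (∫ y in S.coordSet C, S.torsionFun vM W A y) 0 := by
  have hCm := hC.measurableSet
  obtain ⟨D, hD⟩ := exists_hasVolumeVariation (U := K \ C) hvM.2 hW hK Set.sdiff_subset
    (hK.measurableSet.diff hCm)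
  have h1 := (S.hasVolumeVariation hvM.2 hW hC hCS le_rfl hCm).union hD
    Set.disjoint_sdiff_right (hK.measurableSet.diff hCm)
  rw [Set.union_sdiff_cancel hCK] at h1
  -- The complement of `C` is open and `A` vanishes over it, so `∇_W A` is zero there and `K \ C`
  -- contributes nothing to the first variation.
  have h2 : D A = 0 := hD.zero A hA fun p hp => by
    refine covD_eq_zero_of_eventually ?_
    have ho : IsOpen (B.proj ⁻¹' Cᶜ) :=
      hC.isClosed.isOpen_compl.preimage B.contMDiff_proj.continuous
    filter_upwards [ho.mem_nhds hp.2] with q hq using hAC q hq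
  refine (h1.hasDerivAt A hA).congr_deriv ?_
  change (∫ y in S.coordSet C, S.variationFun W A y) + D A = _
  rw [h2, add_zero, S.integral_variationFun hvM hW hA.smooth hC hCS hAC]

/-- Torsion-free connections are critical points of the volume. -/
theorem isCritical_of_covD_frame_eq_zero [T2Space M] (hvM : IsVolumeForm vM)
    (hW : B.IsNegativeDefinite v W) (h : ∀ p, covD W (B.frame vM W) p = 0) :
    B.IsCritical vM W := by
  intro A K hA hK hAK
  have : LocallyCompactSpace M := ChartedSpace.locallyCompactSpace (EuclideanSpace ℝ (Fin 3)) M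
  have hS : ∀ x : M, ∃ S : LocalSection B, x ∈ S.base := fun x => by
    obtain ⟨p, rfl⟩ := B.proj_surjective x
    obtain ⟨S, -, hb, -⟩ := B.exists_localSection p
    exact ⟨S, hb⟩
  choose S hS using hS
  obtain ⟨s, hs⟩ := hK.elim_finite_subcover (fun x => (S x).base) (fun x => (S x).isOpen_base)
    fun x _ => Set.mem_iUnion.2 ⟨x, hS x⟩
  -- The partition sums to one on `K`, and `A` vanishes outside `K`, so the pieces `f i • A` add up
  -- to `A`, each supported in one section.
  obtain ⟨f, hf⟩ := SmoothPartitionOfUnity.exists_isSubordinate (𝓡 3) hK.isClosed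
    (fun i : s => (S i).base) (fun i => (S i).isOpen_base) (by simpa [Set.iUnion_subtype] using hs)
  let Af : s → DiffForm 6 P ℍ[ℝ] 1 := fun i p => f i (B.proj p) • A p
  have hAf : ∀ i, B.IsVariation (Af i) := fun i => hA.fun_smul (f i).contMDiff
  have hsum : ∑ i, Af i = A := by
    funext p
    rw [Finset.sum_apply]
    by_cases hp : B.proj p ∈ K
    · have h1 := f.sum_eq_one hp
      rw [finsum_eq_sum_of_fintype] at h1
      refine (Finset.sum_smul (f := fun i => f i (B.proj p)) (x := A p)).symm.trans ?_
      rw [h1, one_smul]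
    · refine (Finset.sum_eq_zero fun i _ => ?_).trans (hAK p hp).symm
      change f i (B.proj p) • A p = 0
      exact smul_oneForm_eq_zero (Or.inr (hAK p hp))
  obtain ⟨D, hD⟩ := exists_hasVolumeVariation hvM.2 hW hK le_rfl hK.measurableSet
  -- Uniqueness of derivatives identifies `D` on each piece with the integral of its pairing with
  -- the torsion, which is zero; additivity of `D` then finishes.
  have hDf : ∀ i, D (Af i) = 0 := by
    intro i
    have h1 := (S i).hasDerivAt_baseVolume_of_support hvM hW (hAf i) (C := K ∩ tsupport (f i))
      (hK.inter_right (isClosed_tsupport _)) (Set.inter_subset_right.trans (hf i))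
      Set.inter_subset_left hK fun p hp => by
        change f i (B.proj p) • A p = 0
        by_cases hpK : B.proj p ∈ K
        · exact smul_oneForm_eq_zero
            (Or.inl (image_eq_zero_of_notMem_tsupport fun h => hp ⟨hpK, h⟩))
        · exact smul_oneForm_eq_zero (Or.inr (hAK p hpK))
    rw [(hD.hasDerivAt _ (hAf i)).unique h1]
    refine setIntegral_eq_zero_of_forall_eq_zero fun y _ => ?_
    rw [LocalSection.torsionFun, Finset.sum_eq_zero, mul_zero]
    intro k _
    rw [LocalSection.torsion, h]
    exact congrArg (fun q : ℍ[ℝ] => q.re) (mul_zero _)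
  have h2 := hD.hasDerivAt A hA
  rwa [← hsum, hD.sum hAf, Finset.sum_eq_zero fun i _ => hDf i, hsum] at h2

end PrincipalSU2Bundle

/-! ### Variations supported in the domain of a section -/

namespace PrincipalSU2Bundle

variable {M P : Type*} [TopologicalSpace M] [ChartedSpace (EuclideanSpace ℝ (Fin 3)) M]
  [TopologicalSpace P] [ChartedSpace (EuclideanSpace ℝ (Fin 6)) P] {B : PrincipalSU2Bundle M P}
  [IsManifold (𝓡 3) ∞ M]

namespace LocalSection

variable (S : LocalSection B)

theorem grp_act_right {p : P} (hp : B.proj p ∈ S.base) (g : SU2) :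
    S.grp (B.act p g) = S.grp p * g := by
  have h := S.grp_act (S.coord p) (S.coord_mem hp) (S.grp p * g)
  rwa [B.act_mul, S.act_sec_coord hp] at h

theorem dcoord_dact {p : P} (hp : B.proj p ∈ S.base) (g : SU2) (X : EuclideanSpace ℝ (Fin 6)) :
    S.dcoord (B.act p g) (B.dact g p X) = S.dcoord p X := by
  have h := mfderiv_comp p (I := 𝓡 6) (I' := 𝓡 6) (I'' := 𝓘(ℝ, EuclideanSpace ℝ (Fin 3)))
    (g := S.coord) (f := fun q => B.act q g)
    ((S.contMDiffAt_coord (by rwa [B.proj_act])).mdifferentiableAt (by simp))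
    ((B.contMDiff_act_right _).mdifferentiableAt (by simp))
  have h4 : S.coord ∘ (fun q => B.act q g) = S.coord := funext fun q => S.coord_act q g
  rw [h4] at h
  exact (congrArg (fun T => T X) h).symm

open Classical in
/-- The horizontal equivariant one-form with a given pullback under a section, extended by zero. -/
def extend (α : EuclideanSpace ℝ (Fin 3) → EuclideanSpace ℝ (Fin 3) →L[ℝ] ℍ[ℝ]) :
    DiffForm 6 P ℍ[ℝ] 1 := fun p =>
  (if B.proj p ∈ S.base then
    ContinuousAlternatingMap.ofSubsingleton ℝ (EuclideanSpace ℝ (Fin 6)) ℍ[ℝ] (0 : Fin 1)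
      (LinearMap.toContinuousLinearMap (LinearMap.mulRight ℝ (S.grp p : ℍ[ℝ]) ∘ₗ
        LinearMap.mulLeft ℝ (((S.grp p)⁻¹ : SU2) : ℍ[ℝ]) ∘ₗ (α (S.coord p)).toLinearMap ∘ₗ
        (S.dcoord p).toLinearMap))
  else 0 : EuclideanSpace ℝ (Fin 6) [⋀^Fin 1]→L[ℝ] ℍ[ℝ])

variable {α : EuclideanSpace ℝ (Fin 3) → EuclideanSpace ℝ (Fin 3) →L[ℝ] ℍ[ℝ]}

theorem extend_apply {p : P} (hp : B.proj p ∈ S.base) (X : EuclideanSpace ℝ (Fin 6)) :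
    S.extend α p ![X] =
      (((S.grp p)⁻¹ : SU2) : ℍ[ℝ]) * α (S.coord p) (S.dcoord p X) * (S.grp p : ℍ[ℝ]) := by
  rw [extend, if_pos hp]
  rfl

theorem extend_of_notMem {p : P} (hp : B.proj p ∉ S.base) : S.extend α p = 0 := by
  rw [extend, if_neg hp]
  rfl

theorem extend_eq_zero {p : P} (h : B.proj p ∈ S.base → α (S.coord p) = 0) :
    S.extend α p = 0 := by
  by_cases hp : B.proj p ∈ S.base
  · ext1 X
    have hX : X = ![X 0] := by ext1 i; fin_cases i; rfl
    rw [hX]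
    refine (S.extend_apply hp (X 0)).trans ?_
    rw [h hp]
    change _ * (0 : ℍ[ℝ]) * _ = 0
    simp
  · exact S.extend_of_notMem hp

theorem pull_extend {y : EuclideanSpace ℝ (Fin 3)} (hy : y ∈ S.dom) :
    pull (S.extend α) S.sec y = α y := by
  ext1 u
  rw [pull_apply, S.extend_apply (S.proj_sec_mem_base hy), S.grp_sec hy, S.coord_sec hy,
    S.dcoord_dsec hy, inv_one]
  change (1 : ℍ[ℝ]) * α y u * 1 = _
  rw [one_mul, mul_one]

/-- Over the domain of `S` smoothness is seen in `S` itself. Over any other point lies a section `T`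
along which the form is locally zero, since `C` is closed. -/
theorem isVariation_extend [IsManifold (𝓡 6) ∞ P] [T2Space M] (hα : ContDiff ℝ ∞ α)
    (hr : ∀ y u, (α y u).re = 0) {C : Set M} (hC : IsCompact C) (hCS : C ⊆ S.base)
    (h0 : ∀ y, S.chart.symm y ∉ C → α y = 0) : B.IsVariation (S.extend α) := by
  have hz : ∀ p, B.proj p ∉ C → S.extend α p = 0 := fun p hp =>
    S.extend_eq_zero fun hb => h0 _ (by rwa [S.chart_symm_coord hb])
  have hh : ∀ p, B.IsHorizontalAt p (S.extend α p) := by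
    intro p X hX
    by_cases hp : B.proj p ∈ S.base
    · refine (S.extend_apply hp X).trans ?_
      rw [S.dcoord_eq_zero hp hX, map_zero]
      simp
    · rw [S.extend_of_notMem hp]
      rfl
  have he : B.IsEquivariant (S.extend α) := by
    intro p g X
    by_cases hp : B.proj p ∈ S.base
    · have hp' : B.proj (B.act p g) ∈ S.base := by rwa [B.proj_act]
      refine (S.extend_apply hp' _).trans ?_
      have h1 : S.dcoord (B.act p g) (mfderiv (𝓡 6) (𝓡 6) (fun q => B.act q g) p X) =
          S.dcoord p X := S.dcoord_dact hp g X
      rw [h1, S.coord_act, S.grp_act_right hp, mul_inv_rev]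
      refine Eq.trans ?_ (congrArg (fun q => ((g⁻¹ : SU2) : ℍ[ℝ]) * q * (g : ℍ[ℝ]))
        (S.extend_apply hp X)).symm
      change (((g⁻¹ : SU2) : ℍ[ℝ]) * (((S.grp p)⁻¹ : SU2) : ℍ[ℝ])) * _ *
        ((S.grp p : ℍ[ℝ]) * (g : ℍ[ℝ])) = _
      noncomm_ring
    · have hp' : B.proj (B.act p g) ∉ S.base := by rwa [B.proj_act]
      rw [S.extend_of_notMem hp, S.extend_of_notMem hp']
      change (0 : ℍ[ℝ]) = _ * 0 * _
      simp
  refine ⟨isSmoothForm_of_sections he hh fun p => ?_, fun p X => ?_, he, hh⟩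
  · by_cases hp : B.proj p ∈ S.base
    · refine ⟨S, hp, hα.contDiffAt.congr_of_eventuallyEq ?_⟩
      filter_upwards [S.isOpen_dom.mem_nhds (S.coord_mem hp)] with y hy using S.pull_extend hy
    · obtain ⟨T, -, hb, -⟩ := B.exists_localSection p
      refine ⟨T, hb, (contDiffAt_const (c := 0)).congr_of_eventuallyEq ?_⟩
      have hc : ContinuousAt T.chart.symm (T.coord p) :=
        T.continuousOn_chart_symm.continuousAt (T.isOpen_dom.mem_nhds (T.coord_mem hb))
      have hpC : T.chart.symm (T.coord p) ∈ Cᶜ := by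
        rw [T.chart_symm_coord hb]; exact fun h => hp (hCS h)
      filter_upwards [T.isOpen_dom.mem_nhds (T.coord_mem hb),
        hc.preimage_mem_nhds (hC.isClosed.isOpen_compl.mem_nhds hpC)] with y hy hyC
      ext1 u
      rw [pull_apply, hz _ (by rw [T.proj_sec y hy]; exact hyC)]
      rfl
  · by_cases hp : B.proj p ∈ S.base
    · exact (congrArg (fun q : ℍ[ℝ] => q.re) (S.extend_apply hp X)).trans
        ((re_conj_SU2 _ _).trans (hr _ _))
    · rw [S.extend_of_notMem hp]
      rfl

variable [IsManifold (𝓡 6) ∞ P] {vM : DiffForm 3 M ℝ 3} {v : DiffForm 6 P ℝ 6}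
  {W : DiffForm 6 P ℍ[ℝ] 1}

theorem continuousAt_torsion (hvM : IsVolumeForm vM) (hW : B.IsNegativeDefinite v W)
    {y : EuclideanSpace ℝ (Fin 3)} (hy : y ∈ S.dom) (k : Fin 3) :
    ContinuousAt (S.torsion vM W k) y := by
  have hE := isSmoothForm_frame hvM hW
  set u := EuclideanSpace.basisFun (Fin 3) ℝ (k + 1)
  set w := EuclideanSpace.basisFun (Fin 3) ℝ (k + 2)
  have h1 : S.torsion vM W k =ᶠ[𝓝 y] fun y =>
      fderiv ℝ (pull (B.frame vM W) S.sec) y u w - fderiv ℝ (pull (B.frame vM W) S.sec) y w u +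
        (pull W S.sec y u * pull (B.frame vM W) S.sec y w -
          pull W S.sec y w * pull (B.frame vM W) S.sec y u) +
        (pull (B.frame vM W) S.sec y u * pull W S.sec y w -
          pull (B.frame vM W) S.sec y w * pull W S.sec y u) := by
    filter_upwards [S.isOpen_dom.mem_nhds hy] with z hz
    rw [← S.covD_sec W hE hz]
    rfl
  refine ContinuousAt.congr ?_ h1.symm
  have h2 := (contDiffAt_pull hW.1.smooth (S.smooth_sec y hy)).continuousAt
  have h3 := contDiffAt_pull hE (S.smooth_sec y hy)
  have h4 : ContinuousAt (fderiv ℝ (pull (B.frame vM W) S.sec)) y :=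
    (h3.fderiv_right (m := ∞) (by simp)).continuousAt
  have h5 := h3.continuousAt
  fun_prop

theorem re_torsion (hvM : IsVolumeForm vM) (hW : B.IsNegativeDefinite v W)
    (k : Fin 3) (y : EuclideanSpace ℝ (Fin 3)) : (S.torsion vM W k y).re = 0 :=
  re_covD (isSmoothForm_frame hvM hW)
    (fun p => (hasFrame_of_isNegativeDefinite hvM.2 hW p).isFrameAt.lieValued) _ _ _

/-- The covariant derivative of the frame is horizontal and imaginary, so its three components on
the section vectors determine it. -/
theorem covD_frame_eq_zero (hvM : IsVolumeForm vM) (hW : B.IsNegativeDefinite v W)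
    {y : EuclideanSpace ℝ (Fin 3)} (hy : y ∈ S.dom) (h : ∀ k, S.torsion vM W k y = 0) :
    covD W (B.frame vM W) (S.sec y) = 0 := by
  have hf := hasFrame_of_isNegativeDefinite hvM.2 hW
  refine horizontal_twoForm_ext (V := EuclideanSpace ℝ (Fin 6)) (B.dproj (S.sec y)).toLinearMap
    (S.vec y) (chartBasis S.center (S.dom_subset hy)) (S.dproj_vec hy)
    (fun Y Z hY => covD_horizontal hW.1 (isSmoothForm_frame hvM hW)
      (isEquivariant_frame hW.1 hf) (fun p => (hf p).isFrameAt.horizontal) _ _ _ hY)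
    (fun _ _ _ => rfl)
    (fun Y Z => re_covD (isSmoothForm_frame hvM hW) (fun p => (hf p).isFrameAt.lieValued) _ _ _)
    (fun _ _ => rfl) ?_
  ext a k
  change im (S.torsion vM W k y) a = im 0 a
  rw [h k]

variable [SecondCountableTopology M] [T2Space M] [MeasurableSpace M] [BorelSpace M]

/-- The fundamental lemma of the calculus of variations, with the variation pointing in the
direction of the torsion component at `y₀`. -/
theorem torsion_eq_zero (hvM : IsVolumeForm vM) (hW : B.IsNegativeDefinite v W)
    (hcrit : B.IsCritical vM W) {y₀ : EuclideanSpace ℝ (Fin 3)} (hy₀ : y₀ ∈ S.dom) (k : Fin 3) :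
    S.torsion vM W k y₀ = 0 := by
  by_contra hq0
  set q := S.torsion vM W k y₀ with hq
  have hqr : q.re = 0 := S.re_torsion hvM hW k y₀
  -- This is the inner product of `q` with the torsion component. At `y₀` it is the squared norm of
  -- `q`, hence positive nearby.
  let g : EuclideanSpace ℝ (Fin 3) → ℝ := fun y => -reCLM (q * S.torsion vM W k y)
  have hg : ∀ y ∈ S.dom, ContinuousAt g y := fun y hy =>
    (reCLM.continuous.continuousAt.comp (continuousAt_const.mul
      (S.continuousAt_torsion hvM hW hy k))).neg
  have hg0 : 0 < g y₀ := by
    have h1 : g y₀ = Quaternion.normSq q := by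
      change -(q * q).re = _
      rw [Quaternion.normSq_def', Quaternion.re_mul, hqr]
      ring
    rw [h1]
    exact lt_of_le_of_ne Quaternion.normSq_nonneg (Ne.symm (Quaternion.normSq_ne_zero.2 hq0))
  obtain ⟨r, hr, hball⟩ := Metric.nhds_basis_closedBall.eventually_iff.1
    (((S.isOpen_dom.eventually_mem hy₀).and ((hg y₀ hy₀).eventually (lt_mem_nhds hg0))).and
      (S.eventually_orient_eq hvM hy₀))
  set Q := Metric.closedBall y₀ r with hQ
  have hQc : IsCompact Q := isCompact_closedBall y₀ r
  have hQd : Q ⊆ S.dom := fun y hy => (hball hy).1.1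
  -- The outer radius is `r`, so `φ` is positive on the ball of radius `r` and vanishes outside it,
  -- keeping the support in `Q`.
  let φ : ContDiffBump y₀ := ⟨r / 2, r, by positivity, by linarith⟩
  set C : Set M := S.chart.symm '' Q with hCdef
  have hC : IsCompact C := hQc.image_of_continuousOn (S.continuousOn_chart_symm.mono hQd)
  have hCS : C ⊆ S.base := by
    rintro _ ⟨y, hy, rfl⟩
    exact S.chart_symm_mem_base (hQd hy)
  have hCQ : S.coordSet C = Q := by
    rw [S.coordSet_eq_image hCS, hCdef, Set.image_image]
    refine (Set.image_congr fun y hy => ?_).trans (Set.image_id Q)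
    exact S.chart.right_inv (S.dom_subset (hQd hy))
  -- Only the `k`-th component of the variation is nonzero, so a single term of the pairing with the
  -- torsion survives.
  let α : EuclideanSpace ℝ (Fin 3) → EuclideanSpace ℝ (Fin 3) →L[ℝ] ℍ[ℝ] := fun y =>
    (φ y • (EuclideanSpace.proj k : EuclideanSpace ℝ (Fin 3) →L[ℝ] ℝ)).smulRight q
  have hα0 : ∀ y, S.chart.symm y ∉ C → α y = 0 := by
    intro y hy
    have h1 : φ y = 0 := φ.zero_of_le_dist (not_lt.1 fun h => hy ⟨y, Metric.mem_closedBall.2 h.le, rfl⟩)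
    ext1 u
    simp [α, h1]
  have hA : B.IsVariation (S.extend α) := S.isVariation_extend
    (ContDiff.smulRight (φ.contDiff.fun_smul contDiff_const) contDiff_const) (fun y u => by simp [α, hqr]) hC hCS hα0
  have hAC : ∀ p, B.proj p ∉ C → S.extend α p = 0 := fun p hp =>
    S.extend_eq_zero fun hb => hα0 _ (by rwa [S.chart_symm_coord hb])
  -- Criticality is used with the compact set `C` itself: the derivative, which is the torsion
  -- integral over `C`, must be zero.
  have h1 := (S.hasDerivAt_baseVolume_of_support hvM hW hA hC hCS le_rfl hC hAC).unique
    (hcrit _ C hA hC hAC)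
  have h2 : ∀ y ∈ Q, S.torsionFun vM W (S.extend α) y = 2 * S.orient vM y₀ * (φ y * g y) := by
    intro y hy
    have hc : ∀ j, S.comp (S.extend α) j y = if j = k then φ y • q else 0 := by
      intro j
      rw [LocalSection.comp, S.pull_extend (hQd hy)]
      by_cases hj : j = k
      · subst hj; simp [α]
      · simp [α, hj, Ne.symm hj]
    rw [torsionFun, (hball hy).2, Finset.sum_eq_single k]
    · rw [hc, if_pos rfl, smul_mul_assoc]
      change _ * (φ y * (q * S.torsion vM W k y).re) = _ * (φ y * -(q * S.torsion vM W k y).re)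
      ring
    · intro j _ hj
      rw [hc, if_neg hj, zero_mul]
      rfl
    · simp
  rw [hCQ, setIntegral_congr_fun hQc.measurableSet h2, integral_const_mul] at h1
  have hσ : 2 * S.orient vM y₀ ≠ 0 := by
    intro h
    have h3 := S.orient_sq hvM.2 hy₀
    rw [show S.orient vM y₀ = 0 by linarith] at h3
    norm_num at h3
  have h3 := (mul_eq_zero.1 h1).resolve_left hσ
  have hi : IntegrableOn (fun y => φ y * g y) Q :=
    ContinuousOn.integrableOn_compact hQc fun y hy =>
      (φ.continuous.continuousAt.mul (hg y (hQd hy))).continuousWithinAt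
  -- The integrand is nonnegative on `Q` and positive on the open ball, which has positive measure.
  have hpos : 0 < ∫ y in Q, φ y * g y := by
    rw [setIntegral_pos_iff_support_of_nonneg_ae ?_ hi]
    · refine lt_of_lt_of_le (Metric.measure_ball_pos volume y₀ hr) (measure_mono fun y hy => ?_)
      have hyQ : y ∈ Q := Metric.ball_subset_closedBall hy
      exact ⟨mul_ne_zero (φ.pos_of_mem_ball hy).ne' (hball hyQ).1.2.ne', hyQ⟩
    · filter_upwards [ae_restrict_mem hQc.measurableSet] with y hy
      exact mul_nonneg φ.nonneg (hball hy).1.2.le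
  exact hpos.ne' h3

end LocalSection

/-- A connection is a critical point of the volume if and only if its frame is torsion-free. -/
theorem isCritical_iff [IsManifold (𝓡 6) ∞ P] [SecondCountableTopology M] [T2Space M]
    [MeasurableSpace M] [BorelSpace M] {vM : DiffForm 3 M ℝ 3} {v : DiffForm 6 P ℝ 6}
    {W : DiffForm 6 P ℍ[ℝ] 1} (hvM : IsVolumeForm vM) (hW : B.IsNegativeDefinite v W) :
    B.IsCritical vM W ↔ ∀ p, covD W (B.frame vM W) p = 0 := by
  refine ⟨fun hcrit p => ?_, isCritical_of_covD_frame_eq_zero hvM hW⟩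
  obtain ⟨S, -, hb, hp⟩ := B.exists_localSection p
  rw [← hp]
  exact S.covD_frame_eq_zero hvM hW (S.coord_mem hb)
    fun k => S.torsion_eq_zero hvM hW hcrit (S.coord_mem hb) k

end PrincipalSU2Bundle

end HitchinGravity

end

theorem proposition3 {M P : Type*}
    [TopologicalSpace M] [ChartedSpace (EuclideanSpace ℝ (Fin 3)) M] [IsManifold (𝓡 3) ∞ M]
    [T2Space M] [SecondCountableTopology M] [MeasurableSpace M] [BorelSpace M]
    [TopologicalSpace P] [ChartedSpace (EuclideanSpace ℝ (Fin 6)) P] [IsManifold (𝓡 6) ∞ P]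
    [T2Space P] [SecondCountableTopology P] [MeasurableSpace P] [BorelSpace P]
    (B : PrincipalSU2Bundle M P)
    (vM : DiffForm 3 M ℝ 3) (hvM : IsVolumeForm vM)
    (vP : DiffForm 6 P ℝ 6) (hvP : IsVolumeForm vP)
    (W : DiffForm 6 P ℍ[ℝ] 1) (hW : B.IsNegativeDefinite vP W) :
    (IsSmoothForm (B.frame vM W) ∧ B.IsEquivariant (B.frame vM W) ∧
      ∀ p e, B.IsFrameAt vM W p e ↔ e = B.frame vM W p) ∧
    (0 < fibreVolume ∧ fibreVolume < ⊤ ∧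
      hitchinFunctional vP (chernSimons W) = fibreVolume * B.baseVolume vM W Set.univ) ∧
    (B.IsCritical vM W ↔ ∀ p, covD W (B.frame vM W) p = 0) := by
  exact ⟨⟨PrincipalSU2Bundle.isSmoothForm_frame hvM hW,
      PrincipalSU2Bundle.isEquivariant_frame hW.1
        (PrincipalSU2Bundle.hasFrame_of_isNegativeDefinite hvM.2 hW),
      PrincipalSU2Bundle.hasFrame_of_isNegativeDefinite hvM.2 hW⟩,
    ⟨fibreVolume_pos, fibreVolume_lt_top,
      PrincipalSU2Bundle.hitchinFunctional_chernSimons hvM.2 hvP.2 hW⟩,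
    PrincipalSU2Bundle.isCritical_iff hvM hW⟩
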